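/- Let $X$ be a Dedekind scheme (that is, Noetherian, regular, irreducible and of dimension $\le 1$) with function field $F$, let $G$ be a finite group and let $i\ge 1$ be an integer such that $\gcd(i,|G|)$ is invertible on $X$. A coherent $\mathcal{O}_XG$-module is a coherent $\mathcal{O}_X$-module with an action of $G$ by $\mathcal{O}_X$-homomorphisms; it is called locally projective (resp. locally free) if all its stalks $\mathcal{P}_x$ are projective (resp. free) over $\mathcal{O}_{X,x}G$. Let $K_0(\mathcal{O}_XG)$ (resp. $K_0^{\rm lf}(\mathcal{O}_XG)$) be the Grothendieck group of the locally projective (resp. locally free) coherent $\mathcal{O}_XG$-modules, with respect to short exact sequences, let $K_0^{\rm lf}(FG)$ be the Grothendieck group of the finitely generated free $FG$-modules, and let $$\mathrm{Cl}(\mathcal{O}_XG):=\ker\bigl(K_0^{\rm lf}(\mathcal{O}_XG)\to K_0^{\rm lf}(FG)\bigr)$$ be the locally free class group. For $n\ge 1$ let $\mathcal{M}_n$ be the smallest full subcategory of the category of coherent $\mathcal{O}_XG$-modules that is closed under extensions and kernels of epimorphisms and that contains all modules $\mathrm{Sym}^{i_1}(\mathcal{P}_1)\otimes_{\mathcal{O}_X}\cdots\otimes_{\mathcal{O}_X}\mathrm{Sym}^{i_r}(\mathcal{P}_r)$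 (with diagonal action) with $\mathcal{P}_1,\dots,\mathcal{P}_r$ locally projective and $i_1+\cdots+i_r=n$. Then the tensor product over $\mathcal{O}_X$ with diagonal action induces a multiplication on $K_0(\mathcal{O}_XG)$ and products $K_0(\mathcal{M}_a)\times K_0(\mathcal{M}_b)\to K_0(\mathcal{M}_{a+b})$ for $a,b\ge1$; there is a unique homomorphism $$\sigma=\Bigl(1+\sum_{n\ge 1}\sigma^n t^n\Bigr)\colon K_0(\mathcal{O}_XG)\to 1+\prod_{n\ge 1}K_0(\mathcal{M}_n)t^n$$ into the multiplicative group of power series with $\sigma^n([\mathcal{P}])=[\mathrm{Sym}^n_{\mathcal{O}_X}(\mathcal{P})]$ for all locally projective $\mathcal{P}$; every object of $\mathcal{M}_i$ is locally projective, so that $\sigma^i$ may be regarded as a map $K_0(\mathcal{O}_XG)\to K_0(\mathcal{M}_i)\to K_0(\mathcal{O}_XG)$; and the canonical homomorphism $\kappa\colon\mathrm{Cl}(\mathcal{O}_XG)\to K_0(\mathcal{O}_XG)$ is injective. Moreover: 1. The multiplication induced on $\mathrm{Cl}(\mathcal{O}_XG)$ is trivial: $\kappa(x)\cdot\kappa(y)=0$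 for all $x,y\in\mathrm{Cl}(\mathcal{O}_XG)$. 2. The operation $\sigma^i$ restricts to $\mathrm{Cl}(\mathcal{O}_XG)$ (that is, $\sigma^i(\kappa(x))\in\kappa(\mathrm{Cl}(\mathcal{O}_XG))$ for all $x\in \mathrm{Cl}(\mathcal{O}_XG)$), and the resulting map $\sigma^i\colon\mathrm{Cl}(\mathcal{O}_XG)\to\mathrm{Cl}(\mathcal{O}_XG)$ is a group homomorphism. -/

import Mathlib

open AlgebraicGeometry TensorProduct

universe u v w

noncomputable section

/-! ### Symmetric powers of a module -/

namespace SymPow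

variable {R S T : Type u} [CommRing R] [CommRing S] [CommRing T]
  {M N L : Type u} [AddCommGroup M] [AddCommGroup N] [AddCommGroup L]
  [Module R M] [Module S N] [Module T L]

/-- The ring homomorphism `Sym_R(M) → Sym_S(N)` induced by a semilinear map `M → N`. -/
def algMap (φ : R →+* S) (f : M →ₛₗ[φ] N) : SymmetricAlgebra R M →+* SymmetricAlgebra S N :=
  letI : Algebra R (SymmetricAlgebra S N) :=
    ((algebraMap S (SymmetricAlgebra S N)).comp φ).toAlgebra
  (SymmetricAlgebra.lift (R := R) (A := SymmetricAlgebra S N)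
    { toFun := fun m => SymmetricAlgebra.ι S N (f m)
      map_add' := fun a b => by simp
      map_smul' := fun r a => by
        simp only [map_smulₛₗ, RingHom.id_apply, Algebra.smul_def]
        rfl }).toRingHom

theorem algMap_ι (φ : R →+* S) (f : M →ₛₗ[φ] N) (m : M) :
    algMap φ f (SymmetricAlgebra.ι R M m) = SymmetricAlgebra.ι S N (f m) := by
  let _ : Algebra R (SymmetricAlgebra S N) :=
    ((algebraMap S (SymmetricAlgebra S N)).comp φ).toAlgebra
  exact SymmetricAlgebra.lift_ι_apply _ m

theorem algMap_algebraMap (φ : R →+* S) (f : M →ₛₗ[φ] N) (r : R) :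
    algMap φ f (algebraMap R _ r) = algebraMap S _ (φ r) := by
  let _ : Algebra R (SymmetricAlgebra S N) :=
    ((algebraMap S (SymmetricAlgebra S N)).comp φ).toAlgebra
  exact AlgHom.commutes _ r

theorem algMap_smul (φ : R →+* S) (f : M →ₛₗ[φ] N) (r : R) (x : SymmetricAlgebra R M) :
    algMap φ f (r • x) = φ r • algMap φ f x := by
  rw [Algebra.smul_def, map_mul, algMap_algebraMap, Algebra.smul_def]

theorem algMap_self (φ : R →+* R) (f : M →ₛₗ[φ] M) (hφ : ∀ r, φ r = r) (hf : ∀ m, f m = m)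
    (x : SymmetricAlgebra R M) : algMap φ f x = x := by
  induction x using SymmetricAlgebra.induction with
  | algebraMap r => rw [algMap_algebraMap, hφ]
  | ι m => rw [algMap_ι, hf]
  | mul a b ha hb => rw [map_mul, ha, hb]
  | add a b ha hb => rw [map_add, ha, hb]

theorem algMap_comp (φ : R →+* S) (ψ : S →+* T) (χ : R →+* T) (f : M →ₛₗ[φ] N) (g : N →ₛₗ[ψ] L)
    (h : M →ₛₗ[χ] L) (hχ : ∀ r, χ r = ψ (φ r)) (hh : ∀ m, h m = g (f m))
    (x : SymmetricAlgebra R M) : algMap ψ g (algMap φ f x) = algMap χ h x := by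
  induction x using SymmetricAlgebra.induction with
  | algebraMap r => simp only [algMap_algebraMap, hχ]
  | ι m => simp only [algMap_ι, hh]
  | mul a b ha hb => simp only [map_mul, ha, hb]
  | add a b ha hb => simp only [map_add, ha, hb]

variable (R M) in
/-- The `n`-th symmetric power `Sym^n_R(M)`: the degree `n` part of the symmetric algebra, i.e. the
`R`-span of the `n`-fold products of elements of `M`. -/
abbrev part (n : ℕ) : Submodule R (SymmetricAlgebra R M) :=
  LinearMap.range (SymmetricAlgebra.ι R M) ^ n

theorem algMap_mem (φ : R →+* S) (f : M →ₛₗ[φ] N) (n : ℕ) {x : SymmetricAlgebra R M}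
    (hx : x ∈ part R M n) : algMap φ f x ∈ part S N n := by
  induction hx using Submodule.pow_induction_on_left' with
  | algebraMap r =>
    rw [algMap_algebraMap]
    simp
  | add x y i hx hy ihx ihy => rw [map_add]; exact add_mem ihx ihy
  | mem_mul m hm i x hx ih =>
    obtain ⟨m, rfl⟩ := hm
    rw [map_mul, algMap_ι, part, Nat.succ_eq_add_one, pow_succ']
    exact Submodule.mul_mem_mul ⟨_, rfl⟩ ih

/-- The semilinear map `Sym^n_R(M) → Sym^n_S(N)` induced by a semilinear map `M → N`. -/
def map (φ : R →+* S) (f : M →ₛₗ[φ] N) (n : ℕ) : part R M n →ₛₗ[φ] part S N n where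
  toFun x := ⟨algMap φ f x.1, algMap_mem φ f n x.2⟩
  map_add' _ _ := Subtype.ext (map_add _ _ _)
  map_smul' r x := Subtype.ext (algMap_smul φ f r x.1)

end SymPow

/-! ### Coherent modules with an action of a finite group -/

/-- Restriction of functions between affine open subsets. -/
def resHom {X : Scheme.{u}} {U V : X.affineOpens} (h : V ≤ U) :
    Γ(X, U.1) →+* Γ(X, V.1) :=
  (X.presheaf.map (CategoryTheory.homOfLE (show V.1 ≤ U.1 from h)).op).hom

theorem resHom_self {X : Scheme.{u}} (U : X.affineOpens) (r : Γ(X, U.1)) :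
    resHom (le_refl U) r = r := by
  have : (CategoryTheory.homOfLE (le_refl U.1)).op = CategoryTheory.CategoryStruct.id _ := rfl
  unfold resHom
  rw [this, X.presheaf.map_id]
  rfl

theorem resHom_comp {X : Scheme.{u}} {U V W : X.affineOpens} (h : V ≤ U) (h' : W ≤ V)
    (r : Γ(X, U.1)) : resHom (h'.trans h) r = resHom h' (resHom h r) := by
  unfold resHom
  rw [← CommRingCat.comp_apply, ← X.presheaf.map_comp]
  rfl

/-- An `O_X`-module with an `O_X`-linear action of the group `G`, given by its modules of sections
over the affine open subsets of `X`, the restriction maps between them, and the action of `G`.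
Together with the condition `OXGMod.IsQuasicoherent` below, this is the description of
quasi-coherent sheaves (with an action of `G` by `O_X`-homomorphisms) by compatible modules on the
affine open subsets. -/
structure OXGMod (X : Scheme.{u}) (G : Type v) [Group G] where
  /-- sections over an affine open subset -/
  sec : X.affineOpens → Type u
  [grp : ∀ U, AddCommGroup (sec U)]
  [mod : ∀ U, Module Γ(X, U.1) (sec U)]
  /-- restriction -/
  res : ∀ {U V : X.affineOpens} (h : V ≤ U), sec U →ₛₗ[resHom h] sec V
  res_self : ∀ (U : X.affineOpens) (m : sec U), res (le_refl U) m = m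
  res_comp : ∀ {U V W : X.affineOpens} (h : V ≤ U) (h' : W ≤ V) (m : sec U),
    res (h'.trans h) m = res h' (res h m)
  /-- the action of `G` on sections -/
  rho : ∀ U, Representation Γ(X, U.1) G (sec U)
  rho_res : ∀ {U V : X.affineOpens} (h : V ≤ U) (g : G) (m : sec U),
    res h (rho U g m) = rho V g (res h m)

attribute [instance] OXGMod.grp OXGMod.mod

namespace OXGMod

variable {X : Scheme.{u}} {G : Type v} [Group G]

/-- Quasi-coherence: for affine open subsets `V ⊆ U`, restriction identifies `P(V)` with
`O_X(V) ⊗_{O_X(U)} P(U)`. -/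
def IsQuasicoherent (P : OXGMod X G) : Prop :=
  ∀ (U V : X.affineOpens) (h : V ≤ U),
    letI : Algebra Γ(X, U.1) Γ(X, V.1) := (resHom h).toAlgebra
    letI : Module Γ(X, U.1) (P.sec V) := Module.compHom _ (resHom h)
    haveI : IsScalarTower Γ(X, U.1) Γ(X, V.1) (P.sec V) := ⟨fun r s m => mul_smul (resHom h r) s m⟩
    IsBaseChange Γ(X, V.1)
      ({ toFun := P.res h
         map_add' := map_add _
         map_smul' := fun r m => map_smulₛₗ (P.res h) r m } : P.sec U →ₗ[Γ(X, U.1)] P.sec V)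

/-- Coherence over a Noetherian scheme: quasi-coherent, with finitely generated modules of sections
over all affine open subsets. -/
def IsCoherent (P : OXGMod X G) : Prop :=
  P.IsQuasicoherent ∧ ∀ U : X.affineOpens, Module.Finite Γ(X, U.1) (P.sec U)

/-- The stalk `P_x = O_{X,x} ⊗_{O_X(U)} P(U)` at a point `x` of the affine open subset `U`, with the
induced action of `G`. -/
def stalkRep (P : OXGMod X G) (U : X.affineOpens) (x : U.1) :
    Representation (X.presheaf.stalk x.1) G (X.presheaf.stalk x.1 ⊗[Γ(X, U.1)] P.sec U) :=
  ((Module.End.baseChangeHom Γ(X, U.1) (X.presheaf.stalk x.1) (P.sec U) :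
    Module.End Γ(X, U.1) (P.sec U) →* _)).comp (P.rho U)

/-- `P` is coherent and all stalks `P_x` are projective over the group ring `O_{X,x}G`. -/
def LocallyProjective (P : OXGMod X G) : Prop :=
  P.IsCoherent ∧ ∀ (U : X.affineOpens) (x : U.1),
    Module.Projective (MonoidAlgebra (X.presheaf.stalk x.1) G) (P.stalkRep U x).asModule

/-- `P` is coherent and all stalks `P_x` are free over the group ring `O_{X,x}G`. -/
def LocallyFree (P : OXGMod X G) : Prop :=
  P.IsCoherent ∧ ∀ (U : X.affineOpens) (x : U.1),
    Module.Free (MonoidAlgebra (X.presheaf.stalk x.1) G) (P.stalkRep U x).asModule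

theorem LocallyFree.locallyProjective {P : OXGMod X G} (h : P.LocallyFree) :
    P.LocallyProjective :=
  ⟨h.1, fun U x => haveI := h.2 U x; inferInstance⟩

/-- Homomorphisms: families of linear maps compatible with restriction and with `G`. -/
structure Hom (P Q : OXGMod X G) where
  app : ∀ U : X.affineOpens, P.sec U →ₗ[Γ(X, U.1)] Q.sec U
  app_res : ∀ {U V : X.affineOpens} (h : V ≤ U) (m : P.sec U),
    app V (P.res h m) = Q.res h (app U m)
  app_rho : ∀ (U : X.affineOpens) (g : G) (m : P.sec U),
    app U (P.rho U g m) = Q.rho U g (app U m)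

/-- There is a short exact sequence `0 → A → B → C → 0`. For quasi-coherent modules, exactness
is exactness of sections over all affine open subsets. -/
def Ses (A B C : OXGMod X G) : Prop :=
  ∃ (f : Hom A B) (g : Hom B C), ∀ U : X.affineOpens,
    Function.Injective (f.app U) ∧ Function.Exact (f.app U) (g.app U) ∧
      Function.Surjective (g.app U)

/-- The structure sheaf `O_X` with trivial action. -/
def unit (X : Scheme.{u}) (G : Type v) [Group G] : OXGMod X G where
  sec U := Γ(X, U.1)
  res h := { toFun := resHom h, map_add' := map_add _, map_smul' := fun r m => map_mul _ r m }
  res_self := resHom_self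
  res_comp := resHom_comp
  rho _ := 1
  rho_res _ _ _ := rfl

/-- The tensor product `P ⊗_{O_X} Q` with diagonal action of `G`. -/
def tensor (P Q : OXGMod X G) : OXGMod X G where
  sec U := P.sec U ⊗[Γ(X, U.1)] Q.sec U
  res h := TensorProduct.map (P.res h) (Q.res h)
  res_self U m := by
    induction m using TensorProduct.induction_on with
    | zero => exact map_zero _
    | tmul a b => rw [TensorProduct.map_tmul, P.res_self, Q.res_self]
    | add a b ha hb => rw [map_add, ha, hb]
  res_comp h h' m := by
    induction m using TensorProduct.induction_on with
    | zero => simp only [map_zero]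
    | tmul a b => simp only [TensorProduct.map_tmul, P.res_comp h h', Q.res_comp h h']
    | add a b ha hb => simp only [map_add, ha, hb]
  rho U := (P.rho U).tprod (Q.rho U)
  rho_res h g m := by
    induction m using TensorProduct.induction_on with
    | zero => simp only [map_zero]
    | tmul a b =>
      simp only [Representation.tprod_apply, TensorProduct.map_tmul, P.rho_res, Q.rho_res]
    | add a b ha hb => simp only [map_add, ha, hb]

/-- The symmetric power `Sym^n_{O_X}(P)` with the induced action of `G`. -/
def sym (n : ℕ) (P : OXGMod X G) : OXGMod X G where
  sec U := SymPow.part Γ(X, U.1) (P.sec U) n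
  res h := SymPow.map (resHom h) (P.res h) n
  res_self U m := Subtype.ext (SymPow.algMap_self _ _ (resHom_self U) (P.res_self U) m.1)
  res_comp h h' m := Subtype.ext
    (SymPow.algMap_comp _ _ _ _ _ _ (resHom_comp h h') (P.res_comp h h') m.1).symm
  rho U :=
    { toFun := fun g => SymPow.map (RingHom.id _) (P.rho U g) n
      map_one' := LinearMap.ext fun m => Subtype.ext
        (SymPow.algMap_self _ _ (fun _ => rfl) (fun a => by rw [map_one]; rfl) m.1)
      map_mul' := fun g g' => LinearMap.ext fun m => Subtype.ext
        (SymPow.algMap_comp _ _ _ _ _ _ (fun _ => rfl) (fun a => by rw [map_mul]; rfl) m.1).symm }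
  rho_res {U V} h g m := Subtype.ext
    ((SymPow.algMap_comp (RingHom.id _) (resHom h) (resHom h) (P.rho U g) (P.res h)
        ((P.res h).comp (P.rho U g)) (fun _ => rfl) (fun _ => rfl) m.1).trans
      (SymPow.algMap_comp (resHom h) (RingHom.id _) (resHom h) (P.res h) (P.rho V g)
        ((P.res h).comp (P.rho U g)) (fun _ => rfl) (fun a => P.rho_res h g a) m.1).symm)

/-- `Sym^{i_1}(P_1) ⊗ ⋯ ⊗ Sym^{i_r}(P_r)` for a list of pairs `(i_j, P_j)` (with a harmless last
factor `O_X`). -/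
def symTensor : List (ℕ × OXGMod X G) → OXGMod X G
  | [] => unit X G
  | (a, P) :: l => tensor (sym a P) (symTensor l)

/-- Membership in `M_n`: the smallest full subcategory of the coherent `O_XG`-modules that contains
all `Sym^{i_1}(P_1) ⊗ ⋯ ⊗ Sym^{i_r}(P_r)` with `P_j` locally projective and `i_1 + ⋯ + i_r = n`, and
that is closed under extensions and under kernels of epimorphisms. -/
inductive InM (n : ℕ+) : OXGMod X G → Prop
  | gen (l : List (ℕ × OXGMod X G)) (hl : ∀ p ∈ l, p.2.LocallyProjective)
      (hn : (l.map Prod.fst).sum = n) : InM n (symTensor l)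
  | ext {A B C : OXGMod X G} (h : Ses A B C) (hB : B.IsCoherent) (hA : InM n A) (hC : InM n C) :
      InM n B
  | ker {A B C : OXGMod X G} (h : Ses A B C) (hA : A.IsCoherent) (hB : InM n B) (hC : InM n C) :
      InM n A

end OXGMod

/-! ### Grothendieck groups -/

/-- The Grothendieck group of the objects satisfying `p`: the free abelian group on them modulo
`[B] = [A] + [C]` for all short exact sequences `0 → A → B → C → 0` of such objects. -/
def K0 {𝒞 : Type w} (ses : 𝒞 → 𝒞 → 𝒞 → Prop) (p : 𝒞 → Prop) : Type w :=
  FreeAbelianGroup {P : 𝒞 // p P} ⧸ AddSubgroup.closure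
    {x : FreeAbelianGroup {P : 𝒞 // p P} | ∃ A B C : {P : 𝒞 // p P}, ses A.1 B.1 C.1 ∧
      x = FreeAbelianGroup.of B - FreeAbelianGroup.of A - FreeAbelianGroup.of C}

namespace K0

variable {𝒞 : Type w} {ses : 𝒞 → 𝒞 → 𝒞 → Prop} {p q : 𝒞 → Prop}

instance : AddCommGroup (K0 ses p) := inferInstanceAs (AddCommGroup (_ ⧸ _))

/-- The class of an object. -/
def cls (P : 𝒞) (hP : p P) : K0 ses p :=
  QuotientAddGroup.mk (FreeAbelianGroup.of ⟨P, hP⟩)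

/-- Additive invariants of objects define homomorphisms on the Grothendieck group. -/
def lift {A : Type*} [AddCommGroup A] (f : ∀ P, p P → A)
    (hf : ∀ (P Q R : 𝒞) (hP : p P) (hQ : p Q) (hR : p R), ses P Q R →
      f Q hQ = f P hP + f R hR) : K0 ses p →+ A :=
  QuotientAddGroup.lift _ (FreeAbelianGroup.lift fun P : {P : 𝒞 // p P} => f P.1 P.2) (by
    rw [AddSubgroup.closure_le]
    rintro _ ⟨P, Q, R, h, rfl⟩
    simp [hf _ _ _ P.2 Q.2 R.2 h])

theorem lift_cls {A : Type*} [AddCommGroup A] (f : ∀ P, p P → A)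
    (hf : ∀ (P Q R : 𝒞) (hP : p P) (hQ : p Q) (hR : p R), ses P Q R →
      f Q hQ = f P hP + f R hR) (P : 𝒞) (hP : p P) : lift f hf (cls P hP) = f P hP :=
  FreeAbelianGroup.lift_apply_of _ _

theorem cls_ses {P Q R : 𝒞} (hP : p P) (hQ : p Q) (hR : p R) (h : ses P Q R) :
    (cls Q hQ : K0 ses p) = cls P hP + cls R hR := by
  have : (QuotientAddGroup.mk (FreeAbelianGroup.of ⟨Q, hQ⟩ - FreeAbelianGroup.of ⟨P, hP⟩ -
      FreeAbelianGroup.of ⟨R, hR⟩) : K0 ses p) = 0 :=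
    (QuotientAddGroup.eq_zero_iff _).2
      (AddSubgroup.subset_closure ⟨⟨P, hP⟩, ⟨Q, hQ⟩, ⟨R, hR⟩, h, rfl⟩)
  rw [← sub_eq_zero, ← sub_sub]
  exact this

theorem induction {motive : K0 ses p → Prop} (zero : motive 0)
    (cls : ∀ P hP, motive (cls P hP)) (neg : ∀ x, motive x → motive (-x))
    (add : ∀ x y, motive x → motive y → motive (x + y)) (x : K0 ses p) : motive x := by
  obtain ⟨x, rfl⟩ := QuotientAddGroup.mk_surjective x
  induction x using FreeAbelianGroup.induction_on with
  | zero => exact zero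
  | of P => exact cls P.1 P.2
  | neg P h => exact neg _ h
  | add a b ha hb => exact add _ _ ha hb

/-- The canonical homomorphism induced by an inclusion of full subcategories. -/
def map (h : ∀ P, p P → q P) : K0 ses p →+ K0 ses q :=
  lift (fun P hP => cls P (h P hP)) fun _ _ _ _ _ _ hs => cls_ses _ _ _ hs

end K0

/-! ### The Grothendieck groups of `X` and `G` and the locally free class group -/

section Groups

variable (X : Scheme.{u}) (G : Type v) [Group G]

/-- `K_0(O_XG)`, the Grothendieck group of the locally projective coherent `O_XG`-modules. -/
abbrev K0Proj : Type (max (u + 1) v) :=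
  K0 (OXGMod.Ses (X := X) (G := G)) OXGMod.LocallyProjective

/-- `K_0^lf(O_XG)`, the Grothendieck group of the locally free coherent `O_XG`-modules. -/
abbrev K0Free : Type (max (u + 1) v) :=
  K0 (OXGMod.Ses (X := X) (G := G)) OXGMod.LocallyFree

/-- `K_0(M_n)`. -/
abbrev K0M (n : ℕ+) : Type (max (u + 1) v) :=
  K0 (OXGMod.Ses (X := X) (G := G)) (OXGMod.InM n)

/-- The canonical homomorphism `K_0^lf(O_XG) → K_0(O_XG)`. -/
def K0Free.toProj : K0Free X G →+ K0Proj X G :=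
  K0.map fun _ h => h.locallyProjective

end Groups

/-- Short exact sequences of modules over a ring. -/
def ModSes (R : Type v) [Ring R] (A B C : ModuleCat.{u} R) : Prop :=
  ∃ (f : A →ₗ[R] B) (g : B →ₗ[R] C),
    Function.Injective f ∧ Function.Exact f g ∧ Function.Surjective g

/-- `K_0^lf(R)` for a ring `R` (used for `R = FG`, `F` a field): the Grothendieck group of the
finitely generated free modules. -/
abbrev K0FreeMod (R : Type v) [Ring R] : Type (max (u + 1) v) :=
  K0 (ModSes.{u} R) fun M => Module.Finite R M ∧ Module.Free R M

/-- A Dedekind scheme: Noetherian, regular, irreducible, of dimension at most one. -/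
class IsDedekindScheme (X : Scheme.{u}) : Prop extends IsNoetherian X, IrreducibleSpace X where
  regular : ∀ x : X, IsRegularLocalRing (X.presheaf.stalk x)
  dim_le_one : topologicalKrullDim X ≤ 1

section GenericFibre

theorem stalk_flat (X : Scheme.{u}) (U : X.affineOpens) (x : U.1) :
    Module.Flat Γ(X, U.1) (X.presheaf.stalk x.1) := by
  have := U.2.isLocalization_stalk x
  exact IsLocalization.flat _ (U.2.primeIdealOf x).asIdeal.primeCompl

namespace OXGMod

variable {X : Scheme.{u}} {G : Type v} [Group G]

/-- The stalk of `P` at `x` as a module over the group ring `O_{X,x}G`. -/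
def stalkMod (P : OXGMod X G) (U : X.affineOpens) (x : U.1) :
    ModuleCat.{u} (MonoidAlgebra (X.presheaf.stalk x.1) G) :=
  ModuleCat.of _ (P.stalkRep U x).asModule

theorem Hom.baseChange_rho {P Q : OXGMod X G} (φ : Hom P Q) (U : X.affineOpens) (x : U.1) (a : G)
    (m : X.presheaf.stalk x.1 ⊗[Γ(X, U.1)] P.sec U) :
    (φ.app U).baseChange (X.presheaf.stalk x.1) (P.stalkRep U x a m) =
      Q.stalkRep U x a ((φ.app U).baseChange (X.presheaf.stalk x.1) m) := by
  induction m using TensorProduct.induction_on with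
  | zero => simp only [map_zero]
  | tmul s m =>
    change s ⊗ₜ[Γ(X, U.1)] φ.app U (P.rho U a m) = s ⊗ₜ[Γ(X, U.1)] Q.rho U a (φ.app U m)
    rw [φ.app_rho]
  | add x y hx hy => simp only [map_add, hx, hy]

/-- The homomorphism induced on stalks. -/
def Hom.stalkMap {P Q : OXGMod X G} (φ : Hom P Q) (U : X.affineOpens) (x : U.1) :
    (P.stalkRep U x).asModule →ₗ[MonoidAlgebra (X.presheaf.stalk x.1) G]
      (Q.stalkRep U x).asModule :=
  Representation.IntertwiningMap.equivLinearMapAsModule _ _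
    ⟨(φ.app U).baseChange (X.presheaf.stalk x.1),
      fun a => LinearMap.ext (φ.baseChange_rho U x a)⟩

theorem Ses.stalkMod {A B C : OXGMod X G} (h : Ses A B C) (U : X.affineOpens) (x : U.1) :
    ModSes _ (A.stalkMod U x) (B.stalkMod U x) (C.stalkMod U x) := by
  obtain ⟨f, g, hfg⟩ := h
  obtain ⟨h1, h2, h3⟩ := hfg U
  have := stalk_flat X U x
  refine ⟨f.stalkMap U x, g.stalkMap U x, ?_, ?_, ?_⟩
  · exact Module.Flat.lTensor_preserves_injective_linearMap (M := X.presheaf.stalk x.1) _ h1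
  · exact lTensor_exact (X.presheaf.stalk x.1) h2 h3
  · exact LinearMap.lTensor_surjective (X.presheaf.stalk x.1) h3

theorem LocallyFree.stalkMod {P : OXGMod X G} (h : P.LocallyFree) (U : X.affineOpens) (x : U.1) :
    Module.Finite (MonoidAlgebra (X.presheaf.stalk x.1) G) (P.stalkMod U x) ∧
      Module.Free (MonoidAlgebra (X.presheaf.stalk x.1) G) (P.stalkMod U x) := by
  refine ⟨?_, h.2 U x⟩
  have := h.1.2 U
  have : Module.Finite (X.presheaf.stalk x.1) (P.stalkRep U x).asModule :=
    inferInstanceAs (Module.Finite _ (X.presheaf.stalk x.1 ⊗[Γ(X, U.1)] P.sec U))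
  exact Module.Finite.of_restrictScalars_finite (X.presheaf.stalk x.1)
    (MonoidAlgebra (X.presheaf.stalk x.1) G) (P.stalkRep U x).asModule

end OXGMod

variable (X : Scheme.{u}) (G : Type v) [Group G]

theorem exists_affine_genericPoint [IrreducibleSpace X] :
    ∃ U : X.affineOpens, genericPoint X ∈ U.1 := by
  obtain ⟨U, hU, hx, -⟩ := X.isBasis_affineOpens.exists_subset_of_mem_open
    (Set.mem_univ (genericPoint X)) isOpen_univ
  obtain ⟨V, hV, rfl⟩ := hU
  exact ⟨⟨V, hV⟩, hx⟩

/-- An affine open neighbourhood of the generic point. -/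
def genericNhd [IrreducibleSpace X] : X.affineOpens := (exists_affine_genericPoint X).choose

/-- The canonical homomorphism `K_0^lf(O_XG) → K_0^lf(O_{X,x}G)`, `[P] ↦ [P_x]`. -/
def K0Free.toStalk (U : X.affineOpens) (x : U.1) :
    K0Free X G →+ K0FreeMod.{u} (MonoidAlgebra (X.presheaf.stalk x.1) G) :=
  K0.lift (fun P hP => K0.cls (P.stalkMod U x) (hP.stalkMod U x))
    fun _ _ _ _ _ _ h => K0.cls_ses _ _ _ (h.stalkMod U x)

/-- The canonical homomorphism `K_0^lf(O_XG) → K_0^lf(FG)`; the function field `F` of `X` is the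
stalk of `O_X` at the generic point. -/
def K0Free.toGeneric [IrreducibleSpace X] :
    K0Free X G →+ K0FreeMod.{u} (MonoidAlgebra X.functionField G) :=
  K0Free.toStalk X G (genericNhd X) ⟨genericPoint X, (exists_affine_genericPoint X).choose_spec⟩

/-- The locally free class group `Cl(O_XG) = ker(K_0^lf(O_XG) → K_0^lf(FG))`. -/
abbrev Cl [IrreducibleSpace X] : AddSubgroup (K0Free X G) := (K0Free.toGeneric X G).ker

/-- The canonical homomorphism `Cl(O_XG) → K_0(O_XG)`. -/
def Cl.toK0 [IrreducibleSpace X] : Cl X G →+ K0Proj X G :=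
  (K0Free.toProj X G).comp (Cl X G).subtype

end GenericFibre

/-! ### Products and symmetric power operations -/

section Operations

variable {X : Scheme.{u}} {G : Type v} [Group G]

/-- `μ` is the product of Grothendieck groups induced by the tensor product over `O_X`, i.e.
`[P] · [Q] = [P ⊗ Q]`. -/
def IsTensorProductMap {p q r : OXGMod X G → Prop}
    (μ : K0 OXGMod.Ses p →+ K0 OXGMod.Ses q →+ K0 OXGMod.Ses r) : Prop :=
  ∀ (P Q : OXGMod X G) (hP : p P) (hQ : q Q), ∃ h : r (P.tensor Q),
    μ (K0.cls P hP) (K0.cls Q hQ) = K0.cls (P.tensor Q) h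

/-- The identification `K_0(M_m) = K_0(M_n)` for `m = n`. -/
def K0M.cast {m n : ℕ+} (h : m = n) : K0M X G m →+ K0M X G n :=
  K0.map fun _ hP => h ▸ hP

/-- `x ↦ 1 + ∑_{n ≥ 1} σ^n(x) t^n` is the homomorphism from `K_0(O_XG)` to the multiplicative group
`1 + ∏_{n ≥ 1} K_0(M_n) t^n` of power series (formed with the products `μ`) that maps `[P]` to
`1 + ∑_{n ≥ 1} [Sym^n(P)] t^n`. The second condition is the comparison of the coefficients of
`t^n` in `σ(x + y) = σ(x) σ(y)`. -/
def IsSymPowerHom (μ : ∀ a b : ℕ+, K0M X G a →+ K0M X G b →+ K0M X G (a + b))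
    (σ : ∀ n : ℕ+, K0Proj X G → K0M X G n) : Prop :=
  (∀ (n : ℕ+) (P : OXGMod X G) (hP : P.LocallyProjective),
    ∃ h : OXGMod.InM n (P.sym n), σ n (K0.cls P hP) = K0.cls (P.sym n) h) ∧
  ∀ (n : ℕ+) (x y : K0Proj X G), σ n (x + y) = σ n x + σ n y +
    ∑ a ∈ (Finset.Iio n).attach,
      K0M.cast (PNat.add_sub_of_lt (Finset.mem_Iio.1 a.2))
        (μ a.1 (n - a.1) (σ a.1 x) (σ (n - a.1) y))

/-- The product is determined by its values on classes of modules. -/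
theorem IsTensorProductMap.unique {p q r : OXGMod X G → Prop}
    {μ μ' : K0 OXGMod.Ses p →+ K0 OXGMod.Ses q →+ K0 OXGMod.Ses r}
    (h : IsTensorProductMap μ) (h' : IsTensorProductMap μ') : μ = μ' := by
  ext x y
  induction x using K0.induction with
  | zero => simp
  | neg x hx => simp [hx]
  | add x x' hx hx' => simp [hx, hx']
  | cls P hP =>
    induction y using K0.induction with
    | zero => simp
    | neg x hx => simp [hx]
    | add x x' hx hx' => simp [hx, hx']
    | cls Q hQ =>
      obtain ⟨_, e⟩ := h P Q hP hQ
      obtain ⟨_, e'⟩ := h' P Q hP hQ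
      rw [e, e']

/-- The symmetric power operations are determined by their values on classes of modules. -/
theorem IsSymPowerHom.unique {μ : ∀ a b : ℕ+, K0M X G a →+ K0M X G b →+ K0M X G (a + b)}
    {σ σ' : ∀ n : ℕ+, K0Proj X G → K0M X G n}
    (h : IsSymPowerHom μ σ) (h' : IsSymPowerHom μ σ') : σ = σ' := by
  funext n
  induction n using PNat.strongInductionOn with
  | _ n ih =>
    have hsum : ∀ x y, σ n (x + y) - σ n x - σ n y = σ' n (x + y) - σ' n x - σ' n y := by
      intro x y
      rw [h.2, h'.2]
      have : ∀ a ∈ (Finset.Iio n).attach,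
          K0M.cast (PNat.add_sub_of_lt (Finset.mem_Iio.1 a.2))
            (μ a.1 (n - a.1) (σ a.1 x) (σ (n - a.1) y)) =
          K0M.cast (PNat.add_sub_of_lt (Finset.mem_Iio.1 a.2))
            (μ a.1 (n - a.1) (σ' a.1 x) (σ' (n - a.1) y)) := by
        intro a _
        have ha := Finset.mem_Iio.1 a.2
        rw [ih a.1 ha, ih (n - a.1) (by
          have := PNat.add_sub_of_lt ha
          conv_rhs => rw [← this]
          exact PNat.lt_add_left _ _)]
      rw [Finset.sum_congr rfl this]
      abel
    have h0 : σ n 0 = σ' n 0 := by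
      have := hsum 0 0
      simpa using this
    funext x
    induction x using K0.induction with
    | zero => exact h0
    | cls P hP =>
      obtain ⟨_, e⟩ := h.1 n P hP
      obtain ⟨_, e'⟩ := h'.1 n P hP
      rw [e, e']
    | neg x hx =>
      have := hsum x (-x)
      rw [add_neg_cancel, h0, hx] at this
      simpa using this
    | add x y hx hy =>
      have := hsum x y
      rw [hx, hy] at this
      simpa using this

end Operations

end

/-! The proof rests on one criterion and one exact sequence.

Criterion. A coherent module is locally projective if and only if its sections over every affine
open are projective over the functions and the identity on them is a trace `∑ g θ g⁻¹` of a linear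
endomorphism (`OXGMod.locallyProjective_iff`). The scalars that occur as traces form an ideal, so
this can be tested at stalks. If the identity of `P` is the trace of `θ`, the derivation of `Sym(P)`
extending `θ` has as its trace the Euler derivation, which is multiplication by `n` on `Sym^n(P)`.
Traces of tensor factors may be added, hence `i` is a trace on every generator of `M_i`. Since `|G|`
is always a trace (of the identity), so is `gcd(i, |G|)`; when this is invertible, the generators
are locally projective, and the property passes to extensions and kernels.

Symmetric powers. For `0 → A → B → C → 0` the submodules `Sym^a(A) · Sym^b(B)` with `a + b = n`
filter `Sym^n(B)`, with quotients `Sym^a(A) ⊗ Sym^b(C)`. All steps lie in `M_n`, because this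
category is closed under kernels. Hence `∑ [Sym^n(P)] t^n` is multiplicative on exact sequences, and
it defines `σ` with coefficients in a graded ring built from all the `K_0(M_n)`.

Injectivity of `κ`. Every locally projective module is a summand of a locally free one, namely of
the induced module. By this cofinality, equal classes in `K_0(O_XG)` give modules that acquire the
same locally free class after adding a common locally projective summand.

Class group. Elements of `Cl` are differences `[P] - [Q]` of locally free modules of equal rank,
which are therefore locally isomorphic. Conversely, the difference of two locally isomorphic locally
projective modules comes from `Cl`. Since `Sym^n` and tensor products preserve local isomorphism,
`σ^i` preserves `Cl`.

Trivial products. Given a point `z`, locally isomorphic `P` and `Q` contain a common locally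
projective `R` that agrees with both near `z`: take a homomorphism that is an isomorphism near `z`,
and restrict it to the product of `Q` with its ideal of denominators, which is locally principal.
With `z` generic, the embeddings of `R` fail to be isomorphisms at finitely many closed points only,
and they factor into modifications at single points. So `κ(x)` is a combination of differences `[A]
- [B]` with `B ⊆ A` differing at one closed point `z`, and for each such `z` the element `κ(y)` is a
combination of `[A'] - [B']` with `B' ⊆ A'` equal near `z`. For such pairs the Koszul sequence `0 →
B ⊗ B' → (A ⊗ B') ⊕ (B ⊗ A') → A ⊗ A' → 0` is exact (`OXGMod.IsModification.ses_koszul`), that is,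
`([A] - [B]) ([A'] - [B']) = 0`. This proves the first claim. Symmetric powers of modifications are
modifications, so the same argument gives `(σ(x) - 1) (σ(y) - 1) = 0`, which is the additivity of
`σ^i` on `Cl`. -/

noncomputable section

/-! ### Base change along a ring homomorphism, by its universal property -/

section BaseChange

variable {R S : Type u} [CommRing R] [CommRing S] {φ : R →+* S}
  {M N M' N' : Type u} [AddCommGroup M] [AddCommGroup N] [AddCommGroup M'] [AddCommGroup N']
  [Module R M] [Module S N] [Module R M'] [Module S N']

/-- The semilinear map `f : M → N` is universal among the semilinear maps from `M`. -/
def IsBC (f : M →ₛₗ[φ] N) : Prop :=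
  ∀ (Q : Type u) [AddCommGroup Q] [Module S Q] (g : M →ₛₗ[φ] Q),
    ∃! g' : N →ₗ[S] Q, ∀ m, g' (f m) = g m

/-- The universal property for semilinear maps needs no algebra structure and no restriction of
scalars to be installed. This is the passage to and from the usual notion, where flatness and
exactness are available. -/
theorem isBC_iff_isBaseChange [Algebra R S] (hφ : φ = algebraMap R S) [Module R N]
    [IsScalarTower R S N] (f : M →ₛₗ[φ] N) (f' : M →ₗ[R] N) (hf : ∀ m, f' m = f m) :
    IsBC f ↔ IsBaseChange S f' := by
  subst hφ
  constructor
  · intro h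
    refine IsBaseChange.of_lift_unique f' fun Q _ _ _ _ g => ?_
    let _ : AddCommGroup Q := Module.addCommMonoidToAddCommGroup S
    obtain ⟨g', h1, h2⟩ := h Q
      { toFun := g
        map_add' := map_add g
        map_smul' := fun r m => by rw [map_smul, algebraMap_smul] }
    refine ⟨g', LinearMap.ext fun m => ?_, fun g'' h'' => h2 _ fun m => ?_⟩
    · rw [LinearMap.comp_apply, hf]
      exact h1 m
    · rw [← hf]
      exact LinearMap.congr_fun h'' m
  · intro h Q _ _ g
    let _ : Module R Q := Module.compHom Q (algebraMap R S)
    have : IsScalarTower R S Q := ⟨fun r s q => by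
      rw [Algebra.smul_def, mul_smul]; rfl⟩
    let g₀ : M →ₗ[R] Q :=
      { toFun := g
        map_add' := map_add g
        map_smul' := fun r m => map_smulₛₗ g r m }
    refine ⟨h.lift g₀, fun m => ?_, fun g'' h'' => h.algHom_ext _ _ fun m => ?_⟩
    · rw [← hf]
      exact h.lift_eq g₀ m
    · rw [h.lift_eq, hf]
      exact h'' m

namespace IsBC

variable {f : M →ₛₗ[φ] N} {f' : M' →ₛₗ[φ] N'} {Q : Type u} [AddCommGroup Q] [Module S Q]

/-- The linear map induced by a semilinear map. -/
def lift (h : IsBC f) (g : M →ₛₗ[φ] Q) : N →ₗ[S] Q := (h Q g).choose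

@[simp]
theorem lift_apply (h : IsBC f) (g : M →ₛₗ[φ] Q) (m : M) : h.lift g (f m) = g m :=
  (h Q g).choose_spec.1 m

theorem hom_ext (h : IsBC f) {g g' : N →ₗ[S] Q} (e : ∀ m, g (f m) = g' (f m)) : g = g' :=
  (h Q (g'.comp f)).unique e fun _ => rfl

theorem span_range (h : IsBC f) : Submodule.span S (Set.range f) = ⊤ := by
  have : (Submodule.span S (Set.range f)).mkQ = 0 := h.hom_ext fun m => by
    rw [LinearMap.zero_apply, Submodule.mkQ_apply, Submodule.Quotient.mk_eq_zero]
    exact Submodule.subset_span ⟨m, rfl⟩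
  rw [← Submodule.ker_mkQ (Submodule.span S (Set.range f)), this, LinearMap.ker_zero]

/-- Uniqueness of the induced map is automatic once the image generates, so only its existence
remains to be given. -/
theorem of_lift_unique (h1 : ∀ (Q : Type u) [AddCommGroup Q] [Module S Q] (g : M →ₛₗ[φ] Q),
      ∃ g' : N →ₗ[S] Q, ∀ m, g' (f m) = g m)
    (h2 : Submodule.span S (Set.range f) = ⊤) : IsBC f := by
  intro Q _ _ g
  obtain ⟨g', hg'⟩ := h1 Q g
  refine ⟨g', hg', fun g'' hg'' => LinearMap.ext_on h2 ?_⟩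
  rintro _ ⟨m, rfl⟩
  rw [hg', hg'']

/-- A semilinear map on the tensor product is extended in one variable at a time: first in the
second factor for each fixed `m`, then in the first factor with values in a module of linear maps.
-/
theorem tensor (h : IsBC f) (h' : IsBC f') : IsBC (TensorProduct.map f f') := by
  intro Q _ _ g
  let g₀ (m : M) : M' →ₛₗ[φ] Q :=
    { toFun := fun m' => g (m ⊗ₜ m')
      map_add' := fun a b => by rw [tmul_add, map_add]
      map_smul' := fun r a => by rw [tmul_smul, map_smulₛₗ] }
  let g₁ : M →ₛₗ[φ] (N' →ₗ[S] Q) :=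
    { toFun := fun m => h'.lift (g₀ m)
      map_add' := fun a b => h'.hom_ext fun m => by
        rw [LinearMap.add_apply, lift_apply, lift_apply, lift_apply]
        exact (congrArg g (add_tmul a b m)).trans (map_add g _ _)
      map_smul' := fun r a => h'.hom_ext fun m => by
        rw [LinearMap.smul_apply, lift_apply, lift_apply]
        exact (congrArg g (smul_tmul' r a m)).symm.trans (map_smulₛₗ g _ _) }
  refine ⟨TensorProduct.lift (h.lift g₁), fun m => ?_, fun g'' hg'' => ?_⟩
  · induction m using TensorProduct.induction_on with
    | zero => simp only [map_zero]
    | tmul a b =>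
      rw [map_tmul, TensorProduct.lift.tmul, lift_apply]
      exact h'.lift_apply (g₀ a) b
    | add a b ha hb => simp only [map_add, ha, hb]
  · refine TensorProduct.ext (h.hom_ext fun m => h'.hom_ext fun m' => ?_)
    have := hg'' (m ⊗ₜ m')
    rw [map_tmul] at this
    change g'' (f m ⊗ₜ f' m') = TensorProduct.lift (h.lift g₁) (f m ⊗ₜ f' m')
    rw [this, TensorProduct.lift.tmul, lift_apply]
    exact (h'.lift_apply (g₀ m) m').symm

theorem prod (h : IsBC f) (h' : IsBC f') (p : M × M' →ₛₗ[φ] N × N')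
    (hp : ∀ m, p m = (f m.1, f' m.2)) : IsBC p := by
  intro Q _ _ g
  let g₁ := h.lift (g.comp (LinearMap.inl R M M'))
  let g₂ := h'.lift (g.comp (LinearMap.inr R M M'))
  refine ⟨LinearMap.coprod g₁ g₂, fun m => ?_, fun g'' hg'' => ?_⟩
  · rw [hp, LinearMap.coprod_apply, lift_apply, lift_apply]
    simp only [LinearMap.comp_apply, LinearMap.inl_apply, LinearMap.inr_apply, ← map_add]
    simp
  · refine LinearMap.prod_ext (h.hom_ext fun m => ?_) (h'.hom_ext fun m => ?_)
    · have := hg'' (m, 0)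
      rw [hp] at this
      simpa [g₁] using this
    · have := hg'' (0, m)
      rw [hp] at this
      simpa [g₂] using this

theorem pi {n : ℕ} (h : IsBC f) (p : (Fin n → M) →ₛₗ[φ] (Fin n → N))
    (hp : ∀ m k, p m k = f (m k)) : IsBC p := by
  intro Q _ _ g
  have hs (k : Fin n) (m : M) : p (Pi.single k m) = Pi.single k (f m) := by
    funext j
    rw [hp]
    by_cases hj : j = k
    · subst hj; simp
    · simp [hj]
  refine ⟨LinearMap.lsum S (fun _ => N) S fun k =>
    h.lift (g.comp (LinearMap.single R (fun _ => M) k)), fun m => ?_, fun g'' hg'' => ?_⟩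
  · simp only [LinearMap.lsum_apply, LinearMap.sum_apply, LinearMap.comp_apply, LinearMap.proj_apply,
      hp, lift_apply, ← map_sum]
    congr 1
    exact LinearMap.sum_single_apply _ m
  · refine LinearMap.pi_ext' fun k => h.hom_ext fun m => ?_
    have := hg'' (Pi.single k m)
    rw [hs] at this
    simp only [LinearMap.comp_apply, LinearMap.single_apply, LinearMap.lsum_apply,
      LinearMap.sum_apply, LinearMap.proj_apply]
    rw [this, Finset.sum_eq_single k]
    · simp
    · intro j _ hj
      simp [hj]
    · simp

theorem id_unit (f : R →ₛₗ[φ] S) (hf : ∀ r, f r = φ r) : IsBC f := by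
  refine of_lift_unique (fun Q _ _ g => ⟨LinearMap.toSpanSingleton S Q (g 1), fun m => ?_⟩) ?_
  · rw [LinearMap.toSpanSingleton_apply, hf]
    rw [← map_smulₛₗ, smul_eq_mul, mul_one]
  · refine eq_top_iff.2 fun s _ => ?_
    have : s = s • f 1 := by simp [hf]
    rw [this]
    exact Submodule.smul_mem _ _ (Submodule.subset_span ⟨1, rfl⟩)

/-- Retracts of base changes are base changes. -/
theorem retract (h : IsBC f') (f : M →ₛₗ[φ] N) (i : M →ₗ[R] M') (p : M' →ₗ[R] M)
    (j : N →ₗ[S] N') (q : N' →ₗ[S] N) (hpi : ∀ m, p (i m) = m) (hqj : ∀ n, q (j n) = n)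
    (hi : ∀ m, f' (i m) = j (f m)) (hp : ∀ m, q (f' m) = f (p m)) : IsBC f := by
  refine of_lift_unique (fun Q _ _ g => ⟨(h.lift (g.comp p)).comp j, fun m => ?_⟩) ?_
  · rw [LinearMap.comp_apply, ← hi, lift_apply, LinearMap.comp_apply, hpi]
  · have := congrArg (Submodule.map q) h.span_range
    rw [Submodule.map_span, Submodule.map_top, LinearMap.range_eq_top.2 fun n => ⟨_, hqj n⟩] at this
    rw [← this]
    refine le_antisymm (this ▸ le_top) (Submodule.span_mono ?_)
    rintro _ ⟨_, ⟨m, rfl⟩, rfl⟩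
    exact ⟨p m, (hp m).symm⟩

variable {M'' N'' : Type u} [AddCommGroup M''] [AddCommGroup N''] [Module R M''] [Module S N'']
  {f'' : M'' →ₛₗ[φ] N''}

/-- Kernels are compatible with base change because flatness keeps the upper row left exact after
tensoring. This makes kernels and suitable submodules quasi-coherent. -/
theorem exact_left (hφ : φ.Flat) {a : M →ₗ[R] M'} {b : M' →ₗ[R] M''} {a' : N →ₗ[S] N'}
    {b' : N' →ₗ[S] N''} (c1 : ∀ m, f' (a m) = a' (f m)) (c2 : ∀ m, f'' (b m) = b' (f' m))
    (h' : IsBC f') (h'' : IsBC f'') (e1 : Function.Exact a b) (i1 : Function.Injective a)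
    (e2 : Function.Exact a' b') (i2 : Function.Injective a') : IsBC f := by
  let _ : Algebra R S := φ.toAlgebra
  have : Module.Flat R S := hφ
  let _ : Module R N := Module.compHom N φ
  have : IsScalarTower R S N := ⟨fun r s n => by rw [Algebra.smul_def, mul_smul]; rfl⟩
  let _ : Module R N' := Module.compHom N' φ
  have : IsScalarTower R S N' := ⟨fun r s n => by rw [Algebra.smul_def, mul_smul]; rfl⟩
  let _ : Module R N'' := Module.compHom N'' φ
  have : IsScalarTower R S N'' := ⟨fun r s n => by rw [Algebra.smul_def, mul_smul]; rfl⟩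
  let f₀ : M →ₗ[R] N :=
    { toFun := f, map_add' := map_add f, map_smul' := fun r m => map_smulₛₗ f r m }
  let f₁ : M' →ₗ[R] N' :=
    { toFun := f', map_add' := map_add f', map_smul' := fun r m => map_smulₛₗ f' r m }
  let f₂ : M'' →ₗ[R] N'' :=
    { toFun := f'', map_add' := map_add f'', map_smul' := fun r m => map_smulₛₗ f'' r m }
  rw [isBC_iff_isBaseChange rfl f f₀ fun _ => rfl]
  rw [isBC_iff_isBaseChange rfl f' f₁ fun _ => rfl] at h'
  rw [isBC_iff_isBaseChange rfl f'' f₂ fun _ => rfl] at h''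
  exact IsBaseChange.of_left_exact S f₀ f₁ f₂ (LinearMap.ext c1)
      (LinearMap.ext c2) h' h'' e1 i1 e2 i2

/-- A diagram chase between the tensored upper row and the lower row. Only right exactness of the
tensor product is needed, since injectivity on the left is assumed in the lower row. -/
theorem exact_middle {a : M →ₗ[R] M'} {b : M' →ₗ[R] M''} {a' : N →ₗ[S] N'}
    {b' : N' →ₗ[S] N''} (c1 : ∀ m, f' (a m) = a' (f m)) (c2 : ∀ m, f'' (b m) = b' (f' m))
    (h : IsBC f) (h'' : IsBC f'') (e1 : Function.Exact a b) (s1 : Function.Surjective b)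
    (e2 : Function.Exact a' b') (i2 : Function.Injective a') :
    IsBC f' := by
  let _ : Algebra R S := φ.toAlgebra
  let _ : Module R N := Module.compHom N φ
  have : IsScalarTower R S N := ⟨fun r s n => by rw [Algebra.smul_def, mul_smul]; rfl⟩
  let _ : Module R N' := Module.compHom N' φ
  have : IsScalarTower R S N' := ⟨fun r s n => by rw [Algebra.smul_def, mul_smul]; rfl⟩
  let _ : Module R N'' := Module.compHom N'' φ
  have : IsScalarTower R S N'' := ⟨fun r s n => by rw [Algebra.smul_def, mul_smul]; rfl⟩
  let f₀ : M →ₗ[R] N :=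
    { toFun := f, map_add' := map_add f, map_smul' := fun r m => map_smulₛₗ f r m }
  let f₁ : M' →ₗ[R] N' :=
    { toFun := f', map_add' := map_add f', map_smul' := fun r m => map_smulₛₗ f' r m }
  let f₂ : M'' →ₗ[R] N'' :=
    { toFun := f'', map_add' := map_add f'', map_smul' := fun r m => map_smulₛₗ f'' r m }
  rw [isBC_iff_isBaseChange rfl f' f₁ fun _ => rfl]
  rw [isBC_iff_isBaseChange rfl f f₀ fun _ => rfl] at h
  rw [isBC_iff_isBaseChange rfl f'' f₂ fun _ => rfl] at h''
  simp only [IsBaseChange, IsTensorProduct] at h h'' ⊢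
  set l := TensorProduct.lift
    (((Algebra.linearMap S (Module.End S (M →ₗ[R] N))).flip f₀).restrictScalars R)
  set l' := TensorProduct.lift
    (((Algebra.linearMap S (Module.End S (M' →ₗ[R] N'))).flip f₁).restrictScalars R)
  set l'' := TensorProduct.lift
    (((Algebra.linearMap S (Module.End S (M'' →ₗ[R] N''))).flip f₂).restrictScalars R)
  have comm₁ : l'.comp (a.lTensor S) = (a'.restrictScalars R).comp l :=
    TensorProduct.ext' fun s m => by
      simpa [l, l', f₀, f₁] using congrArg (s • ·) (c1 m)
  have comm₂ : l''.comp (b.lTensor S) = (b'.restrictScalars R).comp l' :=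
    TensorProduct.ext' fun s m => by
      simpa [l', l'', f₁, f₂] using congrArg (s • ·) (c2 m)
  have ex := _root_.lTensor_exact S e1 s1
  have sur := LinearMap.lTensor_surjective S s1
  constructor
  · rw [injective_iff_map_eq_zero]
    intro t ht
    have h1 : l'' (b.lTensor S t) = 0 := by
      have := LinearMap.congr_fun comm₂ t
      simp only [LinearMap.comp_apply, LinearMap.restrictScalars_apply] at this
      rw [this, ht, map_zero]
    obtain ⟨t₀, rfl⟩ := (ex t).1 (h''.1 (h1.trans (map_zero _).symm))
    have h2 : a' (l t₀) = 0 := (LinearMap.congr_fun comm₁ t₀).symm.trans ht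
    rw [h.1 ((i2 (h2.trans (map_zero a').symm)).trans (map_zero l).symm), map_zero]
  · intro y
    obtain ⟨t'', ht''⟩ := h''.2 (b' y)
    obtain ⟨t', rfl⟩ := sur t''
    have h1 : b' (y - l' t') = 0 := by
      rw [map_sub, ← ht'', sub_eq_zero]
      exact LinearMap.congr_fun comm₂ t'
    obtain ⟨x, hx⟩ := (e2 _).1 h1
    obtain ⟨t, rfl⟩ := h.2 x
    refine ⟨a.lTensor S t + t', ?_⟩
    have h2 : l' (a.lTensor S t) = a' (l t) := LinearMap.congr_fun comm₁ t
    rw [map_add, h2, hx, sub_add_cancel]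

end IsBC

end BaseChange

/-! ### Traces and projectivity over group rings -/

namespace Representation

variable {R : Type*} {G : Type*} [CommRing R] [Group G] [Fintype G]
  {V W : Type*} [AddCommGroup V] [Module R V] [AddCommGroup W] [Module R W]

/-- Multiplication by `r` is the trace `∑ g θ g⁻¹` of some `R`-linear endomorphism `θ`. -/
def HasTrace (ρ : Representation R G V) (r : R) : Prop :=
  ∃ θ : Module.End R V, ∀ v, ∑ g, ρ g (θ (ρ g⁻¹ v)) = r • v

variable {ρ : Representation R G V} {σ : Representation R G W}

theorem HasTrace.add {r s : R} (hr : ρ.HasTrace r) (hs : ρ.HasTrace s) : ρ.HasTrace (r + s) := by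
  obtain ⟨θ, hθ⟩ := hr
  obtain ⟨η, hη⟩ := hs
  exact ⟨θ + η, fun v => by simp [Finset.sum_add_distrib, hθ, hη, add_smul]⟩

theorem HasTrace.mul {r : R} (t : R) (hr : ρ.HasTrace r) : ρ.HasTrace (t * r) := by
  obtain ⟨θ, hθ⟩ := hr
  exact ⟨t • θ, fun v => by simp [← Finset.smul_sum, hθ, mul_smul]⟩

theorem hasTrace_card (ρ : Representation R G V) : ρ.HasTrace (Fintype.card G : R) :=
  ⟨1, fun v => by simp [Nat.cast_smul_eq_nsmul]⟩

theorem hasTrace_zero (ρ : Representation R G V) : ρ.HasTrace 0 := ⟨0, fun v => by simp⟩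

/-- The ideal of all traces. -/
def traceIdeal (ρ : Representation R G V) : Ideal R where
  carrier := {r | ρ.HasTrace r}
  add_mem' := HasTrace.add
  zero_mem' := ρ.hasTrace_zero
  smul_mem' t _ h := h.mul t

/-- By Bézout the gcd is a combination of `n` and `|G|`, both of which are traces; dividing by it
gives `1`. This is the only use of the assumption on `gcd(i, |G|)`. -/
theorem HasTrace.gcd {n : ℕ} (hn : ρ.HasTrace (n : R))
    (h : IsUnit ((Nat.gcd n (Fintype.card G) : ℕ) : R)) : ρ.HasTrace 1 := by
  obtain ⟨u, hu⟩ := h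
  have h1 : ρ.HasTrace ((Nat.gcd n (Fintype.card G) : ℕ) : R) := by
    have := congrArg (Int.cast (R := R)) (Nat.gcd_eq_gcd_ab n (Fintype.card G))
    push_cast at this
    rw [this, mul_comm (n : R), mul_comm (_ : R) (Int.cast (Nat.gcdB _ _))]
    exact (hn.mul _).add (ρ.hasTrace_card.mul _)
  have := h1.mul (u⁻¹ : Rˣ).val
  rwa [← hu, Units.inv_mul] at this

/-- The endomorphism `θ ⊗ 1` works, because conjugation by `g` leaves the identity of the other
factor unchanged. -/
theorem HasTrace.tprod_left {r : R} (h : ρ.HasTrace r) (σ : Representation R G W) :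
    (ρ.tprod σ).HasTrace r := by
  obtain ⟨θ, hθ⟩ := h
  refine ⟨TensorProduct.map θ LinearMap.id, fun v => ?_⟩
  induction v using TensorProduct.induction_on with
  | zero => simp
  | tmul a b => simp [← TensorProduct.sum_tmul, hθ, TensorProduct.smul_tmul']
  | add a b ha hb => simp only [map_add, Finset.sum_add_distrib, ha, hb, smul_add]

theorem HasTrace.tprod_right {r : R} (h : ρ.HasTrace r) (σ : Representation R G W) :
    (σ.tprod ρ).HasTrace r := by
  obtain ⟨θ, hθ⟩ := h
  refine ⟨TensorProduct.map LinearMap.id θ, fun v => ?_⟩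
  induction v using TensorProduct.induction_on with
  | zero => simp
  | tmul a b => simp [← TensorProduct.tmul_sum, hθ]
  | add a b ha hb => simp only [map_add, Finset.sum_add_distrib, ha, hb, smul_add]

theorem HasTrace.retract {r : R} (h : σ.HasTrace r) (i : V →ₗ[R] W) (p : W →ₗ[R] V)
    (hpi : ∀ v, p (i v) = v) (hi : ∀ g v, i (ρ g v) = σ g (i v))
    (hp : ∀ g w, p (σ g w) = ρ g (p w)) : ρ.HasTrace r := by
  obtain ⟨θ, hθ⟩ := h
  refine ⟨p ∘ₗ θ ∘ₗ i, fun v => ?_⟩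
  simp only [LinearMap.comp_apply, hi, ← hp, ← map_sum, hθ, map_smul, hpi]

/-- An equivariant surjection onto a projective module with a trace equal to `1` splits
equivariantly. -/
theorem exists_equivariant_section [Module.Projective R W] (h : σ.HasTrace 1) (p : V →ₗ[R] W)
    (hp : ∀ g v, p (ρ g v) = σ g (p v)) (hs : Function.Surjective p) :
    ∃ s : W →ₗ[R] V, (∀ w, p (s w) = w) ∧ ∀ g w, s (σ g w) = ρ g (s w) := by
  obtain ⟨θ, hθ⟩ := h
  obtain ⟨s₀, hs₀⟩ := p.exists_rightInverse_of_surjective (LinearMap.range_eq_top.2 hs)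
  have hs₀ : ∀ w, p (s₀ w) = w := LinearMap.congr_fun hs₀
  refine ⟨∑ g, ρ g ∘ₗ s₀ ∘ₗ θ ∘ₗ σ g⁻¹, fun w => ?_, fun g w => ?_⟩
  · simp only [LinearMap.sum_apply, LinearMap.comp_apply, map_sum, hp, hs₀, hθ, one_smul]
  · simp only [LinearMap.sum_apply, LinearMap.comp_apply, map_sum]
    refine (Fintype.sum_equiv (Equiv.mulLeft g) _ _ fun a => ?_).symm
    simp only [Equiv.coe_mulLeft, mul_inv_rev, map_mul, Module.End.mul_apply, inv_self_apply]

/-- The equivariant section splits the middle term, and the endomorphisms of the two summands are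
added. -/
theorem HasTrace.ext {U : Type*} [AddCommGroup U] [Module R U] {τ : Representation R G U}
    (hV : ρ.HasTrace 1) (hU : τ.HasTrace 1) (i : V →ₗ[R] W) (p : W →ₗ[R] U)
    (s : U →ₗ[R] W) (hps : ∀ u, p (s u) = u) (hi : Function.Injective i)
    (he : Function.Exact i p) (hir : ∀ g v, i (ρ g v) = σ g (i v))
    (hpr : ∀ g w, p (σ g w) = τ g (p w)) (hsr : ∀ g u, s (τ g u) = σ g (s u)) :
    σ.HasTrace 1 := by
  obtain ⟨θ, hθ⟩ := hV
  obtain ⟨η, hη⟩ := hU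
  have hr : ∀ w, ∃ v, i v = w - s (p w) := fun w => (he _).1 (by rw [map_sub, hps, sub_self])
  choose r hr using hr
  let r' : W →ₗ[R] V :=
    { toFun := r
      map_add' := fun a b => hi (by simp only [map_add, hr]; abel)
      map_smul' := fun t a => hi (by simp [map_smul, hr, smul_sub]) }
  have hr' : ∀ w, i (r' w) = w - s (p w) := hr
  have hrr : ∀ g w, r' (σ g w) = ρ g (r' w) := fun g w => hi (by
    rw [hir, hr', hr', hpr, hsr, map_sub])
  refine ⟨i ∘ₗ θ ∘ₗ r' + s ∘ₗ η ∘ₗ p, fun w => ?_⟩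
  simp only [LinearMap.add_apply, LinearMap.comp_apply, map_add, Finset.sum_add_distrib, hrr, hpr,
    ← hir, ← hsr, ← map_sum, hθ, hη, one_smul, hr', sub_add_cancel]

/-- On a free module the identity is the trace of "take the coefficient at `1`". A splitting of the
canonical free cover transports this to any projective module. -/
theorem hasTrace_one_of_projective
    (h : Module.Projective (MonoidAlgebra R G) ρ.asModule) : ρ.HasTrace 1 := by
  classical
  obtain ⟨s, hs⟩ := h.out
  let ε : MonoidAlgebra R G →ₗ[R] R :=
    { toFun := fun a => a.coeff 1, map_add' := fun a b => rfl, map_smul' := fun r a => rfl }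
  have hε : ∀ g r, ε (MonoidAlgebra.single g r) = if g = 1 then r else 0 := fun g r =>
    Finsupp.single_apply
  let c : (ρ.asModule →₀ MonoidAlgebra R G) →ₗ[R] V :=
    Finsupp.lsum R fun m => ε.smulRight (ρ.asModuleEquiv m)
  let act (g : G) : (ρ.asModule →₀ MonoidAlgebra R G) →ₗ[R] (ρ.asModule →₀ MonoidAlgebra R G) :=
    { toFun := fun x => MonoidAlgebra.of R G g • x
      map_add' := fun x y => smul_add _ x y
      map_smul' := fun r x => smul_comm _ r x }
  -- On `h` times a basis vector, taking the coefficient at `1` after translation by `g⁻¹` is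
  -- nonzero only for `g = h`, so the sum returns the canonical projection of the free cover.
  have key : ∑ g, ρ g ∘ₗ c ∘ₗ act g⁻¹ = ρ.asModuleEquiv.toLinearMap ∘ₗ
      (Finsupp.linearCombination (MonoidAlgebra R G) id).restrictScalars R := by
    refine Finsupp.lhom_ext fun m a => ?_
    induction a using MonoidAlgebra.induction_linear with
    | zero => rw [Finsupp.single_zero, map_zero, map_zero]
    | add a b ha hb => rw [Finsupp.single_add, map_add, map_add, ha, hb]
    | single h r =>
      have h1 : ∀ g, c (act g⁻¹ (Finsupp.single m (MonoidAlgebra.single h r))) =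
          (if g⁻¹ * h = 1 then r else 0) • ρ.asModuleEquiv m := by
        intro g
        change c (MonoidAlgebra.of R G g⁻¹ • Finsupp.single m (MonoidAlgebra.single h r)) = _
        rw [Finsupp.smul_single, smul_eq_mul, MonoidAlgebra.of_apply,
          MonoidAlgebra.single_mul_single, one_mul]
        refine (Finsupp.lsum_single (σ := RingHom.id R) ..).trans ?_
        rw [LinearMap.smulRight_apply, hε]
      simp only [LinearMap.sum_apply, LinearMap.comp_apply, h1, map_smul]
      rw [Finset.sum_eq_single h]
      · rw [if_pos (inv_mul_cancel h), LinearMap.restrictScalars_apply,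
          Finsupp.linearCombination_single, single_smul]
        rfl
      · intro g _ hg
        rw [if_neg fun e => hg (inv_mul_eq_one.1 e), zero_smul]
      · simp
  refine ⟨c ∘ₗ s.restrictScalars R ∘ₗ ρ.asModuleEquiv.symm.toLinearMap, fun v => ?_⟩
  rw [one_smul]
  have h1 := LinearMap.congr_fun key (s (ρ.asModuleEquiv.symm v))
  simp only [LinearMap.sum_apply, LinearMap.comp_apply] at h1
  refine Eq.trans (Finset.sum_congr rfl fun g _ => ?_) (h1.trans (congrArg ρ.asModuleEquiv (hs _)))
  have : act g⁻¹ (s (ρ.asModuleEquiv.symm v)) = s (ρ.asModuleEquiv.symm (ρ g⁻¹ v)) := by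
    rw [asModuleEquiv_symm_map_rho, map_smul]
    rfl
  rw [this]
  rfl

/-- The canonical free cover has an equivariant section by averaging, and an equivariant linear
section is linear over the group ring. -/
theorem projective_of_hasTrace_one [Module.Projective R V] (h : ρ.HasTrace 1) :
    Module.Projective (MonoidAlgebra R G) ρ.asModule := by
  let p := Finsupp.linearCombination (MonoidAlgebra R G) (id : ρ.asModule → ρ.asModule)
  have hp1 : ∀ m : ρ.asModule, p (Finsupp.single m 1) = m := fun m => by
    rw [Finsupp.linearCombination_single, one_smul]
    rfl
  obtain ⟨s, hs, hsg⟩ := exists_equivariant_section (σ := ρ)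
    (ρ := Representation.ofModule' (k := R) (G := G) (ρ.asModule →₀ MonoidAlgebra R G)) h
    (p.restrictScalars R : _ →ₗ[R] V)
    (fun g v => by
      refine (map_smul p (MonoidAlgebra.of R G g) v).trans ?_
      rw [MonoidAlgebra.of_apply, single_smul, one_smul]
      rfl)
    (fun m => ⟨Finsupp.single (ρ.asModuleEquiv.symm m) 1, hp1 (ρ.asModuleEquiv.symm m)⟩)
  have hlin : ∀ (a : MonoidAlgebra R G) (m : ρ.asModule), s (a • m : ρ.asModule) = a • s m := by
    intro a m
    induction a using MonoidAlgebra.induction_linear with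
    | zero => rw [zero_smul, zero_smul]; exact map_zero s
    | add a b ha hb => rw [add_smul, add_smul, ← ha, ← hb]; exact map_add s _ _
    | single g r =>
      rw [single_smul]
      refine (map_smul s r _).trans ?_
      rw [hsg]
      change r • MonoidAlgebra.of R G g • s m = _
      rw [← smul_assoc, MonoidAlgebra.of_apply, MonoidAlgebra.smul_single, smul_eq_mul, mul_one]
  exact ⟨⟨{ toFun := s, map_add' := map_add s, map_smul' := hlin }, hs⟩⟩

/-- Base change of a representation. -/
def baseChange' (S : Type*) [CommRing S] [Algebra R S] (ρ : Representation R G V) :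
    Representation S G (S ⊗[R] V) :=
  ((Module.End.baseChangeHom R S V : Module.End R V →* _)).comp ρ

omit [Fintype G] in
theorem baseChange'_tmul (S : Type*) [CommRing S] [Algebra R S] (ρ : Representation R G V) (g : G)
    (s : S) (v : V) : ρ.baseChange' S g (s ⊗ₜ v) = s ⊗ₜ ρ g v := rfl

theorem HasTrace.baseChange' {r : R} (h : ρ.HasTrace r) (S : Type*) [CommRing S] [Algebra R S] :
    (ρ.baseChange' S).HasTrace (algebraMap R S r) := by
  obtain ⟨θ, hθ⟩ := h
  refine ⟨θ.baseChange S, fun v => ?_⟩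
  induction v using TensorProduct.induction_on with
  | zero => simp
  | tmul a b =>
    simp only [baseChange'_tmul, LinearMap.baseChange_tmul, ← TensorProduct.tmul_sum, hθ]
    rw [TensorProduct.tmul_smul, algebraMap_smul]
  | add a b ha hb => simp only [map_add, Finset.sum_add_distrib, ha, hb, smul_add]

/-- Traces descend from a localization, up to a denominator. -/
theorem HasTrace.exists_of_localization (M : Submonoid R) (S : Type*) [CommRing S] [Algebra R S]
    [IsLocalization M S] [Module.FinitePresentation R V]
    (h : (ρ.baseChange' S).HasTrace 1) : ∃ r ∈ M, ρ.HasTrace r := by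
  obtain ⟨θ, hθ⟩ := h
  let f : V →ₗ[R] S ⊗[R] V := TensorProduct.mk R S V 1
  have : IsLocalizedModule M f :=
    (isLocalizedModule_iff_isBaseChange M S f).2 (TensorProduct.isBaseChange R V S)
  obtain ⟨η, s, hη⟩ := Module.FinitePresentation.exists_lift_of_isLocalizedModule M f
    ((θ.restrictScalars R).comp f)
  have hη : ∀ v, f (η v) = (s : R) • θ (f v) := LinearMap.congr_fun hη
  let tr : V →ₗ[R] V := ∑ g, ρ g ∘ₗ η ∘ₗ ρ g⁻¹
  have htr : f ∘ₗ tr = f ∘ₗ ((s : R) • LinearMap.id) := by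
    ext v
    have h1 : ∀ g w, f (ρ g w) = ρ.baseChange' S g (f w) := fun _ _ => rfl
    simp only [tr, LinearMap.comp_apply, LinearMap.sum_apply, map_sum, h1, hη,
      LinearMap.smul_apply, LinearMap.id_apply, map_smul]
    have : ∀ g (w : S ⊗[R] V), ρ.baseChange' S g ((s : R) • w) =
        (s : R) • ρ.baseChange' S g w := fun g w => by
      rw [← algebraMap_smul S, map_smul, algebraMap_smul]
    simp only [this, ← Finset.smul_sum, hθ, one_smul]
  have : Module.Finite R V := inferInstance
  -- The trace of `η` is multiplication by `s` only after localization; finite generation provides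
  -- one element of `M` that kills the difference.
  obtain ⟨t, ht⟩ := Module.Finite.exists_smul_of_comp_eq_of_isLocalizedModule M f _ _ htr
  refine ⟨t * s, mul_mem t.2 s.2, (t : R) • η, fun v => ?_⟩
  have := LinearMap.congr_fun ht v
  simp only [tr, LinearMap.smul_apply, LinearMap.sum_apply, LinearMap.comp_apply,
    LinearMap.id_apply] at this
  simp only [LinearMap.smul_apply, map_smul, ← Finset.smul_sum, mul_smul]
  exact this

/-- A section over the localization is cleared of denominators. The scalars `r` for which
multiplication by `r` factors through `p` form an ideal, and this puts into it an element outside a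
given prime. -/
theorem _root_.Module.exists_smul_section_of_localization {n : ℕ} (M : Submonoid R) (S : Type*)
    [CommRing S] [Algebra R S] [IsLocalization M S] [Module.FinitePresentation R V]
    [Module.Projective S (S ⊗[R] V)] (p : (Fin n → R) →ₗ[R] V) (hp : Function.Surjective p) :
    ∃ r ∈ M, ∃ q : V →ₗ[R] (Fin n → R), ∀ v, p (q v) = r • v := by
  have hp' : Function.Surjective (p.baseChange S) := LinearMap.lTensor_surjective S hp
  obtain ⟨s, hs⟩ := (p.baseChange S).exists_rightInverse_of_surjective
    (LinearMap.range_eq_top.2 hp')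
  let f : V →ₗ[R] S ⊗[R] V := TensorProduct.mk R S V 1
  have : IsLocalizedModule M f :=
    (isLocalizedModule_iff_isBaseChange M S f).2 (TensorProduct.isBaseChange R V S)
  let f' : (Fin n → R) →ₗ[R] S ⊗[R] (Fin n → R) := TensorProduct.mk R S _ 1
  have : IsLocalizedModule M f' :=
    (isLocalizedModule_iff_isBaseChange M S f').2 (TensorProduct.isBaseChange R _ S)
  obtain ⟨q, r, hq⟩ := Module.FinitePresentation.exists_lift_of_isLocalizedModule M f'
    ((s.restrictScalars R).comp f)
  have hq : ∀ v, f' (q v) = (r : R) • s (f v) := LinearMap.congr_fun hq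
  have hpq : f ∘ₗ (p ∘ₗ q) = f ∘ₗ ((r : R) • LinearMap.id) := by
    ext v
    have h1 : ∀ w, f (p w) = p.baseChange S (f' w) := fun _ => rfl
    have h2 : ∀ w, p.baseChange S (s w) = w := LinearMap.congr_fun hs
    simp only [LinearMap.comp_apply, h1, hq, LinearMap.smul_apply, LinearMap.id_apply, map_smul]
    rw [← algebraMap_smul S, map_smul, algebraMap_smul, h2]
  obtain ⟨t, ht⟩ := Module.Finite.exists_smul_of_comp_eq_of_isLocalizedModule M f _ _ hpq
  refine ⟨t * r, mul_mem t.2 r.2, (t : R) • q, fun v => ?_⟩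
  have := LinearMap.congr_fun ht v
  simp only [LinearMap.smul_apply, LinearMap.comp_apply, LinearMap.id_apply] at this
  rw [LinearMap.smul_apply, map_smul, mul_smul]
  exact this

end Representation

/-! ### Symmetric powers: grading, base change, projectivity -/

namespace SymPow

variable {R S T : Type u} [CommRing R] [CommRing S] [CommRing T]
  {M N L : Type u} [AddCommGroup M] [AddCommGroup N] [AddCommGroup L]
  [Module R M] [Module S N] [Module T L]

open SymmetricAlgebra Polynomial

/-- `algMap` as a semilinear map. -/
def algLin (φ : R →+* S) (f : M →ₛₗ[φ] N) : SymmetricAlgebra R M →ₛₗ[φ] SymmetricAlgebra S N where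
  toFun := algMap φ f
  map_add' := map_add _
  map_smul' := algMap_smul φ f

@[simp]
theorem algLin_apply (φ : R →+* S) (f : M →ₛₗ[φ] N) (x : SymmetricAlgebra R M) :
    algLin φ f x = algMap φ f x := rfl

@[simp]
theorem map_coe (φ : R →+* S) (f : M →ₛₗ[φ] N) (n : ℕ) (x : part R M n) :
    (map φ f n x : SymmetricAlgebra S N) = algMap φ f x := rfl

variable (R M) in
/-- The homomorphism `m ↦ m t` that records the degree. -/
def toPoly : SymmetricAlgebra R M →ₐ[R] (SymmetricAlgebra R M)[X] :=
  SymmetricAlgebra.lift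
    (((monomial 1 : SymmetricAlgebra R M →ₗ[SymmetricAlgebra R M] _).restrictScalars R).comp
      (ι R M))

@[simp]
theorem toPoly_ι (m : M) : toPoly R M (ι R M m) = monomial 1 (ι R M m) :=
  SymmetricAlgebra.lift_ι_apply _ m

/-- The exponent of `t` records the degree, so extracting a coefficient gives a projection onto each
symmetric power. -/
theorem toPoly_of_mem {n : ℕ} {x : SymmetricAlgebra R M} (hx : x ∈ part R M n) :
    toPoly R M x = monomial n x := by
  induction hx using Submodule.pow_induction_on_left' with
  | algebraMap r => rw [AlgHom.commutes]; rfl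
  | add x y i hx hy ihx ihy => rw [map_add, ihx, ihy, map_add]
  | mem_mul m hm i x hx ih =>
    obtain ⟨m, rfl⟩ := hm
    rw [map_mul, toPoly_ι, ih, monomial_mul_monomial, add_comm, Nat.succ_eq_add_one]

theorem mul_mem_part {a b : ℕ} {x y : SymmetricAlgebra R M} (hx : x ∈ part R M a)
    (hy : y ∈ part R M b) : x * y ∈ part R M (a + b) := by
  rw [part, pow_add]
  exact Submodule.mul_mem_mul hx hy

theorem algebraMap_mem_part (r : R) : algebraMap R (SymmetricAlgebra R M) r ∈ part R M 0 := by
  rw [part, pow_zero]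
  exact Submodule.algebraMap_mem r

theorem ι_mem_part (m : M) : ι R M m ∈ part R M 1 := by
  rw [part, pow_one]
  exact ⟨m, rfl⟩

theorem coeff_toPoly_mem (x : SymmetricAlgebra R M) (n : ℕ) :
    (toPoly R M x).coeff n ∈ part R M n := by
  induction x using SymmetricAlgebra.induction generalizing n with
  | algebraMap r =>
    rw [toPoly_of_mem (algebraMap_mem_part r), coeff_monomial]
    split_ifs with h
    · exact h ▸ algebraMap_mem_part r
    · exact zero_mem _
  | ι m =>
    rw [toPoly_ι, coeff_monomial]
    split_ifs with h
    · exact h ▸ ι_mem_part m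
    · exact zero_mem _
  | mul a b ha hb =>
    rw [map_mul, coeff_mul]
    refine Submodule.sum_mem _ fun p hp => ?_
    rw [← Finset.HasAntidiagonal.mem_antidiagonal.1 hp]
    exact mul_mem_part (ha _) (hb _)
  | add a b ha hb =>
    rw [map_add, coeff_add]
    exact add_mem (ha n) (hb n)

variable (R M) in
/-- The projection onto the component of degree `n`. -/
def proj (n : ℕ) : SymmetricAlgebra R M →ₗ[R] part R M n where
  toFun x := ⟨(toPoly R M x).coeff n, coeff_toPoly_mem x n⟩
  map_add' a b := Subtype.ext (by simp)
  map_smul' r a := Subtype.ext (by simp)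

theorem proj_coe (n : ℕ) (x : SymmetricAlgebra R M) :
    (proj R M n x : SymmetricAlgebra R M) = (toPoly R M x).coeff n := rfl

theorem proj_self {n : ℕ} (x : part R M n) : proj R M n x = x :=
  Subtype.ext (by rw [proj_coe, toPoly_of_mem x.2, coeff_monomial, if_pos rfl])

theorem coeff_zero_toPoly (x : SymmetricAlgebra R M) :
    (toPoly R M x).coeff 0 = algebraMap R _ (algebraMapInv x) := by
  induction x using SymmetricAlgebra.induction with
  | algebraMap r => simp [Polynomial.algebraMap_apply]
  | ι m => simp [coeff_monomial, algebraMapInv_ι]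
  | mul a b ha hb => rw [map_mul, mul_coeff_zero, ha, hb, map_mul, map_mul]
  | add a b ha hb => rw [map_add, coeff_add, ha, hb, map_add, map_add]

/-- As `u` already has degree `a`, only the degree zero part of `x` contributes in degree `a`. -/
theorem proj_mul {a : ℕ} (u : part R M a) (x : SymmetricAlgebra R M) :
    proj R M a (u * x) = algebraMapInv x • u := by
  refine Subtype.ext ?_
  rw [proj_coe, map_mul, toPoly_of_mem u.2]
  have := coeff_monomial_mul (toPoly R M x) a 0 (u : SymmetricAlgebra R M)
  rw [zero_add] at this
  rw [this, coeff_zero_toPoly, mul_comm, ← Algebra.smul_def]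
  rfl

theorem toPoly_algMap (φ : R →+* S) (f : M →ₛₗ[φ] N) (x : SymmetricAlgebra R M) :
    toPoly S N (algMap φ f x) = (toPoly R M x).map (algMap φ f) := by
  induction x using SymmetricAlgebra.induction with
  | algebraMap r =>
    rw [algMap_algebraMap, AlgHom.commutes, AlgHom.commutes, Polynomial.algebraMap_apply,
      Polynomial.algebraMap_apply, Polynomial.map_C, algMap_algebraMap]
  | ι m => rw [algMap_ι, toPoly_ι, toPoly_ι, map_monomial, algMap_ι]
  | mul a b ha hb => rw [map_mul, map_mul, map_mul, Polynomial.map_mul, ha, hb]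
  | add a b ha hb => rw [map_add, map_add, map_add, Polynomial.map_add, ha, hb]

theorem proj_algMap (φ : R →+* S) (f : M →ₛₗ[φ] N) (n : ℕ) (x : SymmetricAlgebra R M) :
    proj S N n (algMap φ f x) = map φ f n (proj R M n x) :=
  Subtype.ext (by rw [proj_coe, toPoly_algMap, coeff_map, map_coe, proj_coe])

/-- By the universal property of `Sym_S(N)` there is an algebra map to `S ⊗ Sym_R(M)` that sends the
image of `x` to `1 ⊗ x`; a semilinear map out of `Sym_R(M)` extends through it. Generation is
checked on products. -/
theorem isBC_algLin {φ : R →+* S} {f : M →ₛₗ[φ] N} (h : IsBC f) : IsBC (algLin φ f) := by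
  refine IsBC.of_lift_unique (fun Q _ _ g => ?_) (eq_top_iff.2 fun y _ => ?_)
  · let _ : Algebra R S := φ.toAlgebra
    let j : N →ₗ[S] S ⊗[R] SymmetricAlgebra R M := h.lift
      { toFun := fun m => 1 ⊗ₜ ι R M m
        map_add' := fun a b => by rw [map_add, tmul_add]
        map_smul' := fun r m => by
          rw [map_smul, tmul_smul, smul_tmul']
          exact congrArg (· ⊗ₜ _) ((Algebra.algebraMap_eq_smul_one r).symm.trans
            (mul_one (φ r)).symm) }
    have hj : ∀ m, j (f m) = 1 ⊗ₜ ι R M m := fun m => h.lift_apply _ m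
    have hJ : ∀ x, SymmetricAlgebra.lift j (algMap φ f x) = 1 ⊗ₜ x := by
      intro x
      induction x using SymmetricAlgebra.induction with
      | algebraMap r =>
        rw [algMap_algebraMap, AlgHom.commutes, Algebra.TensorProduct.algebraMap_apply]
        have : algebraMap S S (φ r) = r • (1 : S) :=
          ((Algebra.algebraMap_eq_smul_one (A := S) r).symm).symm ▸ rfl
        rw [this, smul_tmul, Algebra.algebraMap_eq_smul_one]
      | ι m => rw [algMap_ι, SymmetricAlgebra.lift_ι_apply, hj]
      | mul a b ha hb => rw [map_mul, map_mul, ha, hb, Algebra.TensorProduct.tmul_mul_tmul, one_mul]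
      | add a b ha hb => rw [map_add, map_add, ha, hb, tmul_add]
    let _ : Module R Q := Module.compHom Q φ
    have : IsScalarTower R S Q := ⟨fun r s n => by rw [Algebra.smul_def, mul_smul]; rfl⟩
    let g₀ : SymmetricAlgebra R M →ₗ[R] Q :=
      { toFun := g, map_add' := map_add g, map_smul' := fun r m => map_smulₛₗ g r m }
    refine ⟨((TensorProduct.isBaseChange R (SymmetricAlgebra R M) S).lift g₀).comp
      (SymmetricAlgebra.lift j).toLinearMap, fun x => ?_⟩
    rw [LinearMap.comp_apply, algLin_apply, AlgHom.toLinearMap_apply, hJ]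
    exact (TensorProduct.isBaseChange R (SymmetricAlgebra R M) S).lift_eq g₀ x
  · induction y using SymmetricAlgebra.induction with
    | algebraMap s =>
      have : algebraMap S (SymmetricAlgebra S N) s = s • algLin φ f 1 := by
        rw [algLin_apply, map_one, Algebra.algebraMap_eq_smul_one]
      rw [this]
      exact Submodule.smul_mem _ _ (Submodule.subset_span ⟨1, rfl⟩)
    | ι n =>
      have hn : n ∈ Submodule.span S (Set.range f) := h.span_range ▸ Submodule.mem_top
      induction hn using Submodule.span_induction with
      | mem x hx =>
        obtain ⟨m, rfl⟩ := hx
        exact Submodule.subset_span ⟨ι R M m, algMap_ι φ f m⟩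
      | zero => rw [map_zero]; exact zero_mem _
      | add x y _ _ hx hy => rw [map_add]; exact add_mem (hx trivial) (hy trivial)
      | smul s x _ hx => rw [map_smul]; exact Submodule.smul_mem _ _ (hx trivial)
    | mul a b ha hb =>
      have := Submodule.mul_mem_mul (ha trivial) (hb trivial)
      rw [Submodule.span_mul_span] at this
      refine Submodule.span_mono ?_ this
      rintro _ ⟨_, ⟨x, rfl⟩, _, ⟨y, rfl⟩, rfl⟩
      exact ⟨x * y, map_mul (algMap φ f) x y⟩
    | add a b ha hb => exact add_mem (ha trivial) (hb trivial)

/-- Symmetric powers commute with base change. -/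
theorem isBC_map {φ : R →+* S} {f : M →ₛₗ[φ] N} (h : IsBC f) (n : ℕ) : IsBC (map φ f n) :=
  -- The degree `n` part is a retract of the symmetric algebra, compatibly with base change.
  (isBC_algLin h).retract (map φ f n) (part R M n).subtype (proj R M n) (part S N n).subtype
    (proj S N n) proj_self proj_self (fun _ => rfl) (proj_algMap φ f n)

instance [Module.Projective R M] : Module.Projective R (SymmetricAlgebra R M) := by
  obtain ⟨s, hs⟩ := Module.projective_def'.1 ‹Module.Projective R M›
  refine Module.Projective.of_split
    (algLin (RingHom.id R) s) (algLin (RingHom.id R) (Finsupp.linearCombination R id)) ?_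
  refine LinearMap.ext fun x => ?_
  rw [LinearMap.comp_apply, algLin_apply, algLin_apply,
    algMap_comp _ _ (RingHom.id R) _ _ LinearMap.id (fun _ => rfl)
      (fun m => (LinearMap.congr_fun hs m).symm)]
  exact algMap_self _ _ (fun _ => rfl) (fun _ => rfl) x

instance [Module.Projective R M] (n : ℕ) : Module.Projective R (part R M n) :=
  Module.Projective.of_split (part R M n).subtype (proj R M n) (LinearMap.ext proj_self)

instance [Module.Finite R M] (n : ℕ) : Module.Finite R (part R M n) :=
  Module.Finite.iff_fg.2 (Submodule.FG.pow (Module.Finite.iff_fg.1 inferInstance) n)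

theorem map_id_apply {f : M →ₗ[R] M} (hf : ∀ m, f m = m) (n : ℕ) (x : part R M n) :
    map (RingHom.id R) f n x = x :=
  Subtype.ext (algMap_self _ _ (fun _ => rfl) hf x.1)

theorem map_map {M₁ M₂ M₃ : Type u} [AddCommGroup M₁] [AddCommGroup M₂] [AddCommGroup M₃]
    [Module R M₁] [Module R M₂] [Module R M₃] (f : M₁ →ₗ[R] M₂) (g : M₂ →ₗ[R] M₃) (n : ℕ)
    (x : part R M₁ n) :
    map (RingHom.id R) g n (map (RingHom.id R) f n x) = map (RingHom.id R) (g.comp f) n x :=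
  Subtype.ext (algMap_comp _ _ _ _ _ _ (fun _ => rfl) (fun _ => rfl) x.1)

theorem map_smul_eq {f : M →ₗ[R] M} {s : R} (hf : ∀ m, f m = s • m) (n : ℕ) (x : part R M n) :
    map (RingHom.id R) f n x = s ^ n • x := by
  refine Subtype.ext ?_
  obtain ⟨x, hx⟩ := x
  change algMap _ f x = s ^ n • x
  induction hx using Submodule.pow_induction_on_left' with
  | algebraMap r => rw [algMap_algebraMap, pow_zero, one_smul]; rfl
  | add x y i hx hy ihx ihy => rw [map_add, ihx, ihy, smul_add]
  | mem_mul m hm i x hx ih =>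
    obtain ⟨m, rfl⟩ := hm
    rw [map_mul, algMap_ι, ih, hf, map_smul, Nat.succ_eq_add_one, pow_succ', smul_mul_smul_comm]

/-! ### Derivations and traces -/

/-- The homomorphism `m ↦ m + θ(m) ε`. -/
def derivHom (θ : Module.End R M) : SymmetricAlgebra R M →ₐ[R] DualNumber (SymmetricAlgebra R M) :=
  SymmetricAlgebra.lift
    ((TrivSqZeroExt.inlAlgHom R (SymmetricAlgebra R M) (SymmetricAlgebra R M)).toLinearMap.comp
      (ι R M) + ((TrivSqZeroExt.inrHom (SymmetricAlgebra R M)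
        (SymmetricAlgebra R M)).restrictScalars R).comp ((ι R M).comp θ))

theorem derivHom_ι (θ : Module.End R M) (m : M) :
    derivHom θ (ι R M m) = TrivSqZeroExt.inl (ι R M m) + TrivSqZeroExt.inr (ι R M (θ m)) :=
  SymmetricAlgebra.lift_ι_apply _ m

theorem fst_derivHom (θ : Module.End R M) (x : SymmetricAlgebra R M) :
    (derivHom θ x).fst = x := by
  induction x using SymmetricAlgebra.induction with
  | algebraMap r => rw [AlgHom.commutes]; rfl
  | ι m => simp [derivHom_ι]
  | mul a b ha hb => rw [map_mul, TrivSqZeroExt.fst_mul, ha, hb]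
  | add a b ha hb => rw [map_add, TrivSqZeroExt.fst_add, ha, hb]

/-- The derivation of the symmetric algebra that extends an endomorphism. -/
def deriv (θ : Module.End R M) : SymmetricAlgebra R M →ₗ[R] SymmetricAlgebra R M where
  toFun x := (derivHom θ x).snd
  map_add' a b := by simp
  map_smul' r a := by simp

theorem deriv_ι (θ : Module.End R M) (m : M) : deriv θ (ι R M m) = ι R M (θ m) := by
  change (derivHom θ _).snd = _
  simp [derivHom_ι]

theorem deriv_mul (θ : Module.End R M) (x y : SymmetricAlgebra R M) :
    deriv θ (x * y) = x * deriv θ y + deriv θ x * y := by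
  change (derivHom θ _).snd = x * (derivHom θ y).snd + (derivHom θ x).snd * y
  rw [map_mul, TrivSqZeroExt.snd_mul, fst_derivHom, fst_derivHom, smul_eq_mul]
  rfl

theorem deriv_algebraMap (θ : Module.End R M) (r : R) : deriv θ (algebraMap R _ r) = 0 := by
  change (derivHom θ _).snd = 0
  rw [AlgHom.commutes]
  rfl

theorem deriv_mem (θ : Module.End R M) {n : ℕ} {x : SymmetricAlgebra R M} (hx : x ∈ part R M n) :
    deriv θ x ∈ part R M n := by
  induction hx using Submodule.pow_induction_on_left' with
  | algebraMap r => rw [deriv_algebraMap]; exact zero_mem _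
  | add x y i hx hy ihx ihy => rw [map_add]; exact add_mem ihx ihy
  | mem_mul m hm i x hx ih =>
    obtain ⟨m, rfl⟩ := hm
    rw [deriv_mul, deriv_ι, Nat.succ_eq_add_one, add_comm i]
    exact add_mem (mul_mem_part (ι_mem_part m) ih) (mul_mem_part (ι_mem_part _) hx)

/-- The symmetric power of a representation. -/
def rep {G : Type v} [Group G] (ρ : Representation R G M) (n : ℕ) :
    Representation R G (part R M n) where
  toFun g := map (RingHom.id _) (ρ g) n
  map_one' := LinearMap.ext fun m => map_id_apply (fun a => by rw [map_one]; rfl) n m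
  map_mul' g g' := LinearMap.ext fun m => by
    rw [Module.End.mul_apply, map_map, map_mul]
    rfl

/-- The trace of the derivation extending `θ` is the derivation extending `∑ g θ g⁻¹ = 1`. That is
the Euler derivation, which multiplies degree `n` by `n`. -/
theorem hasTrace_rep {G : Type v} [Group G] [Fintype G] {ρ : Representation R G M}
    (h : ρ.HasTrace 1) (n : ℕ) : (rep ρ n).HasTrace (n : R) := by
  obtain ⟨θ, hθ⟩ := h
  let E : SymmetricAlgebra R M →ₗ[R] SymmetricAlgebra R M :=
    ∑ g, algLin (RingHom.id R) (ρ g) ∘ₗ deriv θ ∘ₗ algLin (RingHom.id R) (ρ g⁻¹)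
  have hE : ∀ x, E x = ∑ g, algMap (RingHom.id R) (ρ g) (deriv θ (algMap (RingHom.id R)
      (ρ g⁻¹) x)) :=
    fun x => by simp [E]
  have hid : ∀ g x, algMap (RingHom.id R) (ρ g) (algMap (RingHom.id R) (ρ g⁻¹) x) = x := by
    intro g x
    rw [algMap_comp _ _ (RingHom.id R) _ _ LinearMap.id (fun _ => rfl) (fun m => by simp)]
    exact algMap_self _ _ (fun _ => rfl) (fun _ => rfl) x
  have hEn : ∀ {n : ℕ} {x}, x ∈ part R M n → E x = (n : R) • x := by
    intro n x hx
    induction hx using Submodule.pow_induction_on_left' with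
    | algebraMap r => simp [hE, algMap_algebraMap, deriv_algebraMap]
    | add x y i hx hy ihx ihy => rw [map_add, ihx, ihy, smul_add]
    | mem_mul m hm i x hx ih =>
      obtain ⟨m, rfl⟩ := hm
      have h1 : E (ι R M m * x) = ι R M m * E x + E (ι R M m) * x := by
        simp only [hE, Finset.mul_sum, Finset.sum_mul, ← Finset.sum_add_distrib]
        refine Finset.sum_congr rfl fun g _ => ?_
        rw [map_mul, deriv_mul, map_add, map_mul, map_mul, hid, hid]
      have h2 : E (ι R M m) = ι R M m := by
        simp only [hE, algMap_ι, deriv_ι, ← map_sum, hθ, one_smul]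
      rw [h1, h2, ih, Nat.succ_eq_add_one, Nat.cast_add, add_smul, mul_smul_comm, Nat.cast_one,
        one_smul]
  refine ⟨(deriv θ).restrict fun x hx => deriv_mem θ hx, fun x => Subtype.ext ?_⟩
  rw [Submodule.coe_sum]
  exact (hE x).symm.trans (hEn x.2)

/-! ### The filtration of a symmetric power of an extension -/

section Filtration

variable {A B C : Type u} [AddCommGroup A] [AddCommGroup B] [AddCommGroup C]
  [Module R A] [Module R B] [Module R C] (f : A →ₗ[R] B) {g : B →ₗ[R] C}

/-- The span of the products of `a` elements of `A` and `b` elements of `B`. -/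
def fil (a b : ℕ) : Submodule R (SymmetricAlgebra R B) :=
  (part R A a).map (algLin (RingHom.id R) f) * part R B b

theorem mul_mem_fil {a b : ℕ} (u : part R A a) (v : part R B b) :
    algMap (RingHom.id R) f u * v ∈ fil f a b :=
  Submodule.mul_mem_mul ⟨u, u.2, rfl⟩ v.2

theorem fil_induction {a b : ℕ} {motive : fil f a b → Prop}
    (mul : ∀ u v, motive ⟨_, mul_mem_fil f u v⟩) (add : ∀ x y, motive x → motive y → motive (x + y))
    (x : fil f a b) : motive x := by
  obtain ⟨x, hx⟩ := x
  induction hx using Submodule.mul_induction_on' with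
  | mem_mul_mem m hm n hn =>
    obtain ⟨u, hu, rfl⟩ := hm
    exact mul ⟨u, hu⟩ ⟨n, hn⟩
  | add x hx y hy ihx ihy => exact add _ _ ihx ihy

theorem fil_zero (n : ℕ) : fil f 0 n = part R B n := by
  have : (part R A 0).map (algLin (RingHom.id R) f) = 1 := by
    rw [part, pow_zero, Submodule.one_eq_span, Submodule.map_span, Set.image_singleton,
      algLin_apply, map_one, ← Submodule.one_eq_span]
  rw [fil, this, one_mul]

/-- One factor from `A` is regarded as a factor from `B`. -/
theorem fil_le (a b : ℕ) : fil f (a + 1) b ≤ fil f a (b + 1) := by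
  refine Submodule.mul_le.2 ?_
  rintro _ ⟨u, hu, rfl⟩ v hv
  rw [SetLike.mem_coe, part, pow_succ] at hu
  induction hu using Submodule.mul_induction_on' with
  | mem_mul_mem m hm n hn =>
    obtain ⟨n, rfl⟩ := hn
    have h2 : ι R B (f n) * v ∈ part R B (b + 1) := by
      rw [add_comm]; exact mul_mem_part (ι_mem_part _) hv
    have := mul_mem_fil f (⟨m, hm⟩ : part R A a) ⟨_, h2⟩
    simpa [algMap_ι, mul_assoc] using this
  | add x hx y hy ihx ihy => rw [map_add, add_mul]; exact add_mem ihx ihy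

theorem algMap_mem_fil (n : ℕ) (u : part R A n) : algMap (RingHom.id R) f u ∈ fil f n 0 := by
  have h1 : (1 : SymmetricAlgebra R B) ∈ part R B 0 := by
    rw [← map_one (algebraMap R (SymmetricAlgebra R B))]
    exact algebraMap_mem_part 1
  have := mul_mem_fil f u ⟨_, h1⟩
  rwa [mul_one] at this

theorem exists_of_mem_fil_zero {n : ℕ} {x : SymmetricAlgebra R B} (hx : x ∈ fil f n 0) :
    ∃ u : part R A n, algMap (RingHom.id R) f u = x := by
  rw [fil, part, part, pow_zero, mul_one] at hx
  obtain ⟨u, hu, rfl⟩ := hx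
  exact ⟨⟨u, hu⟩, rfl⟩

theorem algMap_injective (r : B →ₗ[R] A) (hr : ∀ a, r (f a) = a) :
    Function.Injective (algMap (RingHom.id R) f) := by
  refine Function.LeftInverse.injective (g := algMap (RingHom.id R) r) fun x => ?_
  rw [algMap_comp _ _ (RingHom.id R) _ _ LinearMap.id (fun _ => rfl) (fun m => (hr m).symm)]
  exact algMap_self _ _ (fun _ => rfl) (fun _ => rfl) x

variable {f}

/-- The homomorphism from the `a`-th step of the filtration to the graded piece. -/
theorem exists_fil_quotient (s : C →ₗ[R] B) (r : B →ₗ[R] A) (hr : ∀ a, r (f a) = a)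
    (hgf : ∀ a, g (f a) = 0) (hgs : ∀ c, g (s c) = c)
        (a b : ℕ) : ∃ q : fil f a b →ₗ[R] part R A a ⊗[R] part R C b,
      (∀ u v, q ⟨_, mul_mem_fil f u v⟩ = u ⊗ₜ map (RingHom.id R) g b v) ∧
      Function.Surjective q := by
  -- `Θ` is the decomposition of `Sym(B)` given by the splitting of `B`, followed below by the
  -- projection to bidegree `(a, b)`.
  let Θ : SymmetricAlgebra R B →ₐ[R] SymmetricAlgebra R A ⊗[R] SymmetricAlgebra R C :=
    SymmetricAlgebra.lift
      ((Algebra.TensorProduct.includeLeft (R := R) (S := R) (A := SymmetricAlgebra R A)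
          (B := SymmetricAlgebra R C)).toLinearMap ∘ₗ ι R A ∘ₗ r +
        (Algebra.TensorProduct.includeRight (R := R) (A := SymmetricAlgebra R A)
          (B := SymmetricAlgebra R C)).toLinearMap ∘ₗ ι R C ∘ₗ g)
  have hΘ : ∀ b, Θ (ι R B b) = ι R A (r b) ⊗ₜ 1 + 1 ⊗ₜ ι R C (g b) := fun b =>
    SymmetricAlgebra.lift_ι_apply _ b
  let E : SymmetricAlgebra R A ⊗[R] SymmetricAlgebra R C →ₐ[R] SymmetricAlgebra R C :=
    (Algebra.TensorProduct.lid R (SymmetricAlgebra R C)).toAlgHom.comp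
      (Algebra.TensorProduct.map algebraMapInv (AlgHom.id R _))
  have hE : ∀ x y, E (x ⊗ₜ y) = algebraMapInv x • y := fun x y => by simp [E]
  have hEΘ : ∀ x, E (Θ x) = algMap (RingHom.id R) g x := by
    intro x
    induction x using SymmetricAlgebra.induction with
    | algebraMap t => rw [AlgHom.commutes, AlgHom.commutes, algMap_algebraMap]; rfl
    | ι m => rw [hΘ, map_add, hE, hE, algebraMapInv_ι, zero_smul, zero_add, map_one, one_smul,
        algMap_ι]
    | mul x y hx hy => rw [map_mul, map_mul, map_mul, hx, hy]
    | add x y hx hy => rw [map_add, map_add, map_add, hx, hy]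
  have hΘf : ∀ x, Θ (algMap (RingHom.id R) f x) = x ⊗ₜ 1 := by
    intro x
    induction x using SymmetricAlgebra.induction with
    | algebraMap t => rw [algMap_algebraMap, AlgHom.commutes]; rfl
    | ι m => rw [algMap_ι, hΘ, hgf, hr, map_zero, tmul_zero, add_zero]
    | mul x y hx hy => rw [map_mul, map_mul, hx, hy, Algebra.TensorProduct.tmul_mul_tmul, mul_one]
    | add x y hx hy => rw [map_add, map_add, hx, hy, add_tmul]
  -- As `u` fills degree `a`, only the part of `y` of degree zero in `A` survives. This is why the
  -- value of `q` on products does not involve the chosen splitting.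
  have key : ∀ (u : part R A a) y, TensorProduct.map (proj R A a) (proj R C b)
      (((u : SymmetricAlgebra R A) ⊗ₜ 1) * y) = u ⊗ₜ proj R C b (E y) := by
    intro u y
    induction y using TensorProduct.induction_on with
    | zero => simp
    | tmul x z => rw [Algebra.TensorProduct.tmul_mul_tmul, one_mul, map_tmul, proj_mul, hE, map_smul,
        smul_tmul]
    | add x y hx hy => rw [mul_add, map_add, hx, hy, map_add, map_add, tmul_add]
  refine ⟨(TensorProduct.map (proj R A a) (proj R C b) ∘ₗ Θ.toLinearMap).comp (fil f a b).subtype,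
    fun u v => ?_, fun y => ?_⟩
  · simp only [LinearMap.comp_apply, Submodule.subtype_apply, AlgHom.toLinearMap_apply, map_mul, hΘf,
      key, hEΘ]
    rw [proj_algMap, proj_self]
  · induction y using TensorProduct.induction_on with
    | zero => exact ⟨0, map_zero _⟩
    | tmul u w =>
      refine ⟨⟨_, mul_mem_fil f u (map (RingHom.id R) s b w)⟩, ?_⟩
      simp only [LinearMap.comp_apply, Submodule.subtype_apply, AlgHom.toLinearMap_apply, map_mul,
        hΘf, key, hEΘ]
      rw [proj_algMap, proj_self, map_map, map_id_apply hgs]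
    | add x y hx hy =>
      obtain ⟨x', rfl⟩ := hx
      obtain ⟨y', rfl⟩ := hy
      exact ⟨x' + y', map_add _ _ _⟩

/-- The quotient maps are built from splittings chosen separately on each affine open. Being
determined by their values on products, they still commute with restriction and with `G`. -/
theorem fil_quotient_unique {a b : ℕ} {Q : Type*} [AddCommGroup Q] {q q' : fil f a b →+ Q}
    (h : ∀ u v, q ⟨_, mul_mem_fil f u v⟩ = q' ⟨_, mul_mem_fil f u v⟩) : q = q' :=
  AddMonoidHom.ext fun x => fil_induction f (motive := fun x => q x = q' x) h
    (fun x y hx hy => by rw [map_add, map_add, hx, hy]) x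

/-- Modulo products with a factor from `A`, every `b` equals its image `s (g b)`; a telescoping
product extends this to higher degrees. -/
theorem sub_mem_fil (s : C →ₗ[R] B) (r : B →ₗ[R] A) (hsr : ∀ b, f (r b) + s (g b) = b) {n : ℕ}
    {v : SymmetricAlgebra R B} (hv : v ∈ part R B (n + 1)) :
    v - algMap (RingHom.id R) (s.comp g) v ∈ fil f 1 n := by
  have hι : ∀ b, ι R B b - ι R B (s (g b)) = algMap (RingHom.id R) f (ι R A (r b)) := by
    intro b
    rw [algMap_ι, ← map_sub, sub_eq_iff_eq_add.2 (hsr b).symm]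
  induction n generalizing v with
  | zero =>
    rw [part, zero_add, pow_one] at hv
    obtain ⟨b, rfl⟩ := hv
    rw [algMap_ι, LinearMap.comp_apply, hι]
    exact algMap_mem_fil f 1 ⟨_, ι_mem_part _⟩
  | succ n ih =>
    rw [part, pow_succ'] at hv
    induction hv using Submodule.mul_induction_on' with
    | mem_mul_mem m hm v hv =>
      obtain ⟨b, rfl⟩ := hm
      have e : ι R B b * v - algMap (RingHom.id R) (s.comp g) (ι R B b * v) =
          (ι R B b - ι R B (s (g b))) * v +
            (v - algMap (RingHom.id R) (s.comp g) v) * ι R B (s (g b)) := by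
        rw [map_mul, algMap_ι, LinearMap.comp_apply]; ring
      rw [e]
      refine add_mem ?_ ?_
      · rw [hι]
        exact mul_mem_fil f ⟨_, ι_mem_part _⟩ ⟨v, hv⟩
      · have := Submodule.mul_mem_mul (ih hv) (ι_mem_part (R := R) (s (g b)))
        rw [fil, mul_assoc, ← pow_add] at this
        exact this
    | add x hx y hy ihx ihy =>
      have e : x + y - algMap (RingHom.id R) (s.comp g) (x + y) =
          (x - algMap (RingHom.id R) (s.comp g) x) + (y - algMap (RingHom.id R) (s.comp g) y) := by
        rw [map_add]; abel
      rw [e]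
      exact add_mem ihx ihy

/-- Multiplication after applying `s` inverts `q` up to the next step of the filtration. Conversely,
a product with an additional factor from `A` is killed because `g` annihilates that factor. -/
theorem fil_exact (s : C →ₗ[R] B) (r : B →ₗ[R] A)
    (hgf : ∀ a, g (f a) = 0) (hsr : ∀ b, f (r b) + s (g b) = b)
    {a b : ℕ} (q : fil f a (b + 1) →ₗ[R] part R A a ⊗[R] part R C (b + 1))
    (hq : ∀ u v, q ⟨_, mul_mem_fil f u v⟩ = u ⊗ₜ map (RingHom.id R) g (b + 1) v)
    (x : fil f a (b + 1)) : q x = 0 ↔ (x : SymmetricAlgebra R B) ∈ fil f (a + 1) b := by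
  constructor
  · let τ : part R A a ⊗[R] part R C (b + 1) →ₗ[R] SymmetricAlgebra R B :=
      TensorProduct.lift ((LinearMap.mul R (SymmetricAlgebra R B)).compl₁₂
        (algLin (RingHom.id R) f ∘ₗ (part R A a).subtype)
        (algLin (RingHom.id R) s ∘ₗ (part R C (b + 1)).subtype))
    have hτ : ∀ x : fil f a (b + 1), (x : SymmetricAlgebra R B) - τ (q x) ∈ fil f (a + 1) b := by
      intro x
      induction x using fil_induction with
      | mul u v =>
        rw [hq]
        have e : τ (u ⊗ₜ map (RingHom.id R) g (b + 1) v) = algMap (RingHom.id R) f u *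
            algMap (RingHom.id R) (s.comp g) v := by
          simp only [τ, TensorProduct.lift.tmul, LinearMap.compl₁₂_apply, LinearMap.mul_apply',
            LinearMap.comp_apply, Submodule.subtype_apply, algLin_apply, map_coe]
          rw [algMap_comp _ _ (RingHom.id R) _ _ (s.comp g) (fun _ => rfl) (fun m => rfl)]
        rw [e, ← mul_sub]
        have h1 := Submodule.mul_mem_mul (Submodule.mem_map_of_mem (f := algLin
            (RingHom.id R) f) u.2)
          (sub_mem_fil s r hsr v.2)
        rw [fil, ← mul_assoc] at h1
        have hle : Submodule.map (algLin (RingHom.id R) f) (part R A a) *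
            Submodule.map (algLin (RingHom.id R) f) (part R A 1) ≤
            Submodule.map (algLin (RingHom.id R) f) (part R A (a + 1)) := by
          refine Submodule.mul_le.2 ?_
          rintro _ ⟨x, hx, rfl⟩ _ ⟨y, hy, rfl⟩
          exact ⟨x * y, mul_mem_part hx hy, map_mul (algMap (RingHom.id R) f) x y⟩
        exact (Submodule.mul_le.2 fun m hm n hn => Submodule.mul_mem_mul (hle hm) hn) h1
      | add x y hx hy =>
        rw [map_add, map_add, Submodule.coe_add, add_sub_add_comm]
        exact add_mem hx hy
    intro h
    have := hτ x
    rwa [h, map_zero, sub_zero] at this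
  · obtain ⟨x, hx⟩ := x
    intro h
    have key : ∀ y : fil f (a + 1) b, q ⟨y, fil_le f a b y.2⟩ = 0 := by
      intro y
      induction y using fil_induction with
      | mul u v =>
        obtain ⟨u, hu⟩ := u
        have hu' := hu
        rw [part, pow_succ] at hu'
        have hz : ∀ (m : SymmetricAlgebra R A) (hm : m ∈ part R A a) (n : A)
            (h : algMap (RingHom.id R) f (m * ι R A n) * v ∈ fil f a (b + 1)), q ⟨_, h⟩ = 0 := by
          intro m hm n h
          have h2 : ι R B (f n) * v ∈ part R B (b + 1) := by
            rw [add_comm]; exact mul_mem_part (ι_mem_part _) v.2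
          have := hq ⟨m, hm⟩ ⟨_, h2⟩
          have h0 : map (RingHom.id R) g (b + 1) ⟨_, h2⟩ = 0 := Subtype.ext (by
            rw [map_coe]
            change algMap _ g (ι R B (f n) * v) = 0
            rw [map_mul, algMap_ι, hgf, map_zero, zero_mul])
          rw [h0, tmul_zero] at this
          rw [← this]
          congr 2
          rw [map_mul, algMap_ι, mul_assoc]
        have : ∀ h : algMap (RingHom.id R) f u * v ∈ fil f a (b + 1), q ⟨_, h⟩ = 0 := by
          clear hu
          induction hu' using Submodule.mul_induction_on' with
          | mem_mul_mem m hm n hn =>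
            obtain ⟨n, rfl⟩ := hn
            exact hz m hm n
          | add x hx y hy ihx ihy =>
            intro h
            have hx' := fil_le f a b (mul_mem_fil f (⟨x, by rw [part, pow_succ]; exact hx⟩ :
              part R A (a + 1)) v)
            have hy' := fil_le f a b (mul_mem_fil f (⟨y, by rw [part, pow_succ]; exact hy⟩ :
              part R A (a + 1)) v)
            have := map_add q ⟨_, hx'⟩ ⟨_, hy'⟩
            rw [ihx, ihy, add_zero] at this
            rw [← this]
            congr 2
            rw [map_add, add_mul]
        exact this _
      | add x y hx hy =>
        have := map_add q ⟨_, fil_le f a b x.2⟩ ⟨_, fil_le f a b y.2⟩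
        rw [hx, hy, add_zero] at this
        exact this
    exact key ⟨x, h⟩

end Filtration

end SymPow

/-! ### Functions on affine open subsets -/

section Functions

variable {X : Scheme.{u}}

theorem resHom_flat {U V : X.affineOpens} (h : V ≤ U) : (resHom h).Flat := by
  have := (CategoryTheory.CategoryStruct.id X : X ⟶ X).flat_appLE U.2 V.2 h
  have h2 : (CategoryTheory.CategoryStruct.id X : X ⟶ X).appLE U.1 V.1 h =
      X.presheaf.map (CategoryTheory.homOfLE (show V.1 ≤ U.1 from h)).op := by
    simp only [Scheme.Hom.appLE, Scheme.Hom.id_app]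
    exact CategoryTheory.Category.id_comp _
  rw [h2] at this
  exact this

instance affineOpens_isNoetherianRing [IsLocallyNoetherian X] (U : X.affineOpens) :
    IsNoetherianRing Γ(X, U.1) :=
  IsLocallyNoetherian.component_noetherian U

theorem mem_basicOpen_iff_notMem {U : X.affineOpens} (x : U.1) (r : Γ(X, U.1)) :
    x.1 ∈ X.basicOpen r ↔ r ∉ (U.2.primeIdealOf x).asIdeal := by
  have := U.2.isLocalization_stalk x
  rw [Scheme.mem_basicOpen X r x.1 x.2]
  exact IsLocalization.AtPrime.isUnit_to_map_iff (X.presheaf.stalk x.1)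
    (U.2.primeIdealOf x).asIdeal r

theorem exists_point {U : X.affineOpens} (p : PrimeSpectrum Γ(X, U.1)) :
    ∃ x : U.1, U.2.primeIdealOf x = p := by
  refine ⟨⟨U.2.fromSpec p, ?_⟩, ?_⟩
  · have := U.2.range_fromSpec
    exact (this ▸ Set.mem_range_self p : U.2.fromSpec p ∈ (U.1 : Set X))
  · have := U.2.isOpenImmersion_fromSpec
    apply U.2.fromSpec.isOpenEmbedding.injective
    exact U.2.fromSpec_primeIdealOf _

/-- This is the local-to-global principle of the whole proof: if the functions for which a statement
holds form an ideal, it suffices to find near each point one that is invertible there. -/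
theorem ideal_eq_top {U : X.affineOpens} {I : Ideal Γ(X, U.1)}
    (h : ∀ x : U.1, ∃ r ∈ I, x.1 ∈ X.basicOpen r) : I = ⊤ := by
  by_contra hI
  obtain ⟨m, hm, hIm⟩ := I.exists_le_maximal hI
  obtain ⟨x, hx⟩ := exists_point ⟨m, hm.isPrime⟩
  obtain ⟨r, hr, hxr⟩ := h x
  rw [mem_basicOpen_iff_notMem, hx] at hxr
  exact hxr (hIm hr)

theorem mem_basicOpen_resHom {U V : X.affineOpens} (h : V ≤ U) (r : Γ(X, U.1)) {x : X}
    (hx : x ∈ V.1) :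
    x ∈ X.basicOpen (resHom h r) ↔ x ∈ X.basicOpen r := by
  unfold resHom
  have := Scheme.basicOpen_res X r (CategoryTheory.homOfLE (show V.1 ≤ U.1 from h)).op
  constructor
  · intro hh
    have h2 := this ▸ hh
    exact h2.2
  · intro hh
    have : x ∈ V.1 ⊓ X.basicOpen r := ⟨hx, hh⟩
    rwa [← Scheme.basicOpen_res X r (CategoryTheory.homOfLE (show V.1 ≤ U.1 from h)).op] at this

theorem mem_basicOpen_mul {U : X.Opens} {r s : Γ(X, U)} {x : X} :
    x ∈ X.basicOpen (r * s) ↔ x ∈ X.basicOpen r ∧ x ∈ X.basicOpen s := by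
  rw [Scheme.basicOpen_mul]; rfl

theorem mem_basicOpen_one {U : X.Opens} {x : X} (hx : x ∈ U) : x ∈ X.basicOpen (1 : Γ(X, U)) := by
  rw [Scheme.basicOpen_of_isUnit X isUnit_one]; exact hx

end Functions

namespace OXGMod

variable {X : Scheme.{u}} {G : Type v} [Group G]

theorem isQuasicoherent_iff {P : OXGMod X G} :
    P.IsQuasicoherent ↔ ∀ (U V : X.affineOpens) (h : V ≤ U), IsBC (P.res h) := by
  refine forall_congr' fun U => forall_congr' fun V => forall_congr' fun h => ?_
  let _ : Algebra Γ(X, U.1) Γ(X, V.1) := (resHom h).toAlgebra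
  let _ : Module Γ(X, U.1) (P.sec V) := Module.compHom _ (resHom h)
  have : IsScalarTower Γ(X, U.1) Γ(X, V.1) (P.sec V) := ⟨fun r s m => mul_smul (resHom h r) s m⟩
  exact (isBC_iff_isBaseChange rfl (P.res h) _ fun _ => rfl).symm

theorem IsCoherent.isBC {P : OXGMod X G} (hP : P.IsCoherent) {U V : X.affineOpens} (h : V ≤ U) :
    IsBC (P.res h) :=
  isQuasicoherent_iff.1 hP.1 U V h

/-! #### Homomorphisms -/

namespace Hom

variable {P Q R : OXGMod X G}

/-- The identity. -/
def id (P : OXGMod X G) : Hom P P where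
  app _ := LinearMap.id
  app_res _ _ := rfl
  app_rho _ _ _ := rfl

/-- Composition. -/
def comp (g : Hom Q R) (f : Hom P Q) : Hom P R where
  app U := (g.app U).comp (f.app U)
  app_res h m := by simp only [LinearMap.comp_apply, f.app_res, g.app_res]
  app_rho U a m := by simp only [LinearMap.comp_apply, f.app_rho, g.app_rho]

end Hom

/-- `P` and `Q` are isomorphic. -/
def Iso (P Q : OXGMod X G) : Prop := ∃ f : Hom P Q, ∀ U, Function.Bijective (f.app U)

theorem Iso.refl (P : OXGMod X G) : Iso P P := ⟨Hom.id P, fun _ => Function.bijective_id⟩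

theorem Iso.symm {P Q : OXGMod X G} (h : Iso P Q) : Iso Q P := by
  obtain ⟨f, hf⟩ := h
  let e (U : X.affineOpens) := LinearEquiv.ofBijective (f.app U) (hf U)
  have he (U : X.affineOpens) (m : Q.sec U) : f.app U ((e U).symm m) = m := (e U).apply_symm_apply m
  exact ⟨{ app := fun U => (e U).symm
           app_res := fun {U V} h m => (hf V).1 (by
            change f.app V ((e V).symm _) = f.app V (P.res h ((e U).symm m))
            rw [f.app_res, he, he])
           app_rho := fun U a m => (hf U).1 (by
            change f.app U ((e U).symm _) = f.app U (P.rho U a ((e U).symm m))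
            rw [f.app_rho, he, he]) }, fun U => (e U).symm.bijective⟩

theorem Iso.trans {P Q R : OXGMod X G} (h : Iso P Q) (h' : Iso Q R) : Iso P R := by
  obtain ⟨f, hf⟩ := h
  obtain ⟨g, hg⟩ := h'
  exact ⟨g.comp f, fun U => (hg U).comp (hf U)⟩

/-- The zero module. -/
def zero (X : Scheme.{u}) (G : Type v) [Group G] : OXGMod X G where
  sec _ := PUnit
  res _ := 0
  res_self _ _ := rfl
  res_comp _ _ _ := rfl
  rho _ := 1
  rho_res _ _ _ := rfl

/-- Writing isomorphisms as exact sequences makes every statement about extensions, and every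
relation in a Grothendieck group, yield invariance under isomorphism. -/
theorem Iso.ses_zero_left {A B : OXGMod X G} (h : Iso A B) : Ses (zero X G) A B := by
  obtain ⟨f, hf⟩ := h
  refine ⟨⟨fun _ => 0, fun _ _ => (map_zero _).symm, fun _ _ _ => (map_zero _).symm⟩, f,
    fun U => ⟨fun _ _ _ => rfl, fun y => ?_, (hf U).2⟩⟩
  constructor
  · intro hy
    exact ⟨PUnit.unit, ((hf U).1 (hy.trans (map_zero _).symm)).symm⟩
  · rintro ⟨_, rfl⟩
    exact map_zero _

/-- The direct sum. -/
def prod (P Q : OXGMod X G) : OXGMod X G where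
  sec U := P.sec U × Q.sec U
  res h :=
    { toFun := fun m => (P.res h m.1, Q.res h m.2)
      map_add' := fun _ _ => Prod.ext (map_add _ _ _) (map_add _ _ _)
      map_smul' := fun _ _ => Prod.ext (map_smulₛₗ _ _ _) (map_smulₛₗ _ _ _) }
  res_self U _ := Prod.ext (P.res_self U _) (Q.res_self U _)
  res_comp h h' _ := Prod.ext (P.res_comp h h' _) (Q.res_comp h h' _)
  rho U := (P.rho U).prod (Q.rho U)
  rho_res h g _ := Prod.ext (P.rho_res h g _) (Q.rho_res h g _)

theorem ses_prod (P Q : OXGMod X G) : Ses P (P.prod Q) Q := by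
  refine ⟨⟨fun _ => LinearMap.inl _ _ _, fun h _ => ?_, fun U g _ => ?_⟩,
    ⟨fun _ => LinearMap.snd _ _ _, fun _ _ => rfl, fun _ _ _ => rfl⟩,
    fun U => ⟨LinearMap.inl_injective, Function.Exact.inl_snd, LinearMap.snd_surjective⟩⟩
  · exact Prod.ext rfl (map_zero (Q.res h)).symm
  · exact Prod.ext rfl (map_zero (Q.rho U g)).symm

/-- A submodule stable under restriction and the action of `G`. -/
def sub (P : OXGMod X G) (S : ∀ U, Submodule Γ(X, U.1) (P.sec U))
    (hres : ∀ {U V : X.affineOpens} (h : V ≤ U) m, m ∈ S U → P.res h m ∈ S V)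
    (hrho : ∀ (U : X.affineOpens) (g : G) m, m ∈ S U → P.rho U g m ∈ S U) : OXGMod X G where
  sec U := S U
  res h :=
    { toFun := fun m => ⟨P.res h m.1, hres h m.1 m.2⟩
      map_add' := fun _ _ => Subtype.ext (map_add _ _ _)
      map_smul' := fun _ _ => Subtype.ext (map_smulₛₗ _ _ _) }
  res_self U m := Subtype.ext (P.res_self U _)
  res_comp h h' m := Subtype.ext (P.res_comp h h' _)
  rho U := 
    { toFun := fun g => (P.rho U g).restrict (hrho U g)
      map_one' := LinearMap.ext fun m => Subtype.ext (by
        change P.rho U 1 m.1 = m.1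
        rw [map_one]; rfl)
      map_mul' := fun a b => LinearMap.ext fun m => Subtype.ext (by
        change P.rho U (a * b) m.1 = P.rho U a (P.rho U b m.1)
        rw [map_mul]; rfl) }
  rho_res h g m := Subtype.ext (P.rho_res h g _)

/-- The inclusion of a submodule. -/
def subι {P : OXGMod X G} {S : ∀ U, Submodule Γ(X, U.1) (P.sec U)}
    {hres : ∀ {U V : X.affineOpens} (h : V ≤ U) m, m ∈ S U → P.res h m ∈ S V}
    {hrho : ∀ (U : X.affineOpens) (g : G) m, m ∈ S U → P.rho U g m ∈ S U} :
    Hom (P.sub S hres hrho) P where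
  app U := (S U).subtype
  app_res _ _ := rfl
  app_rho _ _ _ := rfl

/-- The kernel of a homomorphism. -/
def kernel {P Q : OXGMod X G} (f : Hom P Q) : OXGMod X G :=
  P.sub (fun U => LinearMap.ker (f.app U))
    (fun h m hm => by rw [LinearMap.mem_ker] at hm ⊢; rw [f.app_res, hm, map_zero])
    (fun U g m hm => by rw [LinearMap.mem_ker] at hm ⊢; rw [f.app_rho, hm, map_zero])

/-- The inclusion of the kernel. -/
def kernelι {P Q : OXGMod X G} (f : Hom P Q) : Hom (kernel f) P where
  app U := (LinearMap.ker (f.app U)).subtype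
  app_res _ _ := rfl
  app_rho _ _ _ := rfl

theorem ses_kernel {P Q : OXGMod X G} (f : Hom P Q) (hf : ∀ U, Function.Surjective (f.app U)) :
    Ses (kernel f) P Q :=
  ⟨kernelι f, f, fun U => ⟨Subtype.val_injective,
    LinearMap.exact_iff.2 (Submodule.range_subtype _).symm, hf U⟩⟩

/-! #### Coherence -/

theorem isCoherent_zero : (zero X G).IsCoherent := by
  refine ⟨isQuasicoherent_iff.2 fun U V h => ?_, fun U => inferInstanceAs
      (Module.Finite Γ(X, U.1) PUnit.{u + 1})⟩
  exact IsBC.of_lift_unique (fun Q _ _ g => ⟨0, fun m => by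
    rw [LinearMap.zero_apply, show m = 0 from rfl, map_zero]⟩)
    (eq_top_iff.2 fun x _ => by rw [show x = 0 from rfl]; exact zero_mem _)

theorem isCoherent_unit : (unit X G).IsCoherent :=
  ⟨isQuasicoherent_iff.2 fun _ _ _ => IsBC.id_unit _ fun _ => rfl,
    fun U => inferInstanceAs (Module.Finite Γ(X, U.1) Γ(X, U.1))⟩

theorem IsCoherent.tensor {P Q : OXGMod X G} (hP : P.IsCoherent) (hQ : Q.IsCoherent) :
    (P.tensor Q).IsCoherent :=
  ⟨isQuasicoherent_iff.2 fun _ _ h => (hP.isBC h).tensor (hQ.isBC h), fun U =>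
    have := hP.2 U
    have := hQ.2 U
    inferInstanceAs (Module.Finite Γ(X, U.1) (P.sec U ⊗[Γ(X, U.1)] Q.sec U))⟩

theorem IsCoherent.prod {P Q : OXGMod X G} (hP : P.IsCoherent) (hQ : Q.IsCoherent) :
    (P.prod Q).IsCoherent :=
  ⟨isQuasicoherent_iff.2 fun _ _ h => (hP.isBC h).prod (hQ.isBC h) _ fun _ => rfl, fun U =>
    have := hP.2 U
    have := hQ.2 U
    inferInstanceAs (Module.Finite Γ(X, U.1) (P.sec U × Q.sec U))⟩

theorem IsCoherent.sym {P : OXGMod X G} (hP : P.IsCoherent) (n : ℕ) : (P.sym n).IsCoherent :=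
  ⟨isQuasicoherent_iff.2 fun _ _ h => SymPow.isBC_map (hP.isBC h) n, fun U =>
    have := hP.2 U
    inferInstanceAs (Module.Finite Γ(X, U.1) (SymPow.part Γ(X, U.1) (P.sec U) n))⟩

theorem IsCoherent.of_ses_middle {A B C : OXGMod X G} (h : Ses A B C) (hA : A.IsCoherent)
    (hC : C.IsCoherent) : B.IsCoherent := by
  obtain ⟨f, g, hfg⟩ := h
  refine ⟨isQuasicoherent_iff.2 fun U V h => ?_, fun U => ?_⟩
  · exact IsBC.exact_middle (f.app_res h · |>.symm) (g.app_res h · |>.symm) (hA.isBC h) (hC.isBC h)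
      (hfg U).2.1 (hfg U).2.2 (hfg V).2.1 (hfg V).1
  · have := hA.2 U
    have := hC.2 U
    exact Module.Finite.of_exact (hfg U).2.1 (hfg U).2.2

theorem IsCoherent.of_ses_left [IsLocallyNoetherian X] {A B C : OXGMod X G} (h : Ses A B C)
    (hB : B.IsCoherent) (hC : C.IsCoherent) : A.IsCoherent := by
  obtain ⟨f, g, hfg⟩ := h
  refine ⟨isQuasicoherent_iff.2 fun U V h => ?_, fun U => ?_⟩
  · exact IsBC.exact_left (resHom_flat h) (f.app_res h · |>.symm) (g.app_res h · |>.symm)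
      (hB.isBC h)
      (hC.isBC h) (hfg U).2.1 (hfg U).1 (hfg V).2.1 (hfg V).1
  · have := hB.2 U
    exact Module.Finite.of_injective (f.app U) (hfg U).1

theorem IsCoherent.of_iso {P Q : OXGMod X G} (h : Iso Q P) (hP : P.IsCoherent) : Q.IsCoherent :=
  IsCoherent.of_ses_middle h.ses_zero_left isCoherent_zero hP

end OXGMod

theorem projective_restrictScalars (R A M : Type*) [CommRing R] [Ring A] [Algebra R A]
    [AddCommGroup M] [Module R M] [Module A M] [IsScalarTower R A M] [Module.Free R A]
    [h : Module.Projective A M] : Module.Projective R M := by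
  obtain ⟨s, hs⟩ := h.out
  exact .of_split (s.restrictScalars R) ((Finsupp.linearCombination A id).restrictScalars R)
    (LinearMap.ext hs)

namespace OXGMod

variable {X : Scheme.{u}} {G : Type v} [Group G]

/-! #### Vector bundles with an action of `G` -/

/-- `P` is coherent with projective modules of sections over the affine open subsets. -/
def IsVB (P : OXGMod X G) : Prop :=
  P.IsCoherent ∧ ∀ U : X.affineOpens, Module.Projective Γ(X, U.1) (P.sec U)

theorem isVB_zero : (zero X G).IsVB :=
  ⟨isCoherent_zero, fun U => inferInstanceAs (Module.Projective Γ(X, U.1) PUnit.{u + 1})⟩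

theorem isVB_unit : (unit X G).IsVB :=
  ⟨isCoherent_unit, fun U => inferInstanceAs (Module.Projective Γ(X, U.1) Γ(X, U.1))⟩

theorem IsVB.tensor {P Q : OXGMod X G} (hP : P.IsVB) (hQ : Q.IsVB) : (P.tensor Q).IsVB :=
  ⟨hP.1.tensor hQ.1, fun U =>
    have := hP.2 U
    have := hQ.2 U
    inferInstanceAs (Module.Projective Γ(X, U.1) (P.sec U ⊗[Γ(X, U.1)] Q.sec U))⟩

theorem IsVB.prod {P Q : OXGMod X G} (hP : P.IsVB) (hQ : Q.IsVB) : (P.prod Q).IsVB :=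
  ⟨hP.1.prod hQ.1, fun U =>
    have := hP.2 U
    have := hQ.2 U
    inferInstanceAs (Module.Projective Γ(X, U.1) (P.sec U × Q.sec U))⟩

theorem IsVB.sym {P : OXGMod X G} (hP : P.IsVB) (n : ℕ) : (P.sym n).IsVB :=
  ⟨hP.1.sym n, fun U =>
    have := hP.2 U
    inferInstanceAs (Module.Projective Γ(X, U.1) (SymPow.part Γ(X, U.1) (P.sec U) n))⟩

theorem IsVB.of_ses_middle {A B C : OXGMod X G} (h : Ses A B C) (hA : A.IsVB) (hC : C.IsVB) :
    B.IsVB := by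
  refine ⟨.of_ses_middle h hA.1 hC.1, fun U => ?_⟩
  obtain ⟨f, g, hfg⟩ := h
  obtain ⟨h1, h2, h3⟩ := hfg U
  have := hA.2 U
  have := hC.2 U
  obtain ⟨s, hs⟩ := (g.app U).exists_rightInverse_of_surjective (LinearMap.range_eq_top.2 h3)
  exact .of_equiv' (h2.splitSurjectiveEquiv h1 ⟨s, hs⟩).1.symm

theorem IsVB.of_ses_left [IsLocallyNoetherian X] {A B C : OXGMod X G} (h : Ses A B C)
    (hB : B.IsVB) (hC : C.IsVB) : A.IsVB := by
  refine ⟨.of_ses_left h hB.1 hC.1, fun U => ?_⟩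
  obtain ⟨f, g, hfg⟩ := h
  obtain ⟨h1, h2, h3⟩ := hfg U
  have := hB.2 U
  have := hC.2 U
  obtain ⟨s, hs⟩ := (g.app U).exists_rightInverse_of_surjective (LinearMap.range_eq_top.2 h3)
  let e := (h2.splitSurjectiveEquiv h1 ⟨s, hs⟩).1
  exact .of_split (e.symm.toLinearMap ∘ₗ LinearMap.inl _ _ _) (LinearMap.fst _ _ _ ∘ₗ e.toLinearMap)
    (LinearMap.ext fun x => by simp)

theorem IsVB.stalk_projective {P : OXGMod X G} (hP : P.IsVB) (U : X.affineOpens) (x : U.1) :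
    Module.Projective (X.presheaf.stalk x.1) (X.presheaf.stalk x.1 ⊗[Γ(X, U.1)] P.sec U) :=
  have := hP.2 U
  inferInstance

/-- This splitting is only linear over a single affine open: it need not be equivariant or
compatible with restriction. -/
theorem ses_splits {A B C : OXGMod X G} {f : Hom A B} {g : Hom B C} {U : X.affineOpens}
    (hfg : Function.Injective (f.app U) ∧ Function.Exact (f.app U) (g.app U) ∧
      Function.Surjective (g.app U)) (hC : Module.Projective Γ(X, U.1) (C.sec U)) :
    ∃ (r : B.sec U →ₗ[Γ(X, U.1)] A.sec U) (s : C.sec U →ₗ[Γ(X, U.1)] B.sec U),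
      (∀ a, r (f.app U a) = a) ∧ (∀ c, g.app U (s c) = c) ∧ (∀ a, g.app U (f.app U a) = 0) ∧
      ∀ b, f.app U (r b) + s (g.app U b) = b := by
  obtain ⟨h1, h2, h3⟩ := hfg
  obtain ⟨s, hs⟩ := (g.app U).exists_rightInverse_of_surjective (LinearMap.range_eq_top.2 h3)
  have hs : ∀ c, g.app U (s c) = c := LinearMap.congr_fun hs
  have hr : ∀ b, ∃ a, f.app U a = b - s (g.app U b) := fun b =>
    (h2 _).1 (by rw [map_sub, hs, sub_self])
  choose r hr using hr
  let r' : B.sec U →ₗ[Γ(X, U.1)] A.sec U :=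
    { toFun := r
      map_add' := fun a b => h1 (by simp only [map_add, hr]; abel)
      map_smul' := fun t a => h1 (by simp [map_smul, hr, smul_sub]) }
  have hr' : ∀ b, f.app U (r' b) = b - s (g.app U b) := hr
  have h0 : ∀ a, g.app U (f.app U a) = 0 := h2.apply_apply_eq_zero
  exact ⟨r', s, fun a => h1 (by rw [hr', h0, map_zero, sub_zero]), hs, h0,
    fun b => by rw [hr', sub_add_cancel]⟩

/-! #### Locally projective modules -/

section Trace

variable [Fintype G]

/-- The stalkwise condition becomes a condition on affine opens, which can be checked directly for
tensor products, symmetric powers, extensions and kernels. Stalkwise sections and traces are spread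
out by clearing denominators, and the resulting scalars generate the unit ideal. -/
theorem locallyProjective_iff [IsLocallyNoetherian X] {P : OXGMod X G} :
    P.LocallyProjective ↔ P.IsVB ∧ ∀ U, (P.rho U).HasTrace 1 := by
  constructor
  · rintro ⟨hP, h⟩
    have hfp (U : X.affineOpens) : Module.FinitePresentation Γ(X, U.1) (P.sec U) :=
      have := hP.2 U
      Module.finitePresentation_of_finite _ _
    refine ⟨⟨hP, fun U => ?_⟩, fun U => ?_⟩
    · have := hfp U
      have := hP.2 U
      obtain ⟨n, p, hp⟩ := Module.Finite.exists_fin' Γ(X, U.1) (P.sec U)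
      -- The functions `r` such that multiplication by `r` factors through the fixed free cover `p`;
      -- the sections are projective as soon as `1` is among them.
      let I : Ideal Γ(X, U.1) :=
        { carrier := {r | ∃ q : P.sec U →ₗ[Γ(X, U.1)] (Fin n → Γ(X, U.1)), ∀ v, p (q v) = r • v}
          add_mem' := by
            rintro a b ⟨q, hq⟩ ⟨q', hq'⟩
            exact ⟨q + q', fun v => by rw [LinearMap.add_apply, map_add, hq, hq', add_smul]⟩
          zero_mem' := ⟨0, fun v => by simp⟩
          smul_mem' := by
            rintro a b ⟨q, hq⟩
            exact ⟨a • q, fun v => by rw [LinearMap.smul_apply, map_smul, hq, smul_eq_mul, mul_smul]⟩ }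
      have hI : I = ⊤ := ideal_eq_top fun x => by
        have := U.2.isLocalization_stalk x
        have hpr := h U x
        -- The group ring is free over the stalk, so projectivity descends to the stalk.
        have : Module.Projective (X.presheaf.stalk x.1)
            (X.presheaf.stalk x.1 ⊗[Γ(X, U.1)] P.sec U) := by
          let _ : Module (MonoidAlgebra (X.presheaf.stalk x.1) G)
              (X.presheaf.stalk x.1 ⊗[Γ(X, U.1)] P.sec U) :=
            inferInstanceAs (Module _ (P.stalkRep U x).asModule)
          have : IsScalarTower (X.presheaf.stalk x.1) (MonoidAlgebra (X.presheaf.stalk x.1) G)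
              (X.presheaf.stalk x.1 ⊗[Γ(X, U.1)] P.sec U) :=
            inferInstanceAs (IsScalarTower _ _ (P.stalkRep U x).asModule)
          have : Module.Projective (MonoidAlgebra (X.presheaf.stalk x.1) G)
              (X.presheaf.stalk x.1 ⊗[Γ(X, U.1)] P.sec U) := hpr
          exact projective_restrictScalars (X.presheaf.stalk x.1) (MonoidAlgebra
              (X.presheaf.stalk x.1) G) _
        obtain ⟨r, hr, hq⟩ := Module.exists_smul_section_of_localization
          (U.2.primeIdealOf x).asIdeal.primeCompl (X.presheaf.stalk x.1) p hp
        exact ⟨r, hq, (mem_basicOpen_iff_notMem x r).2 hr⟩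
      obtain ⟨q, hq⟩ : (1 : Γ(X, U.1)) ∈ I := hI ▸ Submodule.mem_top
      exact .of_split q p (LinearMap.ext fun v => by simp [hq])
    · have := hfp U
      have hI : (P.rho U).traceIdeal = ⊤ := ideal_eq_top fun x => by
        have := U.2.isLocalization_stalk x
        have ht := Representation.hasTrace_one_of_projective (h U x)
        obtain ⟨r, hr, hq⟩ := Representation.HasTrace.exists_of_localization
          (ρ := P.rho U) (U.2.primeIdealOf x).asIdeal.primeCompl (X.presheaf.stalk x.1) ht
        exact ⟨r, hq, (mem_basicOpen_iff_notMem x r).2 hr⟩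
      exact (hI ▸ Submodule.mem_top : (1 : Γ(X, U.1)) ∈ (P.rho U).traceIdeal)
  · rintro ⟨hP, h⟩
    refine ⟨hP.1, fun U x => ?_⟩
    have := hP.stalk_projective U x
    refine Representation.projective_of_hasTrace_one ?_
    have := (h U).baseChange' (X.presheaf.stalk x.1)
    rwa [map_one] at this

variable [IsLocallyNoetherian X]

theorem LocallyProjective.isVB {P : OXGMod X G} (h : P.LocallyProjective) : P.IsVB :=
  (locallyProjective_iff.1 h).1

theorem LocallyProjective.hasTrace {P : OXGMod X G} (h : P.LocallyProjective) (U : X.affineOpens) :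
    (P.rho U).HasTrace 1 :=
  (locallyProjective_iff.1 h).2 U

theorem LocallyProjective.tensor_left {P Q : OXGMod X G} (hP : P.LocallyProjective) (hQ : Q.IsVB) :
    (P.tensor Q).LocallyProjective :=
  locallyProjective_iff.2 ⟨hP.isVB.tensor hQ, fun U => (hP.hasTrace U).tprod_left _⟩

theorem LocallyProjective.tensor {P Q : OXGMod X G} (hP : P.LocallyProjective)
    (hQ : Q.LocallyProjective) : (P.tensor Q).LocallyProjective :=
  hP.tensor_left hQ.isVB

omit [IsLocallyNoetherian X] in
theorem hasTrace_of_ses_middle {A B C : OXGMod X G} (h : Ses A B C) {U : X.affineOpens}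
    (hA : (A.rho U).HasTrace 1) (hC : (C.rho U).HasTrace 1)
    (hpC : Module.Projective Γ(X, U.1) (C.sec U)) : (B.rho U).HasTrace 1 := by
  obtain ⟨f, g, hfg⟩ := h
  obtain ⟨h1, h2, h3⟩ := hfg U
  obtain ⟨s, hs, hs'⟩ := Representation.exists_equivariant_section hC (g.app U) (g.app_rho U) h3
  exact hA.ext hC (f.app U) (g.app U) s hs h1 h2 (f.app_rho U) (g.app_rho U) hs'

omit [IsLocallyNoetherian X] in
theorem hasTrace_of_ses_left {A B C : OXGMod X G} (h : Ses A B C) {U : X.affineOpens}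
    (hB : (B.rho U).HasTrace 1) (hC : (C.rho U).HasTrace 1)
    (hpC : Module.Projective Γ(X, U.1) (C.sec U)) : (A.rho U).HasTrace 1 := by
  obtain ⟨f, g, hfg⟩ := h
  obtain ⟨h1, h2, h3⟩ := hfg U
  obtain ⟨s, hs, hs'⟩ := Representation.exists_equivariant_section hC (g.app U) (g.app_rho U) h3
  have hr : ∀ b, ∃ a, f.app U a = b - s (g.app U b) := fun b =>
    (h2 _).1 (by rw [map_sub, hs, sub_self])
  choose r hr using hr
  let r' : B.sec U →ₗ[Γ(X, U.1)] A.sec U :=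
    { toFun := r
      map_add' := fun a b => h1 (by simp only [map_add, hr]; abel)
      map_smul' := fun t a => h1 (by simp [map_smul, hr, smul_sub]) }
  have hr' : ∀ b, f.app U (r' b) = b - s (g.app U b) := hr
  exact hB.retract (f.app U) r' (fun a => h1 (by
      rw [hr', h2.apply_apply_eq_zero, map_zero, sub_zero])) (f.app_rho U) fun a b => h1 (by
      rw [f.app_rho, hr', hr', g.app_rho, hs', map_sub])

theorem LocallyProjective.of_ses_middle {A B C : OXGMod X G} (h : Ses A B C)
    (hA : A.LocallyProjective) (hC : C.LocallyProjective) : B.LocallyProjective :=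
  locallyProjective_iff.2 ⟨.of_ses_middle h hA.isVB hC.isVB, fun U =>
    hasTrace_of_ses_middle h (hA.hasTrace U) (hC.hasTrace U) (hC.isVB.2 U)⟩

theorem LocallyProjective.of_ses_left {A B C : OXGMod X G} (h : Ses A B C)
    (hB : B.LocallyProjective) (hC : C.LocallyProjective) : A.LocallyProjective :=
  locallyProjective_iff.2 ⟨.of_ses_left h hB.isVB hC.isVB, fun U =>
    hasTrace_of_ses_left h (hB.hasTrace U) (hC.hasTrace U) (hC.isVB.2 U)⟩

theorem locallyProjective_zero : (zero X G).LocallyProjective :=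
  locallyProjective_iff.2 ⟨isVB_zero, fun _ => ⟨0, fun _ => rfl⟩⟩

theorem LocallyProjective.prod {P Q : OXGMod X G} (hP : P.LocallyProjective)
    (hQ : Q.LocallyProjective) : (P.prod Q).LocallyProjective :=
  .of_ses_middle (ses_prod P Q) hP hQ

end Trace

/-! #### Tensor products -/

section Tensor

variable {P P' Q Q' R : OXGMod X G}

theorem _root_.TensorProduct.semilinear_eq {R S M N L : Type*} [CommRing R] [CommRing S]
    [AddCommGroup M] [AddCommGroup N] [AddCommGroup L] [Module R M] [Module R N] [Module S L]
    {φ : R →+* S} (f g : M ⊗[R] N →ₛₗ[φ] L) (h : ∀ a b, f (a ⊗ₜ b) = g (a ⊗ₜ b)) (m : M ⊗[R] N) :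
    f m = g m := by
  induction m using TensorProduct.induction_on with
  | zero => simp only [map_zero]
  | tmul a b => exact h a b
  | add a b ha hb => simp only [map_add, ha, hb]

theorem _root_.TensorProduct.semilinear_eq₃ {R S M N K L : Type*} [CommRing R] [CommRing S]
    [AddCommGroup M] [AddCommGroup N] [AddCommGroup K] [AddCommGroup L] [Module R M] [Module R N]
    [Module R K] [Module S L] {φ : R →+* S} (f g : (M ⊗[R] N) ⊗[R] K →ₛₗ[φ] L)
    (h : ∀ a b c, f ((a ⊗ₜ b) ⊗ₜ c) = g ((a ⊗ₜ b) ⊗ₜ c)) (m : (M ⊗[R] N) ⊗[R] K) :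
    f m = g m := by
  refine semilinear_eq f g (fun a c => ?_) m
  induction a using TensorProduct.induction_on with
  | zero => simp only [zero_tmul, map_zero]
  | tmul a b => exact h a b c
  | add a b ha hb => simp only [add_tmul, map_add, ha, hb]

/-- The tensor product of homomorphisms. -/
def Hom.tensorMap (f : Hom P P') (g : Hom Q Q') : Hom (P.tensor Q) (P'.tensor Q') where
  app U := TensorProduct.map (f.app U) (g.app U)
  app_res {U V} h m := semilinear_eq
    ((TensorProduct.map (f.app V) (g.app V)).comp (TensorProduct.map (P.res h) (Q.res h)))
    ((TensorProduct.map (P'.res h) (Q'.res h)).comp (TensorProduct.map (f.app U) (g.app U)))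
    (fun a b => congrArg₂ (· ⊗ₜ ·) (f.app_res h a) (g.app_res h b)) m
  app_rho U x m := semilinear_eq
    ((TensorProduct.map (f.app U) (g.app U)).comp (TensorProduct.map (P.rho U x) (Q.rho U x)))
    ((TensorProduct.map (P'.rho U x) (Q'.rho U x)).comp (TensorProduct.map (f.app U) (g.app U)))
    (fun a b => congrArg₂ (· ⊗ₜ ·) (f.app_rho U x a) (g.app_rho U x b)) m

theorem Iso.tensor (h : Iso P P') (h' : Iso Q Q') : Iso (P.tensor Q) (P'.tensor Q') := by
  obtain ⟨f, hf⟩ := h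
  obtain ⟨g, hg⟩ := h'
  exact ⟨f.tensorMap g, fun U => (TensorProduct.congr (LinearEquiv.ofBijective (f.app U) (hf U))
    (LinearEquiv.ofBijective (g.app U) (hg U))).bijective⟩

theorem tensor_comm (P Q : OXGMod X G) : Iso (P.tensor Q) (Q.tensor P) :=
  ⟨⟨fun U => (TensorProduct.comm Γ(X, U.1) (P.sec U) (Q.sec U)).toLinearMap,
    fun {U V} h m => semilinear_eq
      ((TensorProduct.comm Γ(X, V.1) (P.sec V) (Q.sec V)).toLinearMap.comp
        (TensorProduct.map (P.res h) (Q.res h)))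
      ((TensorProduct.map (Q.res h) (P.res h)).comp
        (TensorProduct.comm Γ(X, U.1) (P.sec U) (Q.sec U)).toLinearMap) (fun _ _ => rfl) m,
    fun U x m => semilinear_eq
      ((TensorProduct.comm Γ(X, U.1) (P.sec U) (Q.sec U)).toLinearMap.comp
        (TensorProduct.map (P.rho U x) (Q.rho U x)))
      ((TensorProduct.map (Q.rho U x) (P.rho U x)).comp
        (TensorProduct.comm Γ(X, U.1) (P.sec U) (Q.sec U)).toLinearMap) (fun _ _ => rfl) m⟩,
    fun _ => (TensorProduct.comm _ _ _).bijective⟩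

theorem tensor_assoc (P Q R : OXGMod X G) :
    Iso ((P.tensor Q).tensor R) (P.tensor (Q.tensor R)) :=
  ⟨⟨fun U => (TensorProduct.assoc Γ(X, U.1) (P.sec U) (Q.sec U) (R.sec U)).toLinearMap,
    fun {U V} h m => semilinear_eq₃
      ((TensorProduct.assoc Γ(X, V.1) (P.sec V) (Q.sec V) (R.sec V)).toLinearMap.comp
        (TensorProduct.map (TensorProduct.map (P.res h) (Q.res h)) (R.res h)))
      ((TensorProduct.map (P.res h) (TensorProduct.map (Q.res h) (R.res h))).comp
        (TensorProduct.assoc Γ(X, U.1) (P.sec U) (Q.sec U) (R.sec U)).toLinearMap)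
      (fun _ _ _ => rfl) m,
    fun U x m => semilinear_eq₃
      ((TensorProduct.assoc Γ(X, U.1) (P.sec U) (Q.sec U) (R.sec U)).toLinearMap.comp
        (TensorProduct.map (TensorProduct.map (P.rho U x) (Q.rho U x)) (R.rho U x)))
      ((TensorProduct.map (P.rho U x) (TensorProduct.map (Q.rho U x) (R.rho U x))).comp
        (TensorProduct.assoc Γ(X, U.1) (P.sec U) (Q.sec U) (R.sec U)).toLinearMap)
      (fun _ _ _ => rfl) m⟩,
    fun _ => (TensorProduct.assoc _ _ _ _).bijective⟩

theorem unit_tensor (P : OXGMod X G) : Iso ((unit X G).tensor P) P :=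
  ⟨⟨fun U => (TensorProduct.lid Γ(X, U.1) (P.sec U)).toLinearMap,
    fun {U V} h m => semilinear_eq
      ((TensorProduct.lid Γ(X, V.1) (P.sec V)).toLinearMap.comp
        (TensorProduct.map ((unit X G).res h) (P.res h)))
      ((P.res h).comp (TensorProduct.lid Γ(X, U.1) (P.sec U)).toLinearMap)
      (fun a b => ((P.res h).map_smulₛₗ a b).symm) m,
    fun U x m => semilinear_eq
      ((TensorProduct.lid Γ(X, U.1) (P.sec U)).toLinearMap.comp
        (TensorProduct.map ((unit X G).rho U x) (P.rho U x)))
      ((P.rho U x).comp (TensorProduct.lid Γ(X, U.1) (P.sec U)).toLinearMap)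
      (fun a b => ((P.rho U x).map_smul a b).symm) m⟩,
    fun _ => (TensorProduct.lid _ _).bijective⟩

theorem Ses.tensor_right {A B C : OXGMod X G} (h : Ses A B C) (hQ : Q.IsVB) :
    Ses (A.tensor Q) (B.tensor Q) (C.tensor Q) := by
  obtain ⟨f, g, hfg⟩ := h
  refine ⟨f.tensorMap (Hom.id Q), g.tensorMap (Hom.id Q), fun U => ?_⟩
  have := hQ.2 U
  exact ⟨Module.Flat.rTensor_preserves_injective_linearMap (M := Q.sec U) _ (hfg U).1,
    rTensor_exact (Q.sec U) (hfg U).2.1 (hfg U).2.2, LinearMap.rTensor_surjective _ (hfg U).2.2⟩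

theorem Ses.iso_left {A A' B C : OXGMod X G} (h : Ses A B C) (e : Iso A' A) : Ses A' B C := by
  obtain ⟨f, g, hfg⟩ := h
  obtain ⟨i, hi⟩ := e
  exact ⟨f.comp i, g, fun U => ⟨(hfg U).1.comp (hi U).1, fun y => by
    rw [(hfg U).2.1 y]
    constructor
    · rintro ⟨x, rfl⟩
      obtain ⟨x, rfl⟩ := (hi U).2 x
      exact ⟨x, rfl⟩
    · rintro ⟨x, rfl⟩
      exact ⟨i.app U x, rfl⟩, (hfg U).2.2⟩⟩

theorem Ses.iso_right {A B C C' : OXGMod X G} (h : Ses A B C) (e : Iso C C') : Ses A B C' := by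
  obtain ⟨f, g, hfg⟩ := h
  obtain ⟨i, hi⟩ := e
  exact ⟨f, i.comp g, fun U => ⟨(hfg U).1, fun y => by
    rw [← (hfg U).2.1 y]
    exact ⟨fun hy => (hi U).1 (hy.trans (map_zero _).symm), fun hy => (congrArg (i.app U) hy).trans
        (map_zero (i.app U))⟩,
    (hi U).2.comp (hfg U).2.2⟩⟩

theorem Ses.iso_middle {A B B' C : OXGMod X G} (h : Ses A B C) (e : Iso B B') : Ses A B' C := by
  obtain ⟨f, g, hfg⟩ := h
  obtain ⟨i, hi⟩ := e
  let e (U : X.affineOpens) := LinearEquiv.ofBijective (i.app U) (hi U)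
  have he (U : X.affineOpens) (m : B'.sec U) : i.app U ((e U).symm m) = m :=
    (e U).apply_symm_apply m
  have he' (U : X.affineOpens) (m : B.sec U) : (e U).symm (i.app U m) = m :=
    (e U).symm_apply_apply m
  refine ⟨i.comp f, ⟨fun U => g.app U ∘ₗ (e U).symm.toLinearMap, fun {U V} h m => ?_,
    fun U a m => ?_⟩, fun U => ⟨(hi U).1.comp (hfg U).1, fun y => ?_,
    (hfg U).2.2.comp (e U).symm.surjective⟩⟩
  · change g.app V ((e V).symm _) = C.res h (g.app U ((e U).symm m))
    rw [← g.app_res]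
    congr 1
    apply (hi V).1
    rw [he, i.app_res, he]
  · change g.app U ((e U).symm _) = C.rho U a (g.app U ((e U).symm m))
    rw [← g.app_rho]
    congr 1
    apply (hi U).1
    rw [he, i.app_rho, he]
  · change g.app U ((e U).symm y) = 0 ↔ _
    rw [(hfg U).2.1]
    constructor
    · rintro ⟨x, hx⟩
      exact ⟨x, (congrArg (i.app U) hx).trans (he U y)⟩
    · rintro ⟨x, rfl⟩
      exact ⟨x, (he' U _).symm⟩

theorem Ses.tensor_left {A B C : OXGMod X G} (h : Ses A B C) (hQ : Q.IsVB) :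
    Ses (Q.tensor A) (Q.tensor B) (Q.tensor C) :=
  (((h.tensor_right hQ).iso_left (tensor_comm Q A)).iso_middle (tensor_comm B Q)).iso_right
    (tensor_comm C Q)

end Tensor

end OXGMod

namespace SymPow

theorem algMap_mem_fil_of {R S A B A' B' : Type u} [CommRing R] [CommRing S] [AddCommGroup A]
    [AddCommGroup B] [AddCommGroup A'] [AddCommGroup B'] [Module R A] [Module R B] [Module S A']
    [Module S B'] {φ : R →+* S} {f : A →ₗ[R] B} {f' : A' →ₗ[S] B'} (α : A →ₛₗ[φ] A')
    (β : B →ₛₗ[φ] B') (h : ∀ a, β (f a) = f' (α a)) {a b : ℕ} {x : SymmetricAlgebra R B}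
    (hx : x ∈ fil f a b) : algMap φ β x ∈ fil f' a b := by
  induction hx using Submodule.mul_induction_on' with
  | mem_mul_mem m hm n hn =>
    obtain ⟨u, hu, rfl⟩ := hm
    rw [map_mul]
    have : algMap φ β (algMap (RingHom.id R) f u) = algMap (RingHom.id S) f' (algMap φ α u) := by
      rw [algMap_comp _ _ φ _ _ (β.comp f) (fun _ => rfl) fun _ => rfl,
        algMap_comp _ _ φ _ _ (β.comp f) (fun _ => rfl) h]
    exact this ▸ mul_mem_fil f' ⟨_, algMap_mem φ α a hu⟩ ⟨_, algMap_mem φ β b hn⟩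
  | add x hx y hy h1 h2 => rw [map_add]; exact add_mem h1 h2

end SymPow

namespace OXGMod

variable {X : Scheme.{u}} {G : Type v} [Group G]

/-! #### The filtration of the symmetric powers of an extension -/

/-- The symmetric algebra. -/
def symAlg (P : OXGMod X G) : OXGMod X G where
  sec U := SymmetricAlgebra Γ(X, U.1) (P.sec U)
  res h := SymPow.algLin (resHom h) (P.res h)
  res_self U := SymPow.algMap_self _ _ (resHom_self U) (P.res_self U)
  res_comp h h' m := (SymPow.algMap_comp _ _ _ _ _ _ (resHom_comp h h') (P.res_comp h h') m).symm
  rho U :=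
    { toFun := fun g => SymPow.algLin (RingHom.id _) (P.rho U g)
      map_one' := LinearMap.ext fun m =>
        SymPow.algMap_self _ _ (fun _ => rfl) (fun a => by rw [map_one]; rfl) m
      map_mul' := fun g g' => LinearMap.ext fun m =>
        (SymPow.algMap_comp _ _ _ _ _ _ (fun _ => rfl) (fun a => by rw [map_mul]; rfl) m).symm }
  rho_res {U V} h g m :=
    ((SymPow.algMap_comp (RingHom.id _) (resHom h) (resHom h) (P.rho U g) (P.res h)
        ((P.res h).comp (P.rho U g)) (fun _ => rfl) (fun _ => rfl) m).trans
      (SymPow.algMap_comp (resHom h) (RingHom.id _) (resHom h) (P.res h) (P.rho V g)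
        ((P.res h).comp (P.rho U g)) (fun _ => rfl) (fun a => P.rho_res h g a) m).symm)

variable {A B C : OXGMod X G}

/-- The submodule `Sym^a(A) · Sym^b(B)` of the symmetric algebra of `B`. -/
def filObj (f : Hom A B) (a b : ℕ) : OXGMod X G :=
  (symAlg B).sub (fun U => SymPow.fil (f.app U) a b)
    (fun {U V} h _ hm => SymPow.algMap_mem_fil_of (f := f.app U) (f' := f.app V) (A.res h) (B.res h)
      (fun a => (f.app_res h a).symm) hm)
    (fun U g _ hm => SymPow.algMap_mem_fil_of (f := f.app U) (f' := f.app U) (A.rho U g) (B.rho U g)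
      (fun a => (f.app_rho U g a).symm) hm)

theorem filObj_zero_left (f : Hom A B) (n : ℕ) : Iso (filObj f 0 n) (B.sym n) :=
  ⟨⟨fun U => (LinearEquiv.ofEq _ _ (SymPow.fil_zero (f.app U) n)).toLinearMap,
    fun _ _ => rfl, fun _ _ _ => rfl⟩, fun U =>
    (LinearEquiv.ofEq _ _ (SymPow.fil_zero (f.app U) n)).bijective⟩

theorem filObj_zero_right {f : Hom A B} {g : Hom B C} (hfg : ∀ U, Function.Injective (f.app U) ∧
    Function.Exact (f.app U) (g.app U) ∧ Function.Surjective (g.app U)) (hC : C.IsVB) (n : ℕ) :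
    Iso (A.sym n) (filObj f n 0) := by
  refine ⟨⟨fun U => ((SymPow.algLin (RingHom.id _) (f.app U)).comp
      (SymPow.part Γ(X, U.1) (A.sec U) n).subtype).codRestrict _ (SymPow.algMap_mem_fil
          (f.app U) n),
    fun {U V} h m => Subtype.ext ?_, fun U x m => Subtype.ext ?_⟩, fun U => ⟨?_, ?_⟩⟩
  · exact (SymPow.algMap_comp _ _ (resHom h) _ _ ((f.app V).comp (A.res h)) (fun _ => rfl)
      (fun _ => rfl) m.1).trans (SymPow.algMap_comp _ _ (resHom h) _ _ ((f.app V).comp (A.res h))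
      (fun _ => rfl) (f.app_res h) m.1).symm
  · exact (SymPow.algMap_comp _ _ (RingHom.id _) _ _ ((f.app U).comp (A.rho U x)) (fun _ => rfl)
      (fun _ => rfl) m.1).trans (SymPow.algMap_comp _ _ (RingHom.id _) _ _
        ((f.app U).comp (A.rho U x)) (fun _ => rfl) (f.app_rho U x) m.1).symm
  · obtain ⟨r, s, hr, -⟩ := ses_splits (hfg U) (hC.2 U)
    exact fun a b hab => Subtype.ext (SymPow.algMap_injective (f.app U) r hr
        (congrArg Subtype.val hab))
  · rintro ⟨x, hx⟩
    obtain ⟨u, hu⟩ := SymPow.exists_of_mem_fil_zero (f.app U) hx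
    exact ⟨u, Subtype.ext hu⟩

/-- The quotient map is given by `u v ↦ u ⊗ Sym(g)(v)`, a formula independent of any splitting, so
that the local constructions define a homomorphism of `O_XG`-modules. -/
theorem ses_filObj {f : Hom A B} {g : Hom B C} (hfg : ∀ U, Function.Injective (f.app U) ∧
    Function.Exact (f.app U) (g.app U) ∧ Function.Surjective (g.app U)) (hC : C.IsVB) (a b : ℕ) :
    Ses (filObj f (a + 1) b) (filObj f a (b + 1)) ((A.sym a).tensor (C.sym (b + 1))) := by
  have hq : ∀ U, ∃ q : SymPow.fil (f.app U) a (b + 1) →ₗ[Γ(X, U.1)]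
      SymPow.part Γ(X, U.1) (A.sec U) a ⊗[Γ(X, U.1)] SymPow.part Γ(X, U.1) (C.sec U) (b + 1),
      (∀ u v, q ⟨_, SymPow.mul_mem_fil (f.app U) u v⟩ =
        u ⊗ₜ SymPow.map (RingHom.id _) (g.app U) (b + 1) v) ∧ Function.Surjective q := fun U => by
    obtain ⟨r, s, hr, hs, h0, h1⟩ := ses_splits (hfg U) (hC.2 U)
    exact SymPow.exists_fil_quotient s r hr h0 hs a (b + 1)
  choose q hq hqs using hq
  have hker : ∀ U (y : SymPow.fil (f.app U) a (b + 1)),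
      q U y = 0 ↔ (y : SymmetricAlgebra Γ(X, U.1) (B.sec U)) ∈ SymPow.fil (f.app U) (a + 1) b := by
    intro U y
    obtain ⟨r, s, hr, hs, h0, h1⟩ := ses_splits (hfg U) (hC.2 U)
    exact SymPow.fil_exact s r h0 h1 (q U) (hq U) y
  let incl (U : X.affineOpens) : SymPow.fil (f.app U) (a + 1) b →ₗ[Γ(X, U.1)]
    SymPow.fil (f.app U) a (b + 1) := Submodule.inclusion (SymPow.fil_le (f.app U) a b)
  refine ⟨⟨incl, fun _ _ => rfl,
    fun _ _ _ => rfl⟩, ⟨q, fun {U V} h m => ?_, fun U x m => ?_⟩, fun U => ⟨?_, ?_, hqs U⟩⟩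
  · refine DFunLike.congr_fun (SymPow.fil_quotient_unique (f := f.app U) (a := a)
      (b := b + 1) (Q := ((A.sym a).tensor (C.sym (b + 1))).sec V)
      (q := (q V).toAddMonoidHom.comp ((filObj f a (b + 1)).res h).toAddMonoidHom)
      (q' := (((A.sym a).tensor (C.sym (b + 1))).res h).toAddMonoidHom.comp (q U).toAddMonoidHom)
      fun u v => ?_) m
    have h1 : (filObj f a (b + 1)).res h ⟨_, SymPow.mul_mem_fil (f.app U) u v⟩ =
        ⟨_, SymPow.mul_mem_fil (f.app V) ((A.sym a).res h u) ((B.sym (b + 1)).res h v)⟩ :=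
      Subtype.ext ((map_mul (SymPow.algMap (resHom h) (B.res h)) _ _).trans
        (congrArg (· * _) ((SymPow.algMap_comp _ _ (resHom h) _ _ ((f.app V).comp (A.res h))
          (fun _ => rfl) (fun a => f.app_res h a) u.1).trans
          (SymPow.algMap_comp _ _ (resHom h) _ _ ((f.app V).comp (A.res h))
            (fun _ => rfl) (fun _ => rfl) u.1).symm)))
    refine (congrArg (q V) h1).trans ((hq V _ _).trans ?_)
    refine .trans ?_ (congrArg _ (hq U u v)).symm
    refine congrArg (_ ⊗ₜ ·) (Subtype.ext ?_)
    exact (SymPow.algMap_comp _ _ (resHom h) _ _ ((g.app V).comp (B.res h)) (fun _ => rfl)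
      (fun _ => rfl) v.1).trans (SymPow.algMap_comp _ _ (resHom h) _ _ ((g.app V).comp (B.res h))
      (fun _ => rfl) (g.app_res h) v.1).symm
  · refine DFunLike.congr_fun (SymPow.fil_quotient_unique (f := f.app U) (a := a)
      (b := b + 1) (Q := ((A.sym a).tensor (C.sym (b + 1))).sec U)
      (q := (q U).toAddMonoidHom.comp ((filObj f a (b + 1)).rho U x).toAddMonoidHom)
      (q' := (((A.sym a).tensor (C.sym (b + 1))).rho U x).toAddMonoidHom.comp
        (q U).toAddMonoidHom) fun u v => ?_) m
    have h1 : (filObj f a (b + 1)).rho U x ⟨_, SymPow.mul_mem_fil (f.app U) u v⟩ =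
        ⟨_, SymPow.mul_mem_fil (f.app U) ((A.sym a).rho U x u) ((B.sym (b + 1)).rho U x v)⟩ :=
      Subtype.ext ((map_mul (SymPow.algMap (RingHom.id _) (B.rho U x)) _ _).trans
        (congrArg (· * _) ((SymPow.algMap_comp _ _ (RingHom.id _) _ _ ((f.app U).comp (A.rho U x))
          (fun _ => rfl) (fun a => f.app_rho U x a) u.1).trans
          (SymPow.algMap_comp _ _ (RingHom.id _) _ _ ((f.app U).comp (A.rho U x))
            (fun _ => rfl) (fun _ => rfl) u.1).symm)))
    refine (congrArg (q U) h1).trans ((hq U _ _).trans ?_)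
    refine .trans ?_ (congrArg _ (hq U u v)).symm
    refine congrArg (_ ⊗ₜ ·) (Subtype.ext ?_)
    exact (SymPow.algMap_comp _ _ (RingHom.id _) _ _ ((g.app U).comp (B.rho U x)) (fun _ => rfl)
      (fun _ => rfl) v.1).trans (SymPow.algMap_comp _ _ (RingHom.id _) _ _
        ((g.app U).comp (B.rho U x)) (fun _ => rfl) (g.app_rho U x) v.1).symm
  · exact Submodule.inclusion_injective (SymPow.fil_le (f.app U) a b)
  · intro y
    constructor
    · exact fun h => ⟨⟨y.1, (hker U y).1 h⟩, rfl⟩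
    · rintro ⟨x, rfl⟩
      exact (hker U _).2 x.2

theorem sym_zero (P : OXGMod X G) : Iso (unit X G) (P.sym 0) := by
  refine ⟨⟨fun U => (Algebra.linearMap Γ(X, U.1) (SymmetricAlgebra Γ(X, U.1) (P.sec U))).codRestrict
      _ (fun r => SymPow.algebraMap_mem_part r), fun h r => Subtype.ext ?_,
      fun U g r => Subtype.ext ?_⟩, fun U => ⟨fun r s h => ?_, ?_⟩⟩
  · exact (SymPow.algMap_algebraMap (resHom h) (P.res h) r).symm
  · exact (SymPow.algMap_algebraMap (RingHom.id _) (P.rho U g) r).symm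
  · exact (SymmetricAlgebra.algebraMap_leftInverse (R := Γ(X, U.1)) (P.sec U)).injective
      (congrArg Subtype.val h)
  · rintro ⟨x, hx⟩
    rw [SymPow.part, pow_zero, Submodule.mem_one] at hx
    obtain ⟨r, rfl⟩ := hx
    exact ⟨r, rfl⟩

/-! #### The categories `M_n` -/

/-- The category `M_n`, for all natural numbers `n`. -/
inductive MemSym (n : ℕ) : OXGMod X G → Prop
  | gen (l : List (ℕ × OXGMod X G)) (hl : ∀ p ∈ l, p.2.LocallyProjective)
      (hn : (l.map Prod.fst).sum = n) : MemSym n (symTensor l)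
  | ext {A B C : OXGMod X G} (h : Ses A B C) (hB : B.IsCoherent) (hA : MemSym n A)
      (hC : MemSym n C) : MemSym n B
  | ker {A B C : OXGMod X G} (h : Ses A B C) (hA : A.IsCoherent) (hB : MemSym n B)
      (hC : MemSym n C) : MemSym n A

/-- Degree zero is added so that the constant coefficients of power series live in the same family.
-/
theorem inM_iff {n : ℕ+} {P : OXGMod X G} : InM n P ↔ MemSym n P := by
  constructor
  · intro h
    induction h with
    | gen l hl hn => exact .gen l hl hn
    | ext h hB _ _ hA hC => exact .ext h hB hA hC
    | ker h hA _ _ hB hC => exact .ker h hA hB hC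
  · intro h
    induction h with
    | gen l hl hn => exact .gen l hl hn
    | ext h hB _ _ hA hC => exact .ext h hB hA hC
    | ker h hA _ _ hB hC => exact .ker h hA hB hC

theorem memSym_unit : MemSym 0 (unit X G) := .gen [] (by simp) rfl

theorem MemSym.zero {n : ℕ} {P : OXGMod X G} (h : MemSym n P) : MemSym n (zero X G) :=
  .ker (Iso.refl P).ses_zero_left isCoherent_zero h h

theorem MemSym.of_iso' {n : ℕ} {P Q : OXGMod X G} (e : Iso Q P) (h : MemSym n P)
    (hP : P.IsCoherent) : MemSym n Q :=
  .ext e.ses_zero_left (.of_iso e hP) h.zero h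

section

variable [Fintype G] [IsLocallyNoetherian X]

theorem isVB_symTensor (l : List (ℕ × OXGMod X G)) (hl : ∀ p ∈ l, p.2.LocallyProjective) :
    (symTensor l).IsVB := by
  induction l with
  | nil => exact isVB_unit
  | cons p l ih =>
    exact ((hl p (by simp)).isVB.sym p.1).tensor (ih fun q hq => hl q (by simp [hq]))

theorem MemSym.isVB {n : ℕ} {P : OXGMod X G} (h : MemSym n P) : P.IsVB := by
  induction h with
  | gen l hl _ => exact isVB_symTensor l hl
  | ext h hB _ _ hA hC => exact .of_ses_middle h hA hC
  | ker h hA _ _ hB hC => exact .of_ses_left h hB hC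

/-- The traces `i_j` of the separate factors add up on the tensor product. The empty product has
degree `0`, and `0` is always a trace. -/
theorem hasTrace_symTensor (l : List (ℕ × OXGMod X G)) (hl : ∀ p ∈ l, p.2.LocallyProjective)
    (U : X.affineOpens) : ((symTensor l).rho U).HasTrace
        (((l.map Prod.fst).sum : ℕ) : Γ(X, U.1)) := by
  induction l with
  | nil =>
    simp only [List.map_nil, List.sum_nil, Nat.cast_zero]
    exact Representation.hasTrace_zero _
  | cons p l ih =>
    have h1 := SymPow.hasTrace_rep ((hl p (by simp)).hasTrace U) p.1
    have h2 := ih fun q hq => hl q (by simp [hq])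
    rw [List.map_cons, List.sum_cons, Nat.cast_add]
    exact Representation.HasTrace.add (h1.tprod_left ((symTensor l).rho U))
      (h2.tprod_right ((p.2.sym p.1).rho U))

theorem MemSym.locallyProjective {n : ℕ} (hn : IsUnit ((Nat.gcd n (Nat.card G) : ℕ) : Γ(X, ⊤)))
    {P : OXGMod X G} (h : MemSym n P) : P.LocallyProjective := by
  induction h with
  | gen l hl hl' =>
    refine locallyProjective_iff.2 ⟨isVB_symTensor l hl, fun U => ?_⟩
    refine (hl' ▸ hasTrace_symTensor l hl U).gcd ?_
    rw [Nat.card_eq_fintype_card] at hn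
    have := hn.map (X.presheaf.map (CategoryTheory.homOfLE (le_top : U.1 ≤ ⊤)).op).hom
    rwa [map_natCast] at this
  | ext h hB _ _ hA hC => exact .of_ses_middle h hA hC
  | ker h hA _ _ hB hC => exact .of_ses_left h hB hC

theorem MemSym.of_iso {n : ℕ} {P Q : OXGMod X G} (e : Iso Q P) (h : MemSym n P) : MemSym n Q :=
  .of_iso' e h h.isVB.1

omit [Fintype G] [IsLocallyNoetherian X] in
theorem symTensor_append (l l' : List (ℕ × OXGMod X G)) :
    Iso ((symTensor l).tensor (symTensor l')) (symTensor (l ++ l')) := by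
  induction l with
  | nil => exact unit_tensor _
  | cons p l ih => exact (tensor_assoc _ _ _).trans ((Iso.refl _).tensor ih)

/-- Induction over both closures: tensoring with a fixed vector bundle preserves exact sequences,
and on generators it concatenates the lists. -/
theorem MemSym.tensor {a b : ℕ} {P Q : OXGMod X G} (hP : MemSym a P) (hQ : MemSym b Q) :
    MemSym (a + b) (P.tensor Q) := by
  induction hP with
  | gen l hl hn =>
    have hv := isVB_symTensor l hl
    induction hQ with
    | gen l' hl' hn' =>
      refine .of_iso (symTensor_append l l') (.gen _ (fun p hp => ?_) (by simp [hn, hn']))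
      rcases List.mem_append.1 hp with hp | hp
      exacts [hl p hp, hl' p hp]
    | ext h hB _ _ hA hC => exact .ext (h.tensor_left hv) (hv.1.tensor hB) hA hC
    | ker h hA _ _ hB hC => exact .ker (h.tensor_left hv) (hv.1.tensor hA) hB hC
  | ext h hB _ _ hA hC => exact .ext (h.tensor_right hQ.isVB) (hB.tensor hQ.isVB.1) hA hC
  | ker h hA _ _ hB hC => exact .ker (h.tensor_right hQ.isVB) (hA.tensor hQ.isVB.1) hB hC

theorem LocallyProjective.memSym_sym {P : OXGMod X G} (h : P.LocallyProjective) (n : ℕ) :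
    MemSym n (P.sym n) :=
  .of_iso (((tensor_comm _ _).trans (unit_tensor _)).symm)
    (.gen [(n, P)] (by simpa using h) (by simp))

/-- Starting from `Sym^n(B)`, each step of the filtration is the kernel of an epimorphism between
objects of `M_n`; closure under kernels is essential here. -/
theorem memSym_filObj {f : Hom A B} {g : Hom B C} (hfg : ∀ U, Function.Injective (f.app U) ∧
    Function.Exact (f.app U) (g.app U) ∧ Function.Surjective (g.app U)) (hA : A.LocallyProjective)
    (hB : B.LocallyProjective) (hC : C.LocallyProjective) {a b n : ℕ} (hn : a + b = n) :
    MemSym n (filObj f a b) := by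
  induction a generalizing b with
  | zero =>
    obtain rfl : b = n := by omega
    exact .of_iso (filObj_zero_left f b) (hB.memSym_sym b)
  | succ a ih =>
    have h1 := ih (b := b + 1) (by omega)
    have h2 : MemSym n ((A.sym a).tensor (C.sym (b + 1))) := by
      obtain rfl : a + (b + 1) = n := by omega
      exact (hA.memSym_sym a).tensor (hC.memSym_sym (b + 1))
    have h3 := ses_filObj hfg hC.isVB a b
    exact .ker h3 (.of_ses_left h3 h1.isVB.1 h2.isVB.1) h1 h2

end

end OXGMod

/-! ### Products on Grothendieck groups -/

namespace K0

variable {𝒞 : Type w} {ses : 𝒞 → 𝒞 → 𝒞 → Prop} {p q r : 𝒞 → Prop}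

theorem hom_ext {A : Type*} [AddCommGroup A] {f g : K0 ses p →+ A}
    (h : ∀ P hP, f (cls P hP) = g (cls P hP)) : f = g := by
  ext x
  induction x using K0.induction with
  | zero => simp
  | cls P hP => exact h P hP
  | neg x hx => simp [hx]
  | add x y hx hy => simp [hx, hy]

/-- Biadditive invariants define biadditive maps. -/
def lift₂ {A : Type*} [AddCommGroup A] (f : ∀ P Q, p P → q Q → A)
    (h1 : ∀ (P P' P'' Q : 𝒞) (hP : p P) (hP' : p P') (hP'' : p P'') (hQ : q Q), ses P P' P'' →
      f P' Q hP' hQ = f P Q hP hQ + f P'' Q hP'' hQ)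
    (h2 : ∀ (P Q Q' Q'' : 𝒞) (hP : p P) (hQ : q Q) (hQ' : q Q') (hQ'' : q Q''), ses Q Q' Q'' →
      f P Q' hP hQ' = f P Q hP hQ + f P Q'' hP hQ'') : K0 ses p →+ K0 ses q →+ A :=
  lift (fun P hP => lift
      (fun Q hQ => f P Q hP hQ) fun Q Q' Q'' hQ hQ' hQ'' => h2 P Q Q' Q'' hP hQ hQ' hQ'')
    fun P P' P'' hP hP' hP'' hs => hom_ext fun Q hQ => by
      rw [AddMonoidHom.add_apply, lift_cls, lift_cls, lift_cls]
      exact h1 P P' P'' Q hP hP' hP'' hQ hs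

theorem lift₂_cls {A : Type*} [AddCommGroup A] (f : ∀ P Q, p P → q Q → A) (h1 h2) (P Q : 𝒞)
    (hP : p P) (hQ : q Q) :
    (lift₂ f h1 h2 : K0 ses p →+ K0 ses q →+ A) (cls P hP) (cls Q hQ) = f P Q hP hQ := by
  rw [lift₂, lift_cls, lift_cls]

theorem map_cls (h : ∀ P, p P → q P) (P : 𝒞) (hP : p P) :
    (map h : K0 ses p →+ K0 ses q) (cls P hP) = cls P (h P hP) := lift_cls _ _ _ _

end K0

namespace OXGMod

variable {X : Scheme.{u}} {G : Type v} [Group G]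

theorem cls_iso {p : OXGMod X G → Prop} (hz : p (zero X G)) {P Q : OXGMod X G} (e : Iso P Q)
    (hP : p P) (hQ : p Q) : (K0.cls P hP : K0 Ses p) = K0.cls Q hQ := by
  have h0 : (K0.cls (zero X G) hz : K0 Ses p) = 0 := by
    have := K0.cls_ses hz hz hz (Iso.refl (zero X G)).ses_zero_left
    simpa using this
  rw [K0.cls_ses hz hP hQ e.ses_zero_left, h0, zero_add]

/-! #### The graded ring of the categories `M_n` -/

/-- Short exact sequences of modules labelled by the same degree. -/
def GSes (A B C : ℕ × OXGMod X G) : Prop := A.1 = B.1 ∧ C.1 = B.1 ∧ Ses A.2 B.2 C.2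

/-- The pairs `(n, P)` with `P` in `M_n`. -/
def GMem (A : ℕ × OXGMod X G) : Prop := MemSym A.1 A.2

variable (X G) in
/-- The direct sum of the Grothendieck groups of the categories `M_n`. -/
def SymRing : Type (max (u + 1) v) := K0 (GSes (X := X) (G := G)) GMem

namespace SymRing

instance : AddCommGroup (SymRing X G) := inferInstanceAs (AddCommGroup (K0 _ _))

/-- The class of an object of `M_n`. -/
def cls (n : ℕ) (P : OXGMod X G) (h : MemSym n P) : SymRing X G :=
  K0.cls (p := GMem) (n, P) h

theorem cls_ses {n : ℕ} {A B C : OXGMod X G} (hA : MemSym n A) (hB : MemSym n B) (hC : MemSym n C)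
    (h : Ses A B C) : cls n B hB = cls n A hA + cls n C hC :=
  K0.cls_ses (P := (n, A)) (Q := (n, B)) (R := (n, C)) hA hB hC ⟨rfl, rfl, h⟩

theorem cls_iso {n : ℕ} {P Q : OXGMod X G} (e : Iso P Q) (hP : MemSym n P) (hQ : MemSym n Q) :
    cls n P hP = cls n Q hQ := by
  have h0 : cls n _ hP.zero = 0 := by
    have := cls_ses hP.zero hP.zero hP.zero (Iso.refl (OXGMod.zero X G)).ses_zero_left
    simpa using this
  rw [cls_ses hP.zero hP hQ e.ses_zero_left, h0, zero_add]

theorem cls_congr {m n : ℕ} (h : m = n) {P Q : OXGMod X G} (e : Iso P Q) (hP : MemSym m P)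
    (hQ : MemSym n Q) : cls m P hP = cls n Q hQ := by
  subst h
  exact cls_iso e hP hQ

theorem induction {motive : SymRing X G → Prop} (zero : motive 0)
    (cls : ∀ n P h, motive (cls n P h)) (neg : ∀ x, motive x → motive (-x))
    (add : ∀ x y, motive x → motive y → motive (x + y)) (x : SymRing X G) : motive x :=
  K0.induction zero (fun P hP => cls P.1 P.2 hP) neg add x

theorem hom_ext {A : Type*} [AddCommGroup A] {f g : SymRing X G →+ A}
    (h : ∀ n P hP, f (cls n P hP) = g (cls n P hP)) : f = g :=
  K0.hom_ext fun P hP => h P.1 P.2 hP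

variable [Fintype G] [IsLocallyNoetherian X]

/-- The product on `SymRing`. -/
def mulHom : SymRing X G →+ SymRing X G →+ SymRing X G :=
  K0.lift₂ (fun P Q hP hQ => cls (P.1 + Q.1) (P.2.tensor Q.2) (MemSym.tensor hP hQ))
    (by
      rintro ⟨_, P⟩ ⟨n, P'⟩ ⟨_, P''⟩ ⟨m, Q⟩ hP hP' hP'' hQ ⟨rfl, rfl, hs⟩
      exact cls_ses _ _ _ (hs.tensor_right (MemSym.isVB hQ)))
    (by
      rintro ⟨m, Q⟩ ⟨_, P⟩ ⟨n, P'⟩ ⟨_, P''⟩ hQ hP hP' hP'' ⟨rfl, rfl, hs⟩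
      exact cls_ses _ _ _ (hs.tensor_left (MemSym.isVB hQ)))

instance : Mul (SymRing X G) := ⟨fun x y => mulHom x y⟩

instance : One (SymRing X G) := ⟨cls 0 (unit X G) memSym_unit⟩

omit [Fintype G] [IsLocallyNoetherian X] in
theorem one_def : (1 : SymRing X G) = cls 0 (unit X G) memSym_unit := rfl

theorem mul_def (x y : SymRing X G) : x * y = mulHom x y := rfl

theorem cls_mul_cls {a b : ℕ} {P Q : OXGMod X G} (hP : MemSym a P) (hQ : MemSym b Q) :
    cls a P hP * cls b Q hQ = cls (a + b) (P.tensor Q) (hP.tensor hQ) :=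
  K0.lift₂_cls _ _ _ _ _ _ _

theorem mul_comm' (x y : SymRing X G) : x * y = y * x := by
  have : (mulHom : SymRing X G →+ _) = mulHom.flip := hom_ext fun n P hP => hom_ext fun m Q hQ => by
    rw [AddMonoidHom.flip_apply, ← mul_def, ← mul_def, cls_mul_cls, cls_mul_cls]
    exact cls_congr (add_comm _ _) (tensor_comm _ _) _ _
  exact DFunLike.congr_fun (DFunLike.congr_fun this x) y

theorem mul_assoc' (x y z : SymRing X G) : x * y * z = x * (y * z) := by
  simp only [mul_def]
  induction x using induction with
  | zero => simp
  | neg x hx => simp [hx]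
  | add x y hx hy => simp [hx, hy]
  | cls n P hP =>
    induction y using induction with
    | zero => simp
    | neg x hx => simp [hx]
    | add x y hx hy => simp [hx, hy]
    | cls m Q hQ =>
      induction z using induction with
      | zero => simp
      | neg x hx => simp [hx]
      | add x y hx hy => simp [hx, hy]
      | cls k R hR =>
        simp only [← mul_def, cls_mul_cls]
        exact cls_congr (add_assoc _ _ _) (tensor_assoc _ _ _) _ _

theorem one_mul' (x : SymRing X G) : 1 * x = x := by
  rw [mul_def, one_def]
  induction x using induction with
  | zero => simp
  | neg x hx => simp [hx]
  | add x y hx hy => simp [hx, hy]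
  | cls n P hP =>
    rw [← mul_def, cls_mul_cls]
    exact cls_congr (zero_add _) (unit_tensor _) _ _

instance : CommRing (SymRing X G) :=
  { (inferInstance : AddCommGroup (SymRing X G)),
    (inferInstance : Mul (SymRing X G)), (inferInstance : One (SymRing X G)) with
    left_distrib := fun x y z => map_add (mulHom x) y z
    right_distrib := fun x y z => by
      change mulHom (x + y) z = mulHom x z + mulHom y z
      rw [map_add]; rfl
    zero_mul := fun x => by change mulHom 0 x = 0; rw [map_zero]; rfl
    mul_zero := fun x => map_zero (mulHom x)
    mul_assoc := mul_assoc'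
    one_mul := one_mul'
    mul_one := fun x => by rw [mul_comm', one_mul']
    mul_comm := mul_comm' }

end SymRing

/-! #### Symmetric powers -/

variable [Fintype G] [IsLocallyNoetherian X]

open PowerSeries

/-- The power series `∑ [Sym^n(P)] t^n`. -/
def symSeries (P : OXGMod X G) (h : P.LocallyProjective) : PowerSeries (SymRing X G) :=
  PowerSeries.mk fun n => SymRing.cls n (P.sym n) (h.memSym_sym n)

theorem coeff_symSeries (P : OXGMod X G) (h : P.LocallyProjective) (n : ℕ) :
    coeff n (symSeries P h) = SymRing.cls n (P.sym n) (h.memSym_sym n) :=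
  PowerSeries.coeff_mk _ _

theorem constantCoeff_symSeries (P : OXGMod X G) (h : P.LocallyProjective) :
    constantCoeff (symSeries P h) = 1 := by
  rw [← PowerSeries.coeff_zero_eq_constantCoeff_apply, coeff_symSeries, SymRing.one_def]
  exact SymRing.cls_iso (sym_zero P).symm _ _

theorem symSeries_ses {A B C : OXGMod X G} (hA : A.LocallyProjective) (hB : B.LocallyProjective)
    (hC : C.LocallyProjective) (h : Ses A B C) :
    symSeries B hB = symSeries A hA * symSeries C hC := by
  obtain ⟨f, g, hfg⟩ := h
  ext n
  rw [coeff_symSeries, PowerSeries.coeff_mul, Finset.Nat.sum_antidiagonal_eq_sum_range_succ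
    (fun a b => coeff a (symSeries A hA) * coeff b (symSeries C hC))]
  -- The first `m` graded pieces are split off, leaving the class of the `m`-th step of the
  -- filtration.
  have key : ∀ m (hm : m ≤ n), SymRing.cls n (B.sym n) (hB.memSym_sym n) =
      ∑ k ∈ Finset.range m, coeff k (symSeries A hA) * coeff (n - k) (symSeries C hC) +
      SymRing.cls n (filObj f m (n - m)) (memSym_filObj hfg hA hB hC (by omega)) := by
    intro m
    induction m with
    | zero =>
      intro _
      rw [Finset.sum_range_zero, zero_add]
      exact SymRing.cls_iso (filObj_zero_left f n).symm _ _
    | succ m ih =>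
      intro hm
      rw [ih (by omega), Finset.sum_range_succ, add_assoc, coeff_symSeries, coeff_symSeries,
        SymRing.cls_mul_cls]
      congr 1
      obtain ⟨b, rfl⟩ : ∃ b, n = m + (b + 1) := ⟨n - m - 1, by omega⟩
      have e1 : m + (b + 1) - m = b + 1 := by omega
      have e2 : m + (b + 1) - (m + 1) = b := by omega
      simp only [e1, e2]
      exact (SymRing.cls_ses _ _ _ (ses_filObj hfg hC.isVB m b)).trans (add_comm _ _)
  rw [key n le_rfl, Finset.sum_range_succ]
  congr 1
  simp only [Nat.sub_self]
  rw [PowerSeries.coeff_zero_eq_constantCoeff_apply, constantCoeff_symSeries, mul_one,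
    coeff_symSeries]
  exact SymRing.cls_iso (filObj_zero_right hfg hC.isVB n).symm _ _

theorem isUnit_symSeries (P : OXGMod X G) (h : P.LocallyProjective) : IsUnit (symSeries P h) := by
  rw [PowerSeries.isUnit_iff_constantCoeff, constantCoeff_symSeries]
  exact isUnit_one

variable (X G) in
/-- The homomorphism from `K_0(O_XG)` to power series given by the symmetric powers. -/
def symHom : K0Proj X G →+ Additive (PowerSeries (SymRing X G))ˣ :=
  K0.lift (fun P hP => Additive.ofMul (isUnit_symSeries P hP).unit)
    fun _ _ _ hP hQ hR h => Additive.toMul.injective (Units.ext (symSeries_ses hP hQ hR h))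

/-- `∑ σ^n(x) t^n`. -/
def sigma (x : K0Proj X G) : PowerSeries (SymRing X G) := ((symHom X G x).toMul : (_)ˣ)

theorem sigma_cls (P : OXGMod X G) (hP : P.LocallyProjective) :
    sigma (K0.cls P hP) = symSeries P hP := by
  rw [sigma, symHom, K0.lift_cls]
  rfl

theorem sigma_add (x y : K0Proj X G) : sigma (x + y) = sigma x * sigma y := by
  simp [sigma]

theorem sigma_zero : sigma (0 : K0Proj X G) = 1 := by
  simp [sigma]

theorem sigma_neg_mul (x : K0Proj X G) : sigma (-x) * sigma x = 1 := by
  rw [← sigma_add, neg_add_cancel, sigma_zero]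

theorem constantCoeff_sigma (x : K0Proj X G) : constantCoeff (sigma x) = 1 := by
  induction x using K0.induction with
  | zero => rw [sigma_zero, map_one]
  | cls P hP => rw [sigma_cls, constantCoeff_symSeries]
  | neg x hx =>
    have := congrArg constantCoeff (sigma_neg_mul x)
    rwa [map_mul, hx, mul_one, map_one] at this
  | add x y hx hy => rw [sigma_add, map_mul, hx, hy, mul_one]

/-! #### Components of the graded ring -/

/-- The inclusion of the component of degree `n`. -/
def SymRing.incl (n : ℕ) : K0 (Ses (X := X) (G := G)) (MemSym n) →+ SymRing X G :=
  K0.lift (fun P hP => SymRing.cls n P hP) fun _ _ _ _ _ _ h => SymRing.cls_ses _ _ _ h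

open Classical in
/-- The projection onto the component of degree `n`. -/
def SymRing.component (n : ℕ) : SymRing X G →+ K0 (Ses (X := X) (G := G)) (MemSym n) :=
  K0.lift (fun P hP => if h : P.1 = n then K0.cls P.2 (h ▸ hP) else 0) (by
    rintro ⟨m, P⟩ ⟨k, P'⟩ ⟨l, P''⟩ hP hP' hP'' ⟨h1, h2, hs⟩
    dsimp only at h1 h2
    subst h1 h2
    by_cases h : l = n
    · subst h
      simp only [↓reduceDIte]
      exact K0.cls_ses _ _ _ hs
    · simp [h])

theorem SymRing.component_cls (n : ℕ) (P : OXGMod X G) (hP : MemSym n P) :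
    SymRing.component n (SymRing.cls n P hP) = K0.cls P hP :=
  (K0.lift_cls _ _ (n, P) hP).trans (dif_pos rfl)

theorem SymRing.component_incl (n : ℕ) (x : K0 (Ses (X := X) (G := G)) (MemSym n)) :
    SymRing.component n (SymRing.incl n x) = x := by
  have : (SymRing.component n).comp (SymRing.incl n) =
      AddMonoidHom.id (K0 (Ses (X := X) (G := G)) (MemSym n)) := K0.hom_ext fun P hP => by
    rw [AddMonoidHom.comp_apply, SymRing.incl, K0.lift_cls, SymRing.component_cls]
    rfl
  exact DFunLike.congr_fun this x

theorem SymRing.mul_mem_range {a b n : ℕ} (h : a + b = n) {x y : SymRing X G}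
    (hx : x ∈ (SymRing.incl (X := X) (G := G) a).range)
    (hy : y ∈ (SymRing.incl (X := X) (G := G) b).range) :
    x * y ∈ (SymRing.incl (X := X) (G := G) n).range := by
  subst h
  obtain ⟨x, rfl⟩ := hx
  obtain ⟨y, rfl⟩ := hy
  induction x using K0.induction with
  | zero => rw [map_zero, zero_mul]; exact zero_mem _
  | neg x hx => rw [map_neg, neg_mul]; exact neg_mem hx
  | add x y hx hy => rw [map_add, add_mul]; exact add_mem hx hy
  | cls P hP =>
    induction y using K0.induction with
    | zero => rw [map_zero, mul_zero]; exact zero_mem _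
    | neg x hx => rw [map_neg, mul_neg]; exact neg_mem hx
    | add x y hx hy => rw [map_add, mul_add]; exact add_mem hx hy
    | cls Q hQ =>
      refine ⟨K0.cls (P.tensor Q) (hP.tensor hQ), ?_⟩
      simp only [SymRing.incl, K0.lift_cls]
      rw [SymRing.cls_mul_cls]

theorem SymRing.one_mem_range : (1 : SymRing X G) ∈ (SymRing.incl (X := X) (G := G) 0).range :=
  ⟨K0.cls _ memSym_unit, by rw [SymRing.incl, K0.lift_cls]; rfl⟩

/-- For `-x` the coefficients are found recursively from `σ(-x) σ(x) = 1`, and the recursion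
respects degrees. -/
theorem coeff_sigma_mem (x : K0Proj X G) (n : ℕ) :
    coeff n (sigma x) ∈ (SymRing.incl (X := X) (G := G) n).range := by
  induction x using K0.induction generalizing n with
  | zero =>
    rw [sigma_zero, PowerSeries.coeff_one]
    split_ifs with h
    · subst h; exact SymRing.one_mem_range
    · exact zero_mem _
  | cls P hP =>
    rw [sigma_cls, coeff_symSeries]
    exact ⟨K0.cls _ (hP.memSym_sym n), by rw [SymRing.incl, K0.lift_cls]⟩
  | add x y hx hy =>
    rw [sigma_add, PowerSeries.coeff_mul]
    exact sum_mem fun p hp => SymRing.mul_mem_range (Finset.HasAntidiagonal.mem_antidiagonal.1 hp)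
        (hx _) (hy _)
  | neg x hx =>
    induction n using Nat.strong_induction_on with
    | _ n ih =>
      have h1 := congrArg (coeff n) (sigma_neg_mul x)
      rw [PowerSeries.coeff_mul, Finset.Nat.sum_antidiagonal_eq_sum_range_succ
        (fun a b => coeff a (sigma (-x)) * coeff b (sigma x)), Finset.sum_range_succ, Nat.sub_self,
        PowerSeries.coeff_zero_eq_constantCoeff_apply, constantCoeff_sigma, mul_one] at h1
      rw [eq_sub_of_add_eq' h1]
      refine sub_mem ?_ (sum_mem fun k hk => SymRing.mul_mem_range
        (Nat.add_sub_of_le (Finset.mem_range.1 hk).le) (ih k (Finset.mem_range.1 hk)) (hx _))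
      rw [PowerSeries.coeff_one]
      split_ifs with h
      · subst h; exact SymRing.one_mem_range
      · exact zero_mem _

end OXGMod

namespace OXGMod

variable {X : Scheme.{u}} {G : Type v} [Group G] [Fintype G] [IsLocallyNoetherian X]

open PowerSeries

/-! #### Products and symmetric power operations on Grothendieck groups -/

variable (X G) in
/-- The product on `K_0(O_XG)`. -/
def projMul : K0Proj X G →+ K0Proj X G →+ K0Proj X G :=
  K0.lift₂ (fun P Q hP hQ => K0.cls (P.tensor Q) (hP.tensor hQ))
    (fun _ _ _ _ _ _ _ hQ h => K0.cls_ses _ _ _ (h.tensor_right hQ.isVB))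
    (fun _ _ _ _ hP _ _ _ h => K0.cls_ses _ _ _ (h.tensor_left hP.isVB))

theorem projMul_cls {P Q : OXGMod X G} (hP : P.LocallyProjective) (hQ : Q.LocallyProjective) :
    projMul X G (K0.cls P hP) (K0.cls Q hQ) = K0.cls (P.tensor Q) (hP.tensor hQ) :=
  K0.lift₂_cls _ _ _ _ _ _ _

theorem isTensorProductMap_projMul : IsTensorProductMap (projMul X G) :=
  fun _ _ hP hQ => ⟨hP.tensor hQ, projMul_cls hP hQ⟩

theorem InM.isVB {n : ℕ+} {P : OXGMod X G} (h : InM n P) : P.IsVB := (inM_iff.1 h).isVB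

theorem InM.tensor {a b : ℕ+} {P Q : OXGMod X G} (hP : InM a P) (hQ : InM b Q) :
    InM (a + b) (P.tensor Q) := by
  have := (inM_iff.1 hP).tensor (inM_iff.1 hQ)
  rwa [← PNat.add_coe, ← inM_iff] at this

/-- The products `K_0(M_a) × K_0(M_b) → K_0(M_{a+b})`. -/
def gradedMul (a b : ℕ+) : K0M X G a →+ K0M X G b →+ K0M X G (a + b) :=
  K0.lift₂ (fun P Q hP hQ => K0.cls (P.tensor Q) (InM.tensor hP hQ))
    (fun _ _ _ _ _ _ _ hQ h => K0.cls_ses _ _ _ (h.tensor_right hQ.isVB))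
    (fun _ _ _ _ hP _ _ _ h => K0.cls_ses _ _ _ (h.tensor_left hP.isVB))

theorem gradedMul_cls {a b : ℕ+} {P Q : OXGMod X G} (hP : InM a P) (hQ : InM b Q) :
    gradedMul a b (K0.cls P hP) (K0.cls Q hQ) = K0.cls (P.tensor Q) (hP.tensor hQ) :=
  K0.lift₂_cls _ _ _ _ _ _ _

theorem isTensorProductMap_gradedMul (a b : ℕ+) :
    IsTensorProductMap (gradedMul (X := X) (G := G) a b) :=
  fun _ _ hP hQ => ⟨hP.tensor hQ, gradedMul_cls hP hQ⟩

/-- The symmetric power operation with values in `K_0(M_n)`. -/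
def sigmaM (n : ℕ+) (x : K0Proj X G) : K0M X G n :=
  K0.map (fun _ => inM_iff.2) (SymRing.component (n : ℕ) (coeff (n : ℕ) (sigma x)))

/-- The inclusion of `K_0(M_n)` into the graded ring. -/
def inclM (n : ℕ+) : K0M X G n →+ SymRing X G :=
  (SymRing.incl (n : ℕ)).comp (K0.map fun _ => inM_iff.1)

theorem inclM_cls (n : ℕ+) (P : OXGMod X G) (hP : InM n P) :
    inclM n (K0.cls P hP) = SymRing.cls n P (inM_iff.1 hP) := by
  rw [inclM, AddMonoidHom.comp_apply, K0.map_cls, SymRing.incl, K0.lift_cls]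

/-- Since each `K_0(M_n)` is a direct summand of the graded ring, identities between the operations
can be verified there. -/
theorem inclM_injective (n : ℕ+) : Function.Injective (inclM (X := X) (G := G) n) := by
  refine Function.LeftInverse.injective
    (g := fun x => K0.map (fun _ => inM_iff.2) (SymRing.component (n : ℕ) x)) fun x => ?_
  have : ((K0.map (fun _ => inM_iff.2)).comp ((SymRing.component (n : ℕ)).comp (inclM n))) =
      AddMonoidHom.id (K0M X G n) := K0.hom_ext fun P hP => by
    simp only [AddMonoidHom.comp_apply, inclM_cls, SymRing.component_cls, K0.map_cls]
    rfl
  exact DFunLike.congr_fun this x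

theorem inclM_map (n : ℕ+) (x : K0 (Ses (X := X) (G := G)) (MemSym n)) :
    inclM n (K0.map (fun _ => inM_iff.2) x) = SymRing.incl n x := by
  have : (inclM n).comp (K0.map (fun _ => inM_iff.2)) =
      SymRing.incl (X := X) (G := G) n := K0.hom_ext fun P hP => by
    simp only [AddMonoidHom.comp_apply, inclM_cls, K0.map_cls, SymRing.incl, K0.lift_cls]
  exact DFunLike.congr_fun this x

theorem inclM_sigmaM (n : ℕ+) (x : K0Proj X G) : inclM n (sigmaM n x) = coeff (n : ℕ)
    (sigma x) := by
  obtain ⟨y, hy⟩ := coeff_sigma_mem x n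
  rw [sigmaM, inclM_map, ← hy, SymRing.component_incl]

theorem inclM_cast {m n : ℕ+} (h : m = n) (x : K0M X G m) : inclM n (K0M.cast h x) = inclM m x := by
  subst h
  have : (K0M.cast rfl) = AddMonoidHom.id (K0M X G m) := K0.hom_ext fun P hP => K0.map_cls _ _ _
  rw [this]
  rfl

theorem inclM_gradedMul {a b : ℕ+} (x : K0M X G a) (y : K0M X G b) :
    inclM (a + b) (gradedMul a b x y) = inclM a x * inclM b y := by
  induction x using K0.induction with
  | zero => simp
  | neg x hx => simp [hx]
  | add x y hx hy => simp [hx, hy, add_mul]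
  | cls P hP =>
    induction y using K0.induction with
    | zero => simp
    | neg x hx => simp [hx]
    | add x y hx hy => simp [hx, hy, mul_add]
    | cls Q hQ =>
      rw [gradedMul_cls, inclM_cls, inclM_cls, inclM_cls, SymRing.cls_mul_cls]
      exact SymRing.cls_congr (PNat.add_coe a b) (Iso.refl _) _ _

theorem isSymPowerHom_sigmaM : IsSymPowerHom (gradedMul (X := X) (G := G)) sigmaM := by
  refine ⟨fun n P hP => ⟨inM_iff.2 (hP.memSym_sym n), inclM_injective n ?_⟩, fun n x y =>
    inclM_injective n ?_⟩
  · rw [inclM_sigmaM, inclM_cls, sigma_cls, coeff_symSeries]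
  · simp only [map_add, map_sum, inclM_sigmaM, inclM_cast, inclM_gradedMul]
    -- The two extreme terms of the convolution are `σ^n(y)` and `σ^n(x)`, because the constant
    -- coefficients are `1`; the remaining indices `0 < k < n` match the positive integers below
    -- `n`.
    rw [Finset.sum_attach (Finset.Iio n)
      fun a => coeff (a : ℕ) (sigma x) * coeff ((n - a : ℕ+) : ℕ) (sigma y),
      sigma_add, PowerSeries.coeff_mul, Finset.Nat.sum_antidiagonal_eq_sum_range_succ
        (fun a b => coeff a (sigma x) * coeff b (sigma y)), Finset.sum_range_succ,
      ← Finset.sum_erase_add _ _ (Finset.mem_range.2 n.pos), Nat.sub_self, Nat.sub_zero]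
    simp only [PowerSeries.coeff_zero_eq_constantCoeff_apply, constantCoeff_sigma, mul_one, one_mul]
    have : ∑ k ∈ (Finset.range n).erase 0, coeff k (sigma x) * coeff ((n : ℕ) - k) (sigma y) =
        ∑ a ∈ Finset.Iio n, coeff (a : ℕ) (sigma x) * coeff ((n - a : ℕ+) : ℕ) (sigma y) := by
      refine (Finset.sum_bij (fun (a : ℕ+) _ => (a : ℕ)) (fun a ha => ?_)
        (fun a _ b _ h => PNat.coe_injective h) (fun k hk => ?_) (fun a ha => ?_)).symm
      · simpa using Finset.mem_Iio.1 ha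
      · obtain ⟨h1, h2⟩ := Finset.mem_erase.1 hk
        exact ⟨⟨k, Nat.pos_of_ne_zero h1⟩, Finset.mem_Iio.2 (PNat.coe_lt_coe _ _ |>.1
          (Finset.mem_range.1 h2)), rfl⟩
      · have := Finset.mem_Iio.1 ha
        rw [PNat.sub_coe, if_pos this]
    rw [this]
    ring

end OXGMod

/-! ### Freeness over the group ring -/

namespace Representation

variable {R : Type*} {G : Type*} [CommRing R] [Group G]
  {V W : Type*} [AddCommGroup V] [Module R V] [AddCommGroup W] [Module R W]
  {ρ : Representation R G V} {σ : Representation R G W}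

/-- An equivariant linear equivalence as an equivalence of modules over the group ring. -/
def asModuleCongr (e : V ≃ₗ[R] W) (he : ∀ g v, e (ρ g v) = σ g (e v)) :
    ρ.asModule ≃ₗ[MonoidAlgebra R G] σ.asModule :=
  LinearEquiv.ofBijective (Representation.IntertwiningMap.equivLinearMapAsModule ρ σ
    ⟨e.toLinearMap, fun g => LinearMap.ext (he g)⟩) e.bijective

theorem asModule_single_smul (g : G) (v : ρ.asModule) :
    MonoidAlgebra.single g (1 : R) • v = ρ.asModuleEquiv.symm (ρ g (ρ.asModuleEquiv v)) :=
  (Representation.single_smul (ρ := ρ) 1 g v).trans (one_smul _ _)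

/-- A representation with a basis permuted freely by the group is free over the group ring. -/
theorem free_of_basis {J : Type*} (b : Module.Basis (J × G) R V)
    (hb : ∀ j g, ρ g (b (j, 1)) = b (j, g)) : Module.Free (MonoidAlgebra R G) ρ.asModule := by
  let L : (J →₀ MonoidAlgebra R G) →ₗ[MonoidAlgebra R G] ρ.asModule :=
    Finsupp.linearCombination (MonoidAlgebra R G) fun j => (b (j, 1) : ρ.asModule)
  let b₁ : Module.Basis (J × G) R (J →₀ MonoidAlgebra R G) :=
    (Finsupp.basis fun _ => MonoidAlgebra.basis G R).reindex (_root_.Equiv.sigmaEquivProd J G)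
  have h1 : ∀ j g, L (b₁ (j, g)) = b (j, g) := by
    intro j g
    have : b₁ (j, g) = Finsupp.single j (MonoidAlgebra.single g 1) := by
      simp [b₁, Finsupp.coe_basis]
    rw [this]
    refine (Finsupp.linearCombination_single _ _ _).trans ?_
    exact (asModule_single_smul g (b (j, 1) : ρ.asModule)).trans (hb j g)
  let b' : Module.Basis (J × G) R ρ.asModule := b.map ρ.asModuleEquiv.symm
  let e := b₁.equiv b' (_root_.Equiv.refl (J × G))
  let L' : (J →₀ MonoidAlgebra R G) →ₗ[R] ρ.asModule := L.restrictScalars R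
  have h2 : L' = e.toLinearMap := b₁.ext fun ⟨j, g⟩ => by
    have h3 : e.toLinearMap (b₁ (j, g)) = ρ.asModuleEquiv.symm (b (j, g)) := by
      rw [LinearEquiv.coe_coe, Module.Basis.equiv_apply, Module.Basis.map_apply]
      rfl
    exact (h1 j g).trans h3.symm
  have h3 : Function.Bijective L' := by
    rw [h2]
    exact e.bijective
  exact Module.Free.of_equiv (LinearEquiv.ofBijective L h3)

end Representation

theorem _root_.TensorProduct.baseChange_eq {R S M L : Type*} [CommRing R] [CommRing S] [Algebra R S]
    [AddCommGroup M] [AddCommGroup L] [Module R M] [Module S L] (f g : S ⊗[R] M →ₗ[S] L)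
    (h : ∀ a b, f (a ⊗ₜ b) = g (a ⊗ₜ b)) (m : S ⊗[R] M) : f m = g m := by
  induction m using TensorProduct.induction_on with
  | zero => simp only [map_zero]
  | tmul a b => exact h a b
  | add a b ha hb => simp only [map_add, ha, hb]

theorem ModSes.nonempty_equiv {R : Type v} [Ring R] {A B C : ModuleCat.{u} R} (h : ModSes R A B C)
    [Module.Projective R C] : Nonempty (B ≃ₗ[R] A × C) := by
  obtain ⟨f, g, h1, h2, h3⟩ := h
  obtain ⟨s, hs⟩ := g.exists_rightInverse_of_surjective (LinearMap.range_eq_top.2 h3)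
  exact ⟨(h2.splitSurjectiveEquiv h1 ⟨s, hs⟩).1⟩

namespace OXGMod

variable {X : Scheme.{u}} {G : Type v} [Group G]

/-! #### Locally free modules -/

theorem locallyFree_zero : (zero X G).LocallyFree :=
  ⟨isCoherent_zero, fun U x => by
    have : Subsingleton ((zero X G).stalkRep U x).asModule :=
      inferInstanceAs (Subsingleton (_ ⊗[Γ(X, U.1)] PUnit.{u + 1}))
    infer_instance⟩

theorem LocallyFree.of_ses_middle {A B C : OXGMod X G} (h : Ses A B C)
    (hA : A.LocallyFree) (hC : C.LocallyFree) : B.LocallyFree := by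
  refine ⟨.of_ses_middle h hA.1 hC.1, fun U x => ?_⟩
  have h1 : Module.Free (MonoidAlgebra (X.presheaf.stalk x.1) G) (A.stalkMod U x) := hA.2 U x
  have h2 : Module.Free (MonoidAlgebra (X.presheaf.stalk x.1) G) (C.stalkMod U x) := hC.2 U x
  have h3 : Module.Projective (MonoidAlgebra (X.presheaf.stalk x.1) G) (C.stalkMod U x) := .of_free
  obtain ⟨e⟩ := (h.stalkMod U x).nonempty_equiv
  exact Module.Free.of_equiv e.symm

theorem LocallyFree.of_iso {P Q : OXGMod X G} (h : Iso Q P) (hP : P.LocallyFree) : Q.LocallyFree :=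
  .of_ses_middle h.ses_zero_left locallyFree_zero hP

theorem LocallyFree.prod {P Q : OXGMod X G} (hP : P.LocallyFree) (hQ : Q.LocallyFree) :
    (P.prod Q).LocallyFree :=
  .of_ses_middle (ses_prod P Q) hP hQ

/-- If `0 → T → I → S → 0` is exact with `I` locally free and `S` locally projective, then
`S ⊕ T` is locally free. -/
theorem LocallyFree.prod_of_ses {T I S : OXGMod X G} (h : Ses T I S) (hI : I.LocallyFree)
    (hS : S.LocallyProjective) (hT : T.LocallyProjective) : (S.prod T).LocallyFree := by
  refine ⟨hS.1.prod hT.1, fun U x => ?_⟩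
  have h1 : Module.Free (MonoidAlgebra (X.presheaf.stalk x.1) G) (I.stalkMod U x) := hI.2 U x
  have h2 : Module.Projective (MonoidAlgebra (X.presheaf.stalk x.1) G) (S.stalkMod U x) := hS.2 U x
  have h3 : Module.Projective (MonoidAlgebra (X.presheaf.stalk x.1) G) (T.stalkMod U x) := hT.2 U x
  obtain ⟨e⟩ := (h.stalkMod U x).nonempty_equiv
  obtain ⟨e'⟩ := ((ses_prod S T).stalkMod U x).nonempty_equiv
  exact Module.Free.of_equiv ((e.trans (LinearEquiv.prodComm _ _ _)).trans e'.symm)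

/-! ### Induced modules and locally free complements -/

section Induced

variable [Fintype G]

/-- The induced module `O_XG ⊗ P`, as a module of tuples indexed by the elements of `G`. -/
def ind (P : OXGMod X G) : OXGMod X G where
  sec U := Fin (Nat.card G) → P.sec U
  res h :=
    { toFun := fun m i => P.res h (m i)
      map_add' := fun _ _ => funext fun _ => map_add _ _ _
      map_smul' := fun _ _ => funext fun _ => map_smulₛₗ _ _ _ }
  res_self U m := funext fun i => P.res_self U (m i)
  res_comp h h' m := funext fun i => P.res_comp h h' (m i)
  rho U :=
    { toFun := fun g => LinearMap.funLeft _ _ fun i =>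
        Finite.equivFin G (g⁻¹ * (Finite.equivFin G).symm i)
      map_one' := LinearMap.ext fun m => funext fun i => by
        simp [LinearMap.funLeft_apply]
      map_mul' := fun a b => LinearMap.ext fun m => funext fun i => by
        simp [LinearMap.funLeft_apply, mul_assoc] }
  rho_res _ _ _ := rfl

theorem isCoherent_ind {P : OXGMod X G} (hP : P.IsCoherent) : P.ind.IsCoherent :=
  ⟨isQuasicoherent_iff.2 fun _ _ h => (hP.isBC h).pi _ fun _ _ => rfl, fun U =>
    have := hP.2 U
    inferInstanceAs (Module.Finite Γ(X, U.1) (Fin (Nat.card G) → P.sec U))⟩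

/-- The group permutes the coordinates and does not act on them. A basis of the stalk of `P` over
the local ring, placed in all coordinates, is therefore permuted freely, whatever the action on `P`.
-/
theorem locallyFree_ind {P : OXGMod X G} (hP : P.IsVB) : P.ind.LocallyFree := by
  refine ⟨isCoherent_ind hP.1, fun U x => ?_⟩
  have := hP.2 U
  have := hP.1.2 U
  have : Module.Free (X.presheaf.stalk x.1) (X.presheaf.stalk x.1 ⊗[Γ(X, U.1)] P.sec U) :=
    Module.free_of_flat_of_isLocalRing
  let b₀ := Module.Free.chooseBasis (X.presheaf.stalk x.1)
      (X.presheaf.stalk x.1 ⊗[Γ(X, U.1)] P.sec U)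
  let E := TensorProduct.piRight Γ(X, U.1) (X.presheaf.stalk x.1) (X.presheaf.stalk x.1)
    (fun _ : Fin (Nat.card G) => P.sec U)
  let b₁ := ((Pi.basis fun _ : Fin (Nat.card G) => b₀).map E.symm).reindex
    (((Equiv.sigmaEquivProd _ _).trans (Equiv.prodComm _ _)).trans
      (Equiv.prodCongr (Equiv.refl _) (Finite.equivFin G).symm))
  have hb₁ : ∀ j g, b₁ (j, g) = E.symm (Pi.single (Finite.equivFin G g) (b₀ j)) := fun j g => by
    simp only [b₁, Module.Basis.reindex_apply, Module.Basis.map_apply]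
    congr 1
    exact Pi.basis_apply _ _
  refine Representation.free_of_basis (ρ := P.ind.stalkRep U x) b₁ fun j g => ?_
  refine (congrArg (P.ind.stalkRep U x g) (hb₁ j 1)).trans (.trans ?_ (hb₁ j g).symm)
  let ρ : (X.presheaf.stalk x.1 ⊗[Γ(X, U.1)] (Fin (Nat.card G) → P.sec U)) →ₗ[X.presheaf.stalk x.1]
    (X.presheaf.stalk x.1 ⊗[Γ(X, U.1)] (Fin (Nat.card G) → P.sec U)) := P.ind.stalkRep U x g
  refine baseChange_eq
    (ρ ∘ₗ E.symm.toLinearMap ∘ₗ LinearMap.single _ (fun _ => _) (Finite.equivFin G 1))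
    (E.symm.toLinearMap ∘ₗ LinearMap.single _ (fun _ => _) (Finite.equivFin G g)) (fun s m => ?_)
        (b₀ j)
  · simp only [LinearMap.comp_apply, LinearMap.single_apply, LinearEquiv.coe_coe, E]
    rw [TensorProduct.piRight_symm_single, TensorProduct.piRight_symm_single]
    change s ⊗ₜ[Γ(X, U.1)] (P.ind.rho U g _) = _
    congr 1
    funext i
    change Pi.single (M := fun _ => P.sec U) (Finite.equivFin G 1) m
      (Finite.equivFin G (g⁻¹ * (Finite.equivFin G).symm i)) = _
    by_cases h : i = Finite.equivFin G g
    · subst h; simp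
    · rw [Pi.single_eq_of_ne h, Pi.single_eq_of_ne]
      intro h'
      apply h
      have := (Finite.equivFin G).injective h'
      rw [inv_mul_eq_one] at this
      rw [this, Equiv.apply_symm_apply]

/-- The canonical map from the induced module. -/
def indMap (P : OXGMod X G) : Hom P.ind P where
  app U := ∑ g : G, P.rho U g ∘ₗ LinearMap.proj (Finite.equivFin G g)
  app_res {U V} h m := by
    simp only [LinearMap.sum_apply, map_sum]
    exact Finset.sum_congr rfl fun g _ => (P.rho_res h g _).symm
  app_rho U x m := by
    simp only [LinearMap.sum_apply, map_sum]
    refine (Fintype.sum_equiv (Equiv.mulLeft x) _ _ fun a => ?_).symm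
    change P.rho U x (P.rho U a (m (Finite.equivFin G a))) = P.rho U (x * a)
      (m (Finite.equivFin G (x⁻¹ * (Finite.equivFin G).symm (Finite.equivFin G (x * a)))))
    simp

theorem indMap_apply (P : OXGMod X G) (U : X.affineOpens) (m : Fin (Nat.card G) → P.sec U) :
    P.indMap.app U m = ∑ g : G, P.rho U g (m (Finite.equivFin G g)) :=
  LinearMap.sum_apply _ _ _

theorem indMap_surjective (P : OXGMod X G) (U : X.affineOpens) :
    Function.Surjective (P.indMap.app U) := by
  intro m
  let f : Fin (Nat.card G) → P.sec U := Pi.single (Finite.equivFin G 1) m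
  refine ⟨f, (indMap_apply P U f).trans ?_⟩
  rw [Finset.sum_eq_single 1]
  · simp [f]
  · intro g _ hg
    have : f (Finite.equivFin G g) = 0 :=
      dif_neg fun h => hg ((Finite.equivFin G).injective h)
    rw [this, map_zero]
  · simp

variable [IsLocallyNoetherian X]

/-- Every locally projective module is a direct summand of a locally free module. -/
theorem LocallyProjective.exists_complement {P : OXGMod X G} (hP : P.LocallyProjective) :
    ∃ T : OXGMod X G, T.LocallyProjective ∧ (P.prod T).LocallyFree := by
  have h := ses_kernel P.indMap P.indMap_surjective
  have hI := locallyFree_ind hP.isVB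
  have hT := LocallyProjective.of_ses_left h hI.locallyProjective hP
  exact ⟨_, hT, .prod_of_ses h hI hP hT⟩

end Induced

/-! #### Locally isomorphic modules -/

/-- `A` and `B` are isomorphic near the point `w` of `U`. -/
def LocEquivAt (A B : OXGMod X G) (U : X.affineOpens) (w : U.1) : Prop :=
  ∃ (h : A.sec U →ₗ[Γ(X, U.1)] B.sec U)
    (k : B.sec U →ₗ[Γ(X, U.1)] A.sec U) (s : Γ(X, U.1)), w.1 ∈ X.basicOpen s ∧
    (∀ a, k (h a) = s • a) ∧ (∀ b, h (k b) = s • b) ∧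
    (∀ g a, h (A.rho U g a) = B.rho U g (h a)) ∧ ∀ g b, k (B.rho U g b) = A.rho U g (k b)

/-- `A` and `B` are locally isomorphic. -/
def LocEquiv (A B : OXGMod X G) : Prop :=
  ∀ (U : X.affineOpens) (w : U.1), LocEquivAt A B U w

theorem LocEquivAt.symm {A B : OXGMod X G} {U : X.affineOpens} {w : U.1}
    (h : LocEquivAt A B U w) : LocEquivAt B A U w := by
  obtain ⟨h, k, s, hs, h1, h2, h3, h4⟩ := h
  exact ⟨k, h, s, hs, h2, h1, h4, h3⟩

theorem LocEquiv.prod_right {A B : OXGMod X G} (h : LocEquiv A B) (N : OXGMod X G) :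
    LocEquiv (A.prod N) (B.prod N) := fun U w => by
  obtain ⟨h, k, s, hs, h1, h2, h3, h4⟩ := h U w
  exact ⟨h.prodMap LinearMap.id, k.prodMap (s • LinearMap.id), s, hs, fun a => Prod.ext (h1 _) rfl,
    fun a => Prod.ext (h2 _) rfl, fun g a => Prod.ext (h3 g _) rfl,
    fun g a => Prod.ext (h4 g _) ((N.rho U g).map_smul s _).symm⟩

theorem LocEquiv.tensor_right {A B : OXGMod X G} (h : LocEquiv A B) (N : OXGMod X G) :
    LocEquiv (A.tensor N) (B.tensor N) := fun U w => by
  obtain ⟨h, k, s, hs, h1, h2, h3, h4⟩ := h U w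
  let h' : A.sec U ⊗[Γ(X, U.1)] N.sec U →ₗ[Γ(X, U.1)] B.sec U ⊗[Γ(X, U.1)] N.sec U :=
    TensorProduct.map h LinearMap.id
  let k' : B.sec U ⊗[Γ(X, U.1)] N.sec U →ₗ[Γ(X, U.1)] A.sec U ⊗[Γ(X, U.1)] N.sec U :=
    TensorProduct.map k LinearMap.id
  refine ⟨h', k', s, hs, ?_, ?_, ?_, ?_⟩
  · exact semilinear_eq (k' ∘ₗ h')
      (s • LinearMap.id) fun a b => by simp [h', k', h1, smul_tmul']
  · exact semilinear_eq (h' ∘ₗ k')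
      (s • LinearMap.id) fun a b => by simp [h', k', h2, smul_tmul']
  · exact fun g => semilinear_eq (h'.comp
      (TensorProduct.map (A.rho U g) (N.rho U g)))
      ((TensorProduct.map (B.rho U g) (N.rho U g)).comp h')
      fun a b => by simp [h', h3]
  · exact fun g => semilinear_eq (k'.comp
      (TensorProduct.map (B.rho U g) (N.rho U g)))
      ((TensorProduct.map (A.rho U g) (N.rho U g)).comp k')
      fun a b => by simp [k', h4]

theorem LocEquiv.sym {A B : OXGMod X G} (h : LocEquiv A B) (n : ℕ) :
    LocEquiv (A.sym n) (B.sym n) := fun U w => by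
  obtain ⟨h, k, s, hs, h1, h2, h3, h4⟩ := h U w
  refine ⟨SymPow.map (RingHom.id _) h n, SymPow.map (RingHom.id _) k n, s ^ n, ?_, ?_, ?_, ?_, ?_⟩
  · induction n with
    | zero => rw [pow_zero]; exact mem_basicOpen_one w.2
    | succ n ih => rw [pow_succ]; exact mem_basicOpen_mul.2 ⟨ih, hs⟩
  · exact fun a => (SymPow.map_map _ _ _ _).trans (SymPow.map_smul_eq (f := k ∘ₗ h) h1 n a)
  · exact fun a => (SymPow.map_map _ _ _ _).trans (SymPow.map_smul_eq (f := h ∘ₗ k) h2 n a)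
  · exact fun g a => Subtype.ext ((SymPow.algMap_comp _ _ (RingHom.id _) _ _ (h ∘ₗ A.rho U g)
      (fun _ => rfl) (fun _ => rfl) a.1).trans (SymPow.algMap_comp _ _ (RingHom.id _) _ _
          (h ∘ₗ A.rho U g)
      (fun _ => rfl) (h3 g) a.1).symm)
  · exact fun g a => Subtype.ext ((SymPow.algMap_comp _ _ (RingHom.id _) _ _ (k ∘ₗ B.rho U g)
      (fun _ => rfl) (fun _ => rfl) a.1).trans (SymPow.algMap_comp _ _ (RingHom.id _) _ _
          (k ∘ₗ B.rho U g)
      (fun _ => rfl) (h4 g) a.1).symm)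

/-- The function `s` becomes a unit in the stalk, so both composites of `h` and `k` become
bijective. -/
theorem LocEquivAt.nonempty_stalk {A B : OXGMod X G} {U : X.affineOpens} {x : U.1}
    (h : LocEquivAt A B U x) :
    Nonempty ((A.stalkRep U x).asModule ≃ₗ[MonoidAlgebra (X.presheaf.stalk x.1) G]
      (B.stalkRep U x).asModule) := by
  obtain ⟨h, k, s, hs, h1, h2, h3, -⟩ := h
  have hu : IsUnit (algebraMap Γ(X, U.1) (X.presheaf.stalk x.1) s) :=
    (Scheme.mem_basicOpen X s x.1 x.2).1 hs
  have hs' : ∀ (M : Type u) [AddCommGroup M] [Module Γ(X, U.1) M] (f : M →ₗ[Γ(X, U.1)] M)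
      (hf : ∀ m, f m = s • m), Function.Bijective (f.baseChange (X.presheaf.stalk x.1)) := by
    intro M _ _ f hf
    have e : ∀ m, f.baseChange (X.presheaf.stalk x.1) m = hu.unit • m := fun m => by
      induction m using TensorProduct.induction_on with
      | zero => simp
      | add a b ha hb => rw [map_add, ha, hb, smul_add]
      | tmul a b =>
        rw [LinearMap.baseChange_tmul, hf, TensorProduct.tmul_smul, ← algebraMap_smul
            (X.presheaf.stalk x.1)]
        rfl
    rw [show ⇑(f.baseChange (X.presheaf.stalk x.1)) = fun m => hu.unit • m from funext e]
    exact MulAction.bijective _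
  have b1 := hs' _ (k ∘ₗ h) h1
  have b2 := hs' _ (h ∘ₗ k) h2
  rw [LinearMap.baseChange_comp] at b1 b2
  have hb : Function.Bijective (h.baseChange (X.presheaf.stalk x.1)) :=
    ⟨Function.Injective.of_comp b1.1, Function.Surjective.of_comp b2.2⟩
  refine ⟨Representation.asModuleCongr (LinearEquiv.ofBijective _ hb) fun g v => ?_⟩
  refine baseChange_eq (h.baseChange (X.presheaf.stalk x.1) ∘ₗ A.stalkRep U x g)
    (B.stalkRep U x g ∘ₗ h.baseChange (X.presheaf.stalk x.1)) (fun a b => ?_) v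
  exact congrArg (a ⊗ₜ ·) (h3 g b)

/-- The comparison module may depend on the point. -/
theorem LocallyFree.of_locEquivAt {A : OXGMod X G} (hA : A.IsCoherent)
    (h : ∀ (U : X.affineOpens) (x : U.1), ∃ B : OXGMod X G, B.LocallyFree ∧ LocEquivAt A B U x) :
    A.LocallyFree :=
  ⟨hA, fun U x => by
    obtain ⟨B, hB, e⟩ := h U x
    obtain ⟨e⟩ := e.nonempty_stalk
    have := hB.2 U x
    exact Module.Free.of_equiv e.symm⟩

theorem LocallyProjective.of_locEquivAt {A : OXGMod X G} (hA : A.IsCoherent)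
    (h : ∀ (U : X.affineOpens) (x : U.1), ∃ B : OXGMod X G, B.LocallyProjective ∧
      LocEquivAt A B U x) : A.LocallyProjective :=
  ⟨hA, fun U x => by
    obtain ⟨B, hB, e⟩ := h U x
    obtain ⟨e⟩ := e.nonempty_stalk
    have := hB.2 U x
    exact Module.Projective.of_equiv e.symm⟩

theorem LocEquiv.locallyFree {A B : OXGMod X G} (h : LocEquiv A B) (hA : A.IsCoherent)
    (hB : B.LocallyFree) : A.LocallyFree :=
  .of_locEquivAt hA fun U x => ⟨B, hB, h U x⟩

end OXGMod

theorem K0FreeMod.cls_congr {R : Type v} [Ring R] {M N : ModuleCat.{u} R} (e : M ≃ₗ[R] N)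
    (hM : Module.Finite R M ∧ Module.Free R M) (hN : Module.Finite R N ∧ Module.Free R N) :
    (K0.cls M hM : K0FreeMod.{u} R) = K0.cls N hN := by
  let Z : ModuleCat.{u} R := ModuleCat.of R PUnit.{u + 1}
  have hZ : Module.Finite R Z ∧ Module.Free R Z :=
    ⟨inferInstanceAs (Module.Finite R PUnit.{u + 1}), inferInstanceAs (Module.Free R PUnit.{u + 1})⟩
  have key : ∀ {M N : ModuleCat.{u} R} (_ : M ≃ₗ[R] N), ModSes R Z M N := fun {M N} e =>
    ⟨0, e.toLinearMap, fun _ _ _ => rfl, fun y => ⟨fun hy => ⟨0, by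
      rw [map_zero]; exact (e.injective (hy.trans (map_zero e).symm)).symm⟩, by
      rintro ⟨z, rfl⟩; simp⟩, e.surjective⟩
  have h0 : (K0.cls Z hZ : K0FreeMod.{u} R) = 0 := by
    simpa using K0.cls_ses (ses := ModSes.{u} R)
      (p := fun M => Module.Finite R M ∧ Module.Free R M) hZ hZ hZ (key (LinearEquiv.refl R Z))
  rw [K0.cls_ses (ses := ModSes.{u} R) (p := fun M => Module.Finite R M ∧ Module.Free R M)
    hZ hM hN (key e), h0, zero_add]

namespace OXGMod

variable {X : Scheme.{u}} {G : Type v} [Group G]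

/-! #### Direct sums -/

theorem Iso.prod {P P' Q Q' : OXGMod X G} (h : Iso P P') (h' : Iso Q Q') :
    Iso (P.prod Q) (P'.prod Q') := by
  obtain ⟨f, hf⟩ := h
  obtain ⟨g, hg⟩ := h'
  exact ⟨⟨fun U => (f.app U).prodMap (g.app U), fun h m => Prod.ext (f.app_res h _) (g.app_res h _),
    fun U a m => Prod.ext (f.app_rho U a _) (g.app_rho U a _)⟩,
    fun U => Function.Bijective.prodMap (hf U) (hg U)⟩

theorem prod_comm (P Q : OXGMod X G) : Iso (P.prod Q) (Q.prod P) :=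
  ⟨⟨fun _ => (LinearEquiv.prodComm _ _ _).toLinearMap, fun _ _ => rfl, fun _ _ _ => rfl⟩,
    fun U => (LinearEquiv.prodComm Γ(X, U.1) (P.sec U) (Q.sec U)).bijective⟩

theorem prod_assoc (P Q R : OXGMod X G) : Iso ((P.prod Q).prod R) (P.prod (Q.prod R)) :=
  ⟨⟨fun U => (LinearEquiv.prodAssoc Γ(X, U.1) (P.sec U) (Q.sec U) (R.sec U)).toLinearMap,
    fun _ _ => rfl, fun _ _ _ => rfl⟩,
    fun U => (LinearEquiv.prodAssoc Γ(X, U.1) (P.sec U) (Q.sec U) (R.sec U)).bijective⟩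

theorem zero_prod (P : OXGMod X G) : Iso ((zero X G).prod P) P :=
  ⟨⟨fun _ => LinearMap.snd _ _ _, fun _ _ => rfl, fun _ _ _ => rfl⟩,
    fun _ => ⟨fun _ _ h => Prod.ext rfl h, fun m => ⟨(0, m), rfl⟩⟩⟩

theorem prod_prod_prod_comm (P Q R S : OXGMod X G) :
    Iso ((P.prod Q).prod (R.prod S)) ((P.prod R).prod (Q.prod S)) :=
  ⟨⟨fun U => (LinearEquiv.prodProdProdComm Γ(X, U.1) (P.sec U) (Q.sec U) (R.sec U)
      (S.sec U)).toLinearMap, fun _ _ => rfl, fun _ _ _ => rfl⟩,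
    fun U => (LinearEquiv.prodProdProdComm Γ(X, U.1) (P.sec U) (Q.sec U) (R.sec U)
      (S.sec U)).bijective⟩

theorem Ses.prod {A B C A' B' C' : OXGMod X G} (h : Ses A B C) (h' : Ses A' B' C') :
    Ses (A.prod A') (B.prod B') (C.prod C') := by
  obtain ⟨f, g, hfg⟩ := h
  obtain ⟨f', g', hfg'⟩ := h'
  refine ⟨⟨fun U => (f.app U).prodMap (f'.app U), fun h m => Prod.ext (f.app_res h _)
      (f'.app_res h _),
    fun U a m => Prod.ext (f.app_rho U a _) (f'.app_rho U a _)⟩,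
    ⟨fun U => (g.app U).prodMap (g'.app U), fun h m => Prod.ext (g.app_res h _) (g'.app_res h _),
    fun U a m => Prod.ext (g.app_rho U a _) (g'.app_rho U a _)⟩, fun U =>
    ⟨Function.Injective.prodMap (hfg U).1 (hfg' U).1, fun y => ?_,
      Function.Surjective.prodMap (hfg U).2.2 (hfg' U).2.2⟩⟩
  refine Prod.ext_iff.trans ((and_congr ((hfg U).2.1 y.1) ((hfg' U).2.1 y.2)).trans ?_)
  constructor
  · rintro ⟨⟨a, ha⟩, ⟨b, hb⟩⟩
    exact ⟨(a, b), Prod.ext ha hb⟩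
  · rintro ⟨x, rfl⟩
    exact ⟨⟨x.1, rfl⟩, ⟨x.2, rfl⟩⟩

theorem cls_prod {p : OXGMod X G → Prop} {P Q : OXGMod X G} (hP : p P) (hQ : p Q)
    (h : p (P.prod Q)) : (K0.cls (P.prod Q) h : K0 Ses p) = K0.cls P hP + K0.cls Q hQ :=
  K0.cls_ses _ _ _ (ses_prod P Q)

theorem K0Free.exists_sub (x : K0Free X G) :
    ∃ (P Q : OXGMod X G) (hP : P.LocallyFree)
        (hQ : Q.LocallyFree), x = K0.cls P hP - K0.cls Q hQ := by
  induction x using K0.induction with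
  | zero => exact ⟨_, _, locallyFree_zero, locallyFree_zero, (sub_self _).symm⟩
  | cls P hP =>
    refine ⟨P.prod (zero X G), _, hP.prod locallyFree_zero, locallyFree_zero, ?_⟩
    rw [cls_prod hP locallyFree_zero, add_sub_cancel_right]
  | neg x hx =>
    obtain ⟨P, Q, hP, hQ, rfl⟩ := hx
    exact ⟨Q, P, hQ, hP, neg_sub _ _⟩
  | add x y hx hy =>
    obtain ⟨P, Q, hP, hQ, rfl⟩ := hx
    obtain ⟨P', Q', hP', hQ', rfl⟩ := hy
    refine ⟨P.prod P', Q.prod Q', hP.prod hP', hQ.prod hQ', ?_⟩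
    rw [cls_prod hP hP', cls_prod hQ hQ', add_sub_add_comm]

/-! #### Locally free modules are cofinal -/

/-- `S` and `S'` become locally free, with the same class, after adding a locally projective
module. -/
def StabEq (S S' : OXGMod X G) : Prop :=
  ∃ T : OXGMod X G, T.LocallyProjective ∧ ∃ (h : (S.prod T).LocallyFree)
    (h' : (S'.prod T).LocallyFree), (K0.cls _ h : K0Free X G) = K0.cls _ h'

variable [Fintype G] [IsLocallyNoetherian X]

theorem StabEq.of_iso {S S' : OXGMod X G} (hS' : S'.LocallyProjective) (e : Iso S S') :
    StabEq S S' := by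
  obtain ⟨T, hT, h⟩ := hS'.exists_complement
  exact ⟨T, hT, h.of_iso (e.prod (.refl T)), h, cls_iso locallyFree_zero (e.prod (.refl T)) _ _⟩

/-- Adding complements of the outer terms, in the form of a split sequence, turns the given sequence
into an exact sequence of locally free modules, where the relation of `K_0^lf` applies. -/
theorem StabEq.of_ses {A B C : OXGMod X G} (hA : A.LocallyProjective) (hC : C.LocallyProjective)
    (hs : Ses A B C) : StabEq B (A.prod C) := by
  obtain ⟨T, hT, h⟩ := hA.exists_complement
  obtain ⟨T', hT', h'⟩ := hC.exists_complement
  have hs' := hs.prod (ses_prod T T')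
  have h1 := LocallyFree.of_ses_middle hs' h h'
  have e := prod_prod_prod_comm A C T T'
  refine ⟨T.prod T', hT.prod hT', h1, (h.prod h').of_iso e, ?_⟩
  rw [cls_iso locallyFree_zero e _ (h.prod h'), cls_prod h h', K0.cls_ses h h1 h' hs']

theorem StabEq.trans {S S' S'' : OXGMod X G} (hS' : S'.LocallyProjective) (h1 : StabEq S S')
    (h2 : StabEq S' S'') : StabEq S S'' := by
  obtain ⟨T, hT, h, h', e⟩ := h1
  obtain ⟨T', hT', k, k', e'⟩ := h2
  have i1 : Iso (S.prod (T.prod (S'.prod T'))) ((S.prod T).prod (S'.prod T')) :=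
      (prod_assoc _ _ _).symm
  have i2 : Iso (S''.prod (T.prod (S'.prod T'))) ((S'.prod T).prod (S''.prod T')) :=
    ⟨⟨fun U => { toFun := fun m => ((m.2.2.1, m.2.1), (m.1, m.2.2.2))
                 map_add' := fun _ _ => rfl
                 map_smul' := fun _ _ => rfl }, fun _ _ => rfl, fun _ _ _ => rfl⟩, fun U =>
      Function.bijective_iff_has_inverse.2 ⟨fun m => (m.2.1, (m.1.2, (m.1.1, m.2.2))),
        fun _ => rfl, fun _ => rfl⟩⟩
  refine ⟨_, hT.prod (hS'.prod hT'), (h.prod k).of_iso i1, (h'.prod k').of_iso i2, ?_⟩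
  rw [cls_iso locallyFree_zero i1 _ (h.prod k), cls_iso locallyFree_zero i2 _ (h'.prod k'),
    cls_prod h k, cls_prod h' k', e, e']

theorem StabEq.prod {S S' R R' : OXGMod X G} (h1 : StabEq S S') (h2 : StabEq R R') :
    StabEq (S.prod R) (S'.prod R') := by
  obtain ⟨T, hT, h, h', e⟩ := h1
  obtain ⟨T', hT', k, k', e'⟩ := h2
  have i1 := prod_prod_prod_comm S R T T'
  have i2 := prod_prod_prod_comm S' R' T T'
  refine ⟨_, hT.prod hT', (h.prod k).of_iso i1, (h'.prod k').of_iso i2, ?_⟩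
  rw [cls_iso locallyFree_zero i1 _ (h.prod k), cls_iso locallyFree_zero i2 _ (h'.prod k'),
    cls_prod h k, cls_prod h' k', e, e']

/-- The common summand is absorbed into the auxiliary module. Cancellation makes the map from this
monoid to its group of differences injective. -/
theorem StabEq.cancel {S S' R : OXGMod X G} (hR : R.LocallyProjective)
    (h : StabEq (R.prod S) (R.prod S')) : StabEq S S' := by
  obtain ⟨T, hT, h, h', e⟩ := h
  have i (S : OXGMod X G) : Iso (S.prod (R.prod T)) ((R.prod S).prod T) :=
    (prod_assoc _ _ _).symm.trans ((prod_comm S R).prod (.refl T))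
  refine ⟨_, hR.prod hT, h.of_iso (i S), h'.of_iso (i S'), ?_⟩
  rw [cls_iso locallyFree_zero (i S) _ h, cls_iso locallyFree_zero (i S') _ h', e]

variable (X G) in
/-- Stable equality is an equivalence relation. -/
def stabSetoid : Setoid {P : OXGMod X G // P.LocallyProjective} where
  r S S' := StabEq S.1 S'.1
  iseqv := ⟨fun S => .of_iso S.2 (.refl _), fun ⟨T, hT, h, h', e⟩ => ⟨T, hT, h', h, e.symm⟩,
    fun {_ S' _} h1 h2 => h1.trans S'.2 h2⟩

variable (X G) in
/-- The monoid of locally projective modules modulo stable equality. -/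
def StabMonoid : Type (max (u + 1) v) := Quotient (stabSetoid X G)

namespace StabMonoid

/-- The class of a locally projective module. -/
def mk (P : OXGMod X G) (hP : P.LocallyProjective) : StabMonoid X G :=
  Quotient.mk (stabSetoid X G) ⟨P, hP⟩

theorem mk_eq_mk {P Q : OXGMod X G} {hP : P.LocallyProjective} {hQ : Q.LocallyProjective} :
    mk P hP = mk Q hQ ↔ StabEq P Q :=
  Quotient.eq (r := stabSetoid X G)

theorem ind {motive : StabMonoid X G → Prop} (h : ∀ P hP, motive (mk P hP)) (x) : motive x :=
  Quotient.ind (fun P => h P.1 P.2) x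

instance : Add (StabMonoid X G) :=
  ⟨Quotient.map₂ (fun P Q => ⟨P.1.prod Q.1, P.2.prod Q.2⟩) fun _ _ h _ _ h' => StabEq.prod h h'⟩

instance : Zero (StabMonoid X G) := ⟨mk (OXGMod.zero X G) locallyProjective_zero⟩

theorem mk_add_mk {P Q : OXGMod X G} (hP : P.LocallyProjective) (hQ : Q.LocallyProjective) :
    mk P hP + mk Q hQ = mk (P.prod Q) (hP.prod hQ) := rfl

theorem mk_eq_of_iso {P Q : OXGMod X G} (hP : P.LocallyProjective) (hQ : Q.LocallyProjective)
    (e : Iso P Q) : mk P hP = mk Q hQ := mk_eq_mk.2 (.of_iso hQ e)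

theorem add_comm' (x y : StabMonoid X G) : x + y = y + x := by
  induction x using ind with
  | h P hP =>
    induction y using ind with
    | h Q hQ => exact mk_eq_of_iso _ _ (prod_comm P Q)

theorem zero_add' (x : StabMonoid X G) : 0 + x = x := by
  induction x using ind with
  | h P hP => exact mk_eq_of_iso _ _ (zero_prod P)

instance : AddCommMonoid (StabMonoid X G) where
  add_comm := add_comm'
  zero_add := zero_add'
  add_zero x := by rw [add_comm', zero_add']
  add_assoc x y z := by
    induction x using ind with
    | h P hP =>
      induction y using ind with
      | h Q hQ =>
        induction z using ind with
        | h R hR => exact mk_eq_of_iso _ _ (prod_assoc P Q R)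
  nsmul := nsmulRec

instance : IsCancelAdd (StabMonoid X G) :=
  haveI : IsLeftCancelAdd (StabMonoid X G) := ⟨fun x y z => by
    induction x using ind with
    | h P hP =>
      induction y using ind with
      | h Q hQ =>
        induction z using ind with
        | h R hR => exact fun h => mk_eq_mk.2 (.cancel hP (mk_eq_mk.1 h))⟩
  AddCommMagma.IsLeftCancelAdd.toIsCancelAdd _

end StabMonoid

variable (X G) in
/-- The homomorphism from `K_0(O_XG)` to the group of differences of `StabMonoid`. -/
def toStab : K0Proj X G →+ Algebra.GrothendieckAddGroup (StabMonoid X G) :=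
  K0.lift (fun P hP => Algebra.GrothendieckAddGroup.of (StabMonoid.mk P hP))
    fun A B C hA _ hC hs => by
      rw [← map_add, StabMonoid.mk_add_mk]
      exact congrArg _ (StabMonoid.mk_eq_mk.2 (.of_ses hA hC hs))

/-- Stable equality is an additive invariant on `K_0(O_XG)`, so `[P] = [P']` gives a `T` for which
`P ⊕ T` and `P' ⊕ T` have the same locally free class. As `T` itself need not be locally free, it is
eliminated by writing `P ⊕ T ⊕ P'` in two ways. -/
theorem toProj_injective : Function.Injective (K0Free.toProj X G) := by
  rw [injective_iff_map_eq_zero]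
  intro x hx
  obtain ⟨P, P', hP, hP', rfl⟩ := K0Free.exists_sub x
  rw [K0Free.toProj, map_sub, K0.map_cls, K0.map_cls, sub_eq_zero] at hx
  have h := congrArg (toStab X G) hx
  rw [toStab, K0.lift_cls, K0.lift_cls] at h
  obtain ⟨T, -, h1, h2, e⟩ :=
    StabMonoid.mk_eq_mk.1 (Algebra.GrothendieckAddGroup.of_injective h)
  have i : Iso ((P.prod T).prod P') (P.prod (P'.prod T)) :=
    (prod_assoc _ _ _).trans ((Iso.refl P).prod (prod_comm _ _))
  have h3 := cls_iso locallyFree_zero i (h1.prod hP') (hP.prod h2)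
  rw [cls_prod h1 hP', cls_prod hP h2, e, add_comm, add_right_cancel_iff] at h3
  rw [h3, sub_self]

theorem toK0_injective [IrreducibleSpace X] : Function.Injective (Cl.toK0 X G) :=
  toProj_injective.comp Subtype.val_injective

/-- After adding a complement of `B`, both modules are locally free and isomorphic at the generic
point, while the difference of their classes is unchanged. -/
theorem LocEquiv.sub_mem_range [IrreducibleSpace X] {A B : OXGMod X G} (h : LocEquiv A B)
    (hA : A.LocallyProjective) (hB : B.LocallyProjective) :
    (K0.cls A hA - K0.cls B hB : K0Proj X G) ∈ (Cl.toK0 X G).range := by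
  obtain ⟨T, hT, hBT⟩ := hB.exists_complement
  have h' := h.prod_right T
  have hAT := h'.locallyFree (hA.1.prod hT.1) hBT
  refine ⟨⟨K0.cls _ hAT - K0.cls _ hBT, ?_⟩, ?_⟩
  · rw [AddMonoidHom.mem_ker, map_sub, sub_eq_zero, K0Free.toGeneric, K0Free.toStalk, K0.lift_cls,
      K0.lift_cls]
    obtain ⟨e⟩ := (h' (genericNhd X)
      ⟨genericPoint X, (exists_affine_genericPoint X).choose_spec⟩).nonempty_stalk
    exact K0FreeMod.cls_congr e _ _
  · change (K0Free.toProj X G) (K0.cls _ hAT - K0.cls _ hBT) = _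
    rw [K0Free.toProj, map_sub, K0.map_cls, K0.map_cls, cls_prod hA hT, cls_prod hB hT,
      add_sub_add_right_eq_sub]

end OXGMod

/-! ### Dedekind schemes -/

section Regular

open IsLocalRing

/-- A Noetherian local ring with principal maximal ideal and a non-maximal prime is a domain. -/
theorem isDomain_of_maximalIdeal_eq_span {R : Type*} [CommRing R] [IsLocalRing R]
    [IsNoetherianRing R] {x : R} (hx : maximalIdeal R = Ideal.span {x}) {p : Ideal R}
    (hp : p.IsPrime) (hpm : p ≠ maximalIdeal R) : IsDomain R := by
  have hle : p ≤ maximalIdeal R := le_maximalIdeal hp.ne_top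
  have hxp : x ∉ p := fun h =>
    hpm (le_antisymm hle (hx ▸ (Ideal.span_singleton_le_iff_mem _).2 h))
  have hbot : p = ⊥ := by
    -- An element `x z` of `p` has `z ∈ p`, since `x ∉ p`. Thus `p` lies in the product of the
    -- maximal ideal with `p`, and Nakayama's lemma applies.
    refine Submodule.eq_bot_of_le_smul_of_le_jacobson_bot (maximalIdeal R) p
      (IsNoetherian.noetherian p) (fun y hy => ?_) (maximalIdeal_le_jacobson ⊥)
    obtain ⟨z, rfl⟩ := Ideal.mem_span_singleton.1 (hx ▸ hle hy)
    exact Submodule.smul_mem_smul (hx ▸ Ideal.mem_span_singleton_self x)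
      ((hp.mem_or_mem hy).resolve_left hxp)
  have : (⊥ : Ideal R).IsPrime := hbot ▸ hp
  exact .of_bot_isPrime R

/-- The number of generators of the maximal ideal is the dimension: with none the ring is a field,
with one the maximal ideal is principal and a chain of primes supplies a non-maximal one. -/
theorem IsRegularLocalRing.isDomain_of_le_one {R : Type*} [CommRing R] [IsRegularLocalRing R]
    (h : ringKrullDim R ≤ 1) : IsDomain R ∧ (maximalIdeal R).IsPrincipal := by
  have hs := IsRegularLocalRing.spanFinrank_maximalIdeal (R := R)
  have hfg : (maximalIdeal R).FG := IsNoetherian.noetherian _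
  have h1 : (maximalIdeal R).spanFinrank ≤ 1 := by
    rw [← hs] at h
    exact_mod_cast h
  rcases Nat.le_one_iff_eq_zero_or_eq_one.1 h1 with h0 | h1
  · have hb := (Submodule.spanFinrank_eq_zero_iff_eq_bot hfg).1 h0
    have : (⊥ : Ideal R).IsPrime := hb ▸ inferInstance
    exact ⟨.of_bot_isPrime R, hb ▸ inferInstance⟩
  · obtain ⟨x, hx⟩ : ∃ x, maximalIdeal R = Ideal.span {x} := by
      have := Submodule.FG.generators_ncard hfg
      rw [h1, Set.ncard_eq_one] at this
      obtain ⟨x, hx⟩ := this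
      exact ⟨x, by rw [Ideal.span, ← hx, Submodule.span_generators]⟩
    rw [h1] at hs
    obtain ⟨l, hl⟩ := Order.le_krullDim_iff.1 hs.le
    refine ⟨?_, ⟨x, hx⟩⟩
    have hlt : l.head < l.last := by
      have := l.strictMono (show (0 : Fin (l.length + 1)) < Fin.last _ by
        rw [Fin.lt_def, Fin.val_last, hl]; exact one_pos)
      exact this
    refine isDomain_of_maximalIdeal_eq_span hx l.head.isPrime fun e => hlt.not_ge ?_
    change l.last.asIdeal ≤ l.head.asIdeal
    rw [e]
    exact le_maximalIdeal l.last.isPrime.ne_top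

end Regular

section Dedekind

variable {X : Scheme.{u}} [IsDedekindScheme X]

theorem ringKrullDim_stalk_le_one (x : X) : ringKrullDim (X.presheaf.stalk x) ≤ 1 := by
  rw [← PrimeSpectrum.topologicalKrullDim_eq_ringKrullDim]
  exact ((X.fromSpecStalk x).isEmbedding.isInducing.topologicalKrullDim_le).trans
    IsDedekindScheme.dim_le_one

theorem isDomain_stalk (x : X) : IsDomain (X.presheaf.stalk x) :=
  have := IsDedekindScheme.regular x
  (IsRegularLocalRing.isDomain_of_le_one (ringKrullDim_stalk_le_one x)).1

instance IsDedekindScheme.isIntegral : IsIntegral X :=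
  have (x : X) : _root_.IsReduced (X.presheaf.stalk x) :=
    have := isDomain_stalk x
    inferInstance
  have := isReduced_of_isReduced_stalk X
  isIntegral_of_irreducibleSpace_of_isReduced X

/-- The localization at a nonzero prime is a stalk, hence a regular local ring of dimension at most
one. It is not a field, so it is a discrete valuation ring. -/
theorem IsDedekindScheme.isDedekindDomain (U : X.affineOpens) [Nonempty U.1] :
    IsDedekindDomain Γ(X, U.1) := by
  have : IsDedekindDomainDvr Γ(X, U.1) :=
    { is_dvr_at_nonzero_prime := fun P hP hP' => by
        obtain ⟨x, hx⟩ := exists_point (U := U) ⟨P, hP'⟩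
        have := U.2.isLocalization_stalk x
        rw [hx] at this
        let e : X.presheaf.stalk x.1 ≃+* Localization.AtPrime P :=
          (IsLocalization.algEquiv P.primeCompl (X.presheaf.stalk x.1)
              (Localization.AtPrime P)).toRingEquiv
        have := IsDedekindScheme.regular x.1
        have := IsRegularLocalRing.of_ringEquiv e
        have h1 : ringKrullDim (Localization.AtPrime P) ≤ 1 := by
          rw [← ringKrullDim_eq_of_ringEquiv e]
          exact ringKrullDim_stalk_le_one x.1
        obtain ⟨h2, h3⟩ := IsRegularLocalRing.isDomain_of_le_one h1
        have : IsPrincipalIdealRing (Localization.AtPrime P) :=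
            ((tfae_of_isNoetherianRing_of_isLocalRing_of_isDomain
          (Localization.AtPrime P)).out 4 0).1 h3
        exact { principal := this.principal
                not_a_field' := IsLocalRing.isField_iff_maximalIdeal_eq.not.1
                  (IsLocalization.AtPrime.not_isField _ hP _) } }
  infer_instance

end Dedekind

/-! ### Vector bundles on integral schemes -/

section Integral

variable {X : Scheme.{u}}

theorem nonempty_of_mem {U : X.Opens} {x : X} (hx : x ∈ U) : Nonempty U := ⟨⟨x, hx⟩⟩

theorem ne_zero_of_mem_basicOpen {U : X.Opens} {s : Γ(X, U)} {x : X} (hx : x ∈ X.basicOpen s) :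
    s ≠ 0 := by
  rintro rfl
  rw [Scheme.basicOpen_zero] at hx
  exact hx

/-- Affine open neighbourhoods of the form `D(t)` inside the intersection of an affine open and an
open subset. -/
theorem exists_affine_basicOpen (U : X.affineOpens) (V : X.Opens) {x : X} (hU : x ∈ U.1)
    (hV : x ∈ V) : ∃ (W : X.affineOpens) (t : Γ(X, U.1)), W.1 = X.basicOpen t ∧ x ∈ W.1 ∧ W ≤ U ∧
      W.1 ≤ V := by
  obtain ⟨t, h1, h2⟩ := U.2.exists_basicOpen_le ⟨x, hV⟩ hU
  exact ⟨⟨X.basicOpen t, U.2.basicOpen t⟩, t, rfl, h2, X.basicOpen_le t, h1⟩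

theorem OXGMod.IsVB.eq_zero_of_dual {G : Type v} [Group G] {P : OXGMod X G} (hP : P.IsVB)
    {U : X.affineOpens} {m : P.sec U}
    (h : ∀ φ : Module.Dual Γ(X, U.1) (P.sec U), φ m = 0) : m = 0 :=
  have := hP.2 U
  (Module.forall_dual_apply_eq_zero_iff _ m).1 h

variable [IsIntegral X]

theorem genericPoint_mem {U : X.Opens} {x : X} (hx : x ∈ U) : genericPoint X ∈ U :=
  ((genericPoint_spec X).mem_open_set_iff U.isOpen).2 ⟨x, trivial, hx⟩

theorem genericPoint_mem_basicOpen {U : X.affineOpens} {s : Γ(X, U.1)} (hs : s ≠ 0) :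
    genericPoint X ∈ X.basicOpen s := by
  by_contra h
  refine hs ((basicOpen_eq_bot_iff s).1 (le_bot_iff.1 fun x hx => h (genericPoint_mem hx)))

theorem resHom_injective {U V : X.affineOpens} (h : V ≤ U) [Nonempty V.1] :
    Function.Injective (resHom h) :=
  map_injective_of_isIntegral X (CategoryTheory.homOfLE (show V.1 ≤ U.1 from h))

namespace OXGMod

variable {G : Type v} [Group G] {P : OXGMod X G}

/-- Linear functionals separate the elements of a projective module, which reduces torsion-freeness
to the domain of functions. -/
theorem IsVB.smul_eq_zero (hP : P.IsVB) {U : X.affineOpens} {r : Γ(X, U.1)} (hr : r ≠ 0)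
    {m : P.sec U} (h : r • m = 0) : m = 0 := by
  refine hP.eq_zero_of_dual fun φ => ?_
  have : Nonempty U.1 := nonempty_of_mem (X.basicOpen_le r (genericPoint_mem_basicOpen hr))
  have h := congrArg φ h
  rw [map_smul, map_zero, smul_eq_mul] at h
  exact (mul_eq_zero.1 h).resolve_left hr

theorem IsVB.smul_cancel (hP : P.IsVB) {U : X.affineOpens} {r : Γ(X, U.1)} (hr : r ≠ 0)
    {m n : P.sec U} (h : r • m = r • n) : m = n :=
  sub_eq_zero.1 (hP.smul_eq_zero hr (by rw [smul_sub, h, sub_self]))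

theorem IsVB.res_injective (hP : P.IsVB) {U V : X.affineOpens} (h : V ≤ U) [Nonempty V.1] :
    Function.Injective (P.res h) := by
  rw [injective_iff_map_eq_zero]
  intro m hm
  refine hP.eq_zero_of_dual fun φ => resHom_injective h ?_
  let φ' : P.sec U →ₛₗ[resHom h] Γ(X, V.1) :=
    ((unit X G).res h).comp φ
  have := (hP.1.isBC h).lift_apply φ' m
  rw [hm, map_zero] at this
  rw [map_zero]
  exact this.symm

theorem IsVB.eq_zero_of_tmul (hP : P.IsVB) {U : X.affineOpens} (x : U.1) {m : P.sec U}
    (hm : (1 : X.presheaf.stalk x.1) ⊗ₜ[Γ(X, U.1)] m = 0) : m = 0 := by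
  refine hP.eq_zero_of_dual fun φ => ?_
  have := congrArg (LinearMap.baseChange (X.presheaf.stalk x.1) φ) hm
  rw [LinearMap.baseChange_tmul, map_zero] at this
  have h2 := congrArg (TensorProduct.rid Γ(X, U.1) (X.presheaf.stalk x.1)) this
  rw [TensorProduct.rid_tmul, map_zero, Algebra.smul_def, mul_one] at h2
  have := U.2.isLocalization_stalk x
  have : Nonempty U.1 := ⟨x⟩
  exact IsLocalization.injective (X.presheaf.stalk x.1)
    (U.2.primeIdealOf x).asIdeal.primeCompl_le_nonZeroDivisors (h2.trans (map_zero _).symm)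

/-- Sections over a smaller affine open subset extend after multiplication with a function that is
invertible at a given point. -/
theorem IsVB.exists_smul_eq_res (hP : P.IsVB) {U V : X.affineOpens} (h : V ≤ U) {w : X}
    (hw : w ∈ V.1) (q : P.sec V) : ∃ (s : Γ(X, U.1)) (p : P.sec U), w ∈ X.basicOpen s ∧
      resHom h s • q = P.res h p := by
  obtain ⟨W, t, hWt, hwW, hWU, hWV⟩ := exists_affine_basicOpen U V.1 (h hw) hw
  have : Nonempty W.1 := nonempty_of_mem hwW
  have hwt : w ∈ X.basicOpen t := hWt ▸ hwW
  have hpow : ∀ n : ℕ, w ∈ X.basicOpen (t ^ n) := fun n => by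
    induction n with
    | zero => rw [pow_zero]; exact mem_basicOpen_one (h hw)
    | succ n ih => rw [pow_succ]; exact mem_basicOpen_mul.2 ⟨ih, hwt⟩
  let _ : Algebra Γ(X, U.1) Γ(X, W.1) := (resHom hWU).toAlgebra
  have hloc : IsLocalization.Away t Γ(X, W.1) :=
    U.2.isLocalization_of_eq_basicOpen t (CategoryTheory.homOfLE (show W.1 ≤ U.1 from hWU)) hWt
  -- Over the basic open `D(t)` every section is a fraction with denominator a power of `t`.
  -- Injectivity of restriction then carries the identity back to `V`.
  have key : ∀ y : P.sec W, ∃ (n : ℕ) (p : P.sec U), resHom hWU (t ^ n) • y = P.res hWU p := by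
    intro y
    have hy : y ∈ Submodule.span Γ(X, W.1) (Set.range (P.res hWU)) := by
      rw [(hP.1.isBC hWU).span_range]; trivial
    induction hy using Submodule.span_induction with
    | mem y hy =>
      obtain ⟨p, rfl⟩ := hy
      exact ⟨0, p, by rw [pow_zero, map_one, one_smul]⟩
    | zero => exact ⟨0, 0, by rw [smul_zero, map_zero]⟩
    | add a b _ _ ha hb =>
      obtain ⟨n, p, hp⟩ := ha
      obtain ⟨m, q, hq⟩ := hb
      refine ⟨n + m, t ^ m • p + t ^ n • q, ?_⟩
      rw [map_add, map_smulₛₗ, map_smulₛₗ, ← hp, ← hq, smul_add, smul_smul, smul_smul, ← map_mul,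
        ← map_mul, pow_add, mul_comm (t ^ m)]
    | smul a y _ hy =>
      obtain ⟨n, p, hp⟩ := hy
      obtain ⟨⟨b, ⟨_, m, rfl⟩⟩, hb⟩ := IsLocalization.surj (Submonoid.powers t) a
      refine ⟨m + n, b • p, ?_⟩
      rw [map_smulₛₗ, ← hp, smul_smul, smul_smul]
      congr 1
      change a * resHom hWU (t ^ m) = resHom hWU b at hb
      rw [← hb, pow_add, map_mul]
      ring
  obtain ⟨n, p, hp⟩ := key (P.res hWV q)
  refine ⟨t ^ n, p, hpow n, hP.res_injective hWV ?_⟩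
  rw [map_smulₛₗ, ← resHom_comp, hp, P.res_comp h hWV]

end OXGMod

end Integral

/-- The product of the denominators of finitely many generators serves all elements at once. -/
theorem exists_smul_mem_of_finite {R M : Type*} [CommRing R] [AddCommGroup M] [Module R M]
    [Module.Finite R M] (S : Submonoid R) (N : Submodule R M) (h : ∀ m, ∃ s ∈ S, s • m ∈ N) :
    ∃ s ∈ S, ∀ m, s • m ∈ N := by
  obtain ⟨T, hT⟩ := Module.Finite.fg_top (R := R) (M := M)
  choose s hs hsm using h
  refine ⟨∏ t ∈ T, s t, prod_mem fun t _ => hs t, fun m => ?_⟩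
  have : (T : Set M) ⊆ N.comap (LinearMap.lsmul R M (∏ t ∈ T, s t)) := fun t ht => by
    classical
    rw [SetLike.mem_coe, Submodule.mem_comap, LinearMap.lsmul_apply,
      ← Finset.mul_prod_erase T s ht, mul_comm, mul_smul]
    exact N.smul_mem _ (hsm t)
  exact Submodule.span_le.2 this (hT ▸ Submodule.mem_top)

/-- The functions on `U` that are invertible at `w`. -/
def invertibleAt {X : Scheme.{u}} {U : X.affineOpens} (w : U.1) : Submonoid Γ(X, U.1) where
  carrier := {s | w.1 ∈ X.basicOpen s}
  one_mem' := mem_basicOpen_one w.2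
  mul_mem' h h' := mem_basicOpen_mul.2 ⟨h, h'⟩

theorem exists_smul_eq_tmul {X : Scheme.{u}} {U : X.affineOpens} (w : U.1) {M : Type u}
    [AddCommGroup M] [Module Γ(X, U.1) M] (y : X.presheaf.stalk w.1 ⊗[Γ(X, U.1)] M) :
    ∃ s ∈ invertibleAt w, ∃ m : M, s • y = 1 ⊗ₜ m := by
  have := U.2.isLocalization_stalk w
  induction y using TensorProduct.induction_on with
  | zero => exact ⟨1, one_mem _, 0, by simp⟩
  | tmul a m =>
    obtain ⟨⟨b, s⟩, h⟩ := IsLocalization.surj (U.2.primeIdealOf w).asIdeal.primeCompl a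
    refine ⟨s, (mem_basicOpen_iff_notMem w s.1).2 s.2, b • m, ?_⟩
    rw [TensorProduct.smul_tmul', Algebra.smul_def, mul_comm, h, TensorProduct.tmul_smul,
      TensorProduct.smul_tmul', Algebra.smul_def, mul_one]
  | add a b ha hb =>
    obtain ⟨s, hs, m, hm⟩ := ha
    obtain ⟨t, ht, n, hn⟩ := hb
    refine ⟨s * t, mul_mem hs ht, t • m + s • n, ?_⟩
    rw [smul_add, mul_smul, mul_smul, hn, smul_comm, hm, tmul_add, tmul_smul, tmul_smul]

/-- Since `B` is generated by the image of `A`, the map of quotients is again a base change; the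
submodules are the kernels of the quotient maps, so flatness applies. -/
theorem IsBC.sub {R S : Type u} [CommRing R] [CommRing S] {φ : R →+* S} {M N : Type u}
    [AddCommGroup M] [AddCommGroup N] [Module R M] [Module S N] (hφ : φ.Flat) {f : M →ₛₗ[φ] N}
    (hf : IsBC f) {A : Submodule R M} {B : Submodule S N} (g : A →ₛₗ[φ] B)
    (hg : ∀ a, (g a : N) = f a) (hB : ∀ b ∈ B, b ∈ Submodule.span S (f '' A)) : IsBC g := by
  have hAB : A ≤ B.comap f := fun a ha => by
    rw [Submodule.mem_comap, ← hg ⟨a, ha⟩]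
    exact (g ⟨a, ha⟩).2
  refine IsBC.exact_left (a := A.subtype) (b := A.mkQ) (a' := B.subtype) (b' := B.mkQ)
    (f'' := A.mapQ B f hAB) hφ (fun m => (hg m).symm) (fun m => Submodule.mapQ_apply _ _ _ m) hf ?_
    (LinearMap.exact_subtype_mkQ A) Subtype.val_injective (LinearMap.exact_subtype_mkQ B)
    Subtype.val_injective
  intro Q _ _ q
  have hq : ∀ m, hf.lift (q.comp A.mkQ) (f m) = q (A.mkQ m) := fun m => hf.lift_apply _ m
  have hBk : B ≤ LinearMap.ker (hf.lift (q.comp A.mkQ)) := fun b hb => by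
    refine Submodule.span_le.2 ?_ (hB b hb)
    rintro _ ⟨a, ha, rfl⟩
    rw [SetLike.mem_coe, LinearMap.mem_ker, hq, Submodule.mkQ_apply,
      (Submodule.Quotient.mk_eq_zero A).2 ha, map_zero]
  refine ⟨B.liftQ _ hBk, fun m => ?_, fun g'' hg'' => ?_⟩
  · obtain ⟨m, rfl⟩ := A.mkQ_surjective m
    rw [Submodule.mkQ_apply, Submodule.mapQ_apply, Submodule.liftQ_apply, hq, Submodule.mkQ_apply]
  · refine LinearMap.ext fun n => ?_
    obtain ⟨n, rfl⟩ := B.mkQ_surjective n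
    rw [Submodule.mkQ_apply, Submodule.liftQ_apply]
    refine LinearMap.congr_fun (hf.hom_ext (g := g''.comp B.mkQ) fun m => ?_) n
    rw [hq]
    exact (congrArg g'' (Submodule.mapQ_apply A B f m).symm).trans (hg'' (A.mkQ m))

namespace OXGMod

variable {X : Scheme.{u}} {G : Type v} [Group G]

/-- The functions `r` for which `r q` is generated by sections over `U` form an ideal; the last
hypothesis provides one that is invertible at each point of `V`. -/
theorem isCoherent_sub [IsLocallyNoetherian X] {P : OXGMod X G} (hP : P.IsCoherent)
    {S : ∀ U, Submodule Γ(X, U.1) (P.sec U)}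
    (hres : ∀ {U V : X.affineOpens} (h : V ≤ U) m, m ∈ S U → P.res h m ∈ S V)
    (hrho : ∀ (U : X.affineOpens) (g : G) m, m ∈ S U → P.rho U g m ∈ S U)
    (hloc : ∀ {U V : X.affineOpens} (h : V ≤ U) q, q ∈ S V → ∀ w ∈ V.1,
      ∃ (s : Γ(X, U.1)) (p : P.sec U), w ∈ X.basicOpen s ∧ p ∈ S U ∧ resHom h s • q = P.res h p) :
    (P.sub S hres hrho).IsCoherent := by
  refine ⟨isQuasicoherent_iff.2 fun U V h => ?_, fun U => ?_⟩
  · refine IsBC.sub (resHom_flat h) (hP.isBC h) _ (fun _ => rfl) fun q hq => ?_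
    let I : Ideal Γ(X, V.1) :=
      (Submodule.span Γ(X, V.1) (P.res h '' S U)).comap (LinearMap.toSpanSingleton _ _ q)
    have hI : I = ⊤ := ideal_eq_top fun w => by
      obtain ⟨s, p, hs, hp, e⟩ := hloc h q hq w.1 w.2
      refine ⟨resHom h s, ?_, (mem_basicOpen_resHom h s w.2).2 hs⟩
      rw [Submodule.mem_comap, LinearMap.toSpanSingleton_apply, e]
      exact Submodule.subset_span ⟨p, hp, rfl⟩
    have h1 : (1 : Γ(X, V.1)) ∈ I := hI ▸ Submodule.mem_top
    rwa [Submodule.mem_comap, LinearMap.toSpanSingleton_apply, one_smul] at h1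
  · have := hP.2 U
    exact inferInstanceAs (Module.Finite Γ(X, U.1) (S U))

/-- Two modules embedded in a third one are isomorphic near `w` if their images agree there. -/
theorem LocEquivAt.of_range {A B : OXGMod X G} {U : X.affineOpens} {w : U.1} {C : Type*}
    [AddCommGroup C] [Module Γ(X, U.1) C] (τ : G → C →ₗ[Γ(X, U.1)] C)
    {f : A.sec U →ₗ[Γ(X, U.1)] C} {g : B.sec U →ₗ[Γ(X, U.1)] C} (hf : Function.Injective f)
    (hg : Function.Injective g) (hfτ : ∀ x a, f (A.rho U x a) = τ x (f a))
    (hgτ : ∀ x a, g (B.rho U x a) = τ x (g a)) {s : Γ(X, U.1)} (hs : w.1 ∈ X.basicOpen s)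
    (hfg : ∀ a, s • f a ∈ LinearMap.range g) (hgf : ∀ b, s • g b ∈ LinearMap.range f) :
    LocEquivAt A B U w := by
  let h : A.sec U →ₗ[Γ(X, U.1)] B.sec U :=
    (LinearEquiv.ofInjective g hg).symm.toLinearMap ∘ₗ (s • f).codRestrict _ hfg
  let k : B.sec U →ₗ[Γ(X, U.1)] A.sec U :=
    (LinearEquiv.ofInjective f hf).symm.toLinearMap ∘ₗ (s • g).codRestrict _ hgf
  have hh : ∀ a, g (h a) = s • f a := fun a =>
    congrArg Subtype.val ((LinearEquiv.ofInjective g hg).apply_symm_apply ⟨s • f a, hfg a⟩)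
  have hk : ∀ b, f (k b) = s • g b := fun b =>
    congrArg Subtype.val ((LinearEquiv.ofInjective f hf).apply_symm_apply ⟨s • g b, hgf b⟩)
  refine ⟨h, k, s * s, mem_basicOpen_mul.2 ⟨hs, hs⟩, fun a => hf ?_, fun b => hg ?_,
    fun x a => hg ?_, fun x b => hf ?_⟩
  · rw [hk, hh, map_smul, mul_smul]
  · rw [hh, hk, map_smul, mul_smul]
  · rw [hh, hfτ, hgτ, hh, map_smul]
  · rw [hk, hfτ, hgτ, hk, map_smul]

end OXGMod

/-! ### Ranks -/

section Rank

variable {R : Type*} {G : Type*} [CommRing R] [Nontrivial R] [Group G] [Finite G]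

theorem finrank_eq_card_mul {M : Type*} [AddCommGroup M] [Module R M] [Module (MonoidAlgebra R G) M]
    [IsScalarTower R (MonoidAlgebra R G) M] {ι : Type*} [Fintype ι]
    (b : Module.Basis ι (MonoidAlgebra R G) M) :
    Module.finrank R M = Fintype.card ι * Nat.card G := by
  have := Fintype.ofFinite G
  rw [Module.finrank_eq_card_basis ((MonoidAlgebra.basis G R).smulTower b), Fintype.card_prod,
    Nat.card_eq_fintype_card, mul_comm]

theorem nonempty_linearEquiv_of_finrank_eq {M N : Type*} [AddCommGroup M] [Module R M]
    [Module (MonoidAlgebra R G) M] [IsScalarTower R (MonoidAlgebra R G) M] [AddCommGroup N]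
    [Module R N] [Module (MonoidAlgebra R G) N] [IsScalarTower R (MonoidAlgebra R G) N]
    [Module.Finite (MonoidAlgebra R G) M] [Module.Free (MonoidAlgebra R G) M]
    [Module.Finite (MonoidAlgebra R G) N] [Module.Free (MonoidAlgebra R G) N]
    (h : Module.finrank R M = Module.finrank R N) : Nonempty (M ≃ₗ[MonoidAlgebra R G] N) := by
  let b := Module.Free.chooseBasis (MonoidAlgebra R G) M
  let c := Module.Free.chooseBasis (MonoidAlgebra R G) N
  rw [finrank_eq_card_mul b, finrank_eq_card_mul c] at h
  exact ⟨b.equiv c (Fintype.equivOfCardEq (Nat.eq_of_mul_eq_mul_right Nat.card_pos h))⟩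

end Rank

section RankHom

variable (R : Type w) (G : Type v) [CommRing R] [Group G]

/-- The rank over `R` of a module over the group ring `RG`. -/
def baseRank (M : ModuleCat.{u} (MonoidAlgebra R G)) : ℕ :=
  letI : Module R M := Module.compHom M (algebraMap R (MonoidAlgebra R G))
  Module.finrank R M

variable {R G}

theorem baseRank_eq (M : ModuleCat.{u} (MonoidAlgebra R G)) [Module R M]
    [IsScalarTower R (MonoidAlgebra R G) M] : baseRank R G M = Module.finrank R M := by
  rw [baseRank]
  congr 1
  exact Module.ext' _ _ fun r m => algebraMap_smul (MonoidAlgebra R G) r m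

variable [Nontrivial R] [Finite G]

theorem baseRank_ses {A B C : ModuleCat.{u} (MonoidAlgebra R G)} (h : ModSes _ A B C)
    (hA : Module.Finite (MonoidAlgebra R G) A ∧ Module.Free (MonoidAlgebra R G) A)
    (hC : Module.Finite (MonoidAlgebra R G) C ∧ Module.Free (MonoidAlgebra R G) C) :
    baseRank R G B = baseRank R G A + baseRank R G C := by
  obtain ⟨_, _⟩ := hA
  obtain ⟨_, _⟩ := hC
  obtain ⟨e⟩ := h.nonempty_equiv
  let _ : Module R A := Module.compHom A (algebraMap R (MonoidAlgebra R G))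
  let _ : Module R B := Module.compHom B (algebraMap R (MonoidAlgebra R G))
  let _ : Module R C := Module.compHom C (algebraMap R (MonoidAlgebra R G))
  have tower (M : ModuleCat.{u} (MonoidAlgebra R G))
      [i : Module R M] (hi : ∀ (r : R) (m : M), r • m = algebraMap R (MonoidAlgebra R G) r • m) :
      IsScalarTower R (MonoidAlgebra R G) M :=
    ⟨fun r a m => by rw [hi, Algebra.smul_def, mul_smul]⟩
  have := tower A fun _ _ => rfl
  have := tower B fun _ _ => rfl
  have := tower C fun _ _ => rfl
  let b := Module.Free.chooseBasis (MonoidAlgebra R G) A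
  let c := Module.Free.chooseBasis (MonoidAlgebra R G) C
  rw [baseRank_eq, baseRank_eq, baseRank_eq, finrank_eq_card_mul b, finrank_eq_card_mul c,
    finrank_eq_card_mul ((b.prod c).map e.symm), Fintype.card_sum, add_mul]

variable (R G)

/-- The homomorphism given by the rank. -/
def K0FreeMod.rank : K0FreeMod.{u} (MonoidAlgebra R G) →+ ℤ :=
  K0.lift (fun M _ => (baseRank R G M : ℤ)) fun _ _ _ hA _ hC hs => by
    rw [baseRank_ses hs hA hC, Nat.cast_add]

end RankHom

/-! ### Ranks of bundles and local isomorphism of locally free modules -/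

namespace OXGMod

section Rank

variable {X : Scheme.{u}} [IsIntegral X] {G : Type v} [Group G]

theorem IsCoherent.finrank_res {P : OXGMod X G} (hP : P.IsCoherent) {U V : X.affineOpens}
    (h : V ≤ U) [Nonempty V.1] :
    Module.finrank Γ(X, V.1) (P.sec V) = Module.finrank Γ(X, U.1) (P.sec U) := by
  let _ : Algebra Γ(X, U.1) Γ(X, V.1) := (resHom h).toAlgebra
  let _ : Module Γ(X, U.1) (P.sec V) := Module.compHom _ (resHom h)
  have : IsScalarTower Γ(X, U.1) Γ(X, V.1) (P.sec V) := ⟨fun r s m => mul_smul (resHom h r) s m⟩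
  have : FaithfulSMul Γ(X, U.1) Γ(X, V.1) :=
    (faithfulSMul_iff_algebraMap_injective _ _).2 (resHom_injective h)
  exact (hP.1 U V h).finrank_eq

theorem IsCoherent.finrank_eq {P : OXGMod X G} (hP : P.IsCoherent) (U V : X.affineOpens)
    [Nonempty U.1] [Nonempty V.1] :
    Module.finrank Γ(X, U.1) (P.sec U) = Module.finrank Γ(X, V.1) (P.sec V) := by
  obtain ⟨x, hx⟩ := (inferInstance : Nonempty U.1)
  obtain ⟨y, hy⟩ := (inferInstance : Nonempty V.1)
  obtain ⟨W, t, -, hW, hWU, hWV⟩ := exists_affine_basicOpen U V.1 (genericPoint_mem hx)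
    (genericPoint_mem hy)
  have := nonempty_of_mem hW
  rw [← hP.finrank_res hWU, hP.finrank_res (show W ≤ V from hWV)]

theorem finrank_stalk (P : OXGMod X G) (U : X.affineOpens) (x : U.1) :
    Module.finrank (X.presheaf.stalk x.1) (X.presheaf.stalk x.1 ⊗[Γ(X, U.1)] P.sec U) =
      Module.finrank Γ(X, U.1) (P.sec U) := by
  have := U.2.isLocalization_stalk x
  have : Nonempty U.1 := ⟨x⟩
  have : FaithfulSMul Γ(X, U.1) (X.presheaf.stalk x.1) :=
    (faithfulSMul_iff_algebraMap_injective _ _).2 (IsLocalization.injective _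
      (U.2.primeIdealOf x).asIdeal.primeCompl_le_nonZeroDivisors)
  exact (TensorProduct.isBaseChange Γ(X, U.1) (P.sec U) (X.presheaf.stalk x.1)).finrank_eq

variable [Finite G] [IrreducibleSpace X]

/-- The rank over the function field is additive on `K_0^lf(FG)`, and on an integral scheme the rank
of sections is the same on all nonempty affine opens. -/
theorem finrank_eq_of_toGeneric_eq {P Q : OXGMod X G} (hP : P.LocallyFree) (hQ : Q.LocallyFree)
    (h : K0Free.toGeneric X G (K0.cls P hP) = K0Free.toGeneric X G (K0.cls Q hQ))
    (U : X.affineOpens) [Nonempty U.1] :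
    Module.finrank Γ(X, U.1) (P.sec U) = Module.finrank Γ(X, U.1) (Q.sec U) := by
  let x : (genericNhd X).1 := ⟨genericPoint X, (exists_affine_genericPoint X).choose_spec⟩
  have h := congrArg (K0FreeMod.rank (X.presheaf.stalk x.1) G) h
  rw [K0Free.toGeneric, K0Free.toStalk, K0.lift_cls, K0.lift_cls, K0FreeMod.rank] at h
  have h := (K0.lift_cls _ _ _ _).symm.trans (h.trans (K0.lift_cls _ _ _ _))
  have : Nonempty (genericNhd X).1 := ⟨x⟩
  have e (P : OXGMod X G) : baseRank _ G (P.stalkMod (genericNhd X) x) =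
      Module.finrank Γ(X, (genericNhd X).1) (P.sec (genericNhd X)) := by
    rw [← finrank_stalk P _ x]
    exact baseRank_eq (R := X.presheaf.stalk x.1) (ModuleCat.of _ (P.stalkRep
        (genericNhd X) x).asModule)
  rw [Nat.cast_inj, e, e] at h
  rw [hP.1.finrank_eq U (genericNhd X), hQ.1.finrank_eq U (genericNhd X), h]

/-- Locally free modules of the same rank are locally isomorphic. -/
theorem LocallyFree.locEquiv [IsLocallyNoetherian X] {P Q : OXGMod X G} (hP : P.LocallyFree)
    (hQ : Q.LocallyFree)
    (h : K0Free.toGeneric X G (K0.cls P hP) = K0Free.toGeneric X G (K0.cls Q hQ)) :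
    LocEquiv P Q := by
  intro U w
  have := Fintype.ofFinite G
  have : Nonempty U.1 := ⟨w⟩
  let A := X.presheaf.stalk w.1
  have hr := finrank_eq_of_toGeneric_eq hP hQ h U
  rw [← finrank_stalk P U w, ← finrank_stalk Q U w] at hr
  have : Module.Finite (MonoidAlgebra A G) (P.stalkRep U w).asModule := (hP.stalkMod U w).1
  have : Module.Free (MonoidAlgebra A G) (P.stalkRep U w).asModule := (hP.stalkMod U w).2
  have : Module.Finite (MonoidAlgebra A G) (Q.stalkRep U w).asModule := (hQ.stalkMod U w).1
  have : Module.Free (MonoidAlgebra A G) (Q.stalkRep U w).asModule := (hQ.stalkMod U w).2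
  obtain ⟨e⟩ : Nonempty ((P.stalkRep U w).asModule ≃ₗ[MonoidAlgebra A G]
      (Q.stalkRep U w).asModule) := 
    nonempty_linearEquiv_of_finrank_eq (R := A) (M := (P.stalkRep U w).asModule)
      (N := (Q.stalkRep U w).asModule) hr
  let e' : A ⊗[Γ(X, U.1)] P.sec U ≃ₗ[A] A ⊗[Γ(X, U.1)] Q.sec U :=
    (P.stalkRep U w).asModuleEquiv.symm ≪≫ₗ e.restrictScalars A ≪≫ₗ (Q.stalkRep U w).asModuleEquiv
  have he : ∀ g m, e' (P.stalkRep U w g m) = Q.stalkRep U w g (e' m) := fun g m => by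
    have h1 := e.map_smul (MonoidAlgebra.single g (1 : A)) ((P.stalkRep U w).asModuleEquiv.symm m)
    rw [Representation.asModule_single_smul, Representation.asModule_single_smul] at h1
    exact congrArg (Q.stalkRep U w).asModuleEquiv h1
  let i (P : OXGMod X G) : P.sec U →ₗ[Γ(X, U.1)] A ⊗[Γ(X, U.1)] P.sec U :=
    TensorProduct.mk Γ(X, U.1) A (P.sec U) 1
  have hi {P : OXGMod X G} (hP : P.IsVB) : Function.Injective (i P) :=
    (injective_iff_map_eq_zero _).2 fun m hm => hP.eq_zero_of_tmul w hm
  have := hP.1.2 U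
  have := hQ.1.2 U
  let f : P.sec U →ₗ[Γ(X, U.1)] A ⊗[Γ(X, U.1)] Q.sec U := e'.toLinearMap.restrictScalars _ ∘ₗ i P
  -- Inside the stalk of `Q`, the transported sections of `P` and the sections of `Q` agree up to
  -- denominators invertible at `w`; finite generation allows one denominator in each direction.
  obtain ⟨s, hs, hs'⟩ := exists_smul_mem_of_finite (invertibleAt w)
    ((LinearMap.range (i Q)).comap f) fun m => by
      obtain ⟨s, hs, n, hn⟩ := exists_smul_eq_tmul w (f m)
      exact ⟨s, hs, by rw [Submodule.mem_comap, map_smul, hn]; exact ⟨n, rfl⟩⟩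
  obtain ⟨t, ht, ht'⟩ := exists_smul_mem_of_finite (invertibleAt w)
    ((LinearMap.range f).comap (i Q)) fun m => by
      obtain ⟨s, hs, n, hn⟩ := exists_smul_eq_tmul w (e'.symm (i Q m))
      refine ⟨s, hs, n, ?_⟩
      change e' (1 ⊗ₜ n) = i Q (s • m)
      have h1 := congrArg e' hn
      rw [← h1, ← algebraMap_smul A, map_smul, e'.apply_symm_apply, algebraMap_smul, map_smul]
  refine LocEquivAt.of_range (fun g => (Q.stalkRep U w g).restrictScalars _) (f := f) (g := i Q)
    (s := s * t) (e'.injective.comp (hi hP.locallyProjective.isVB)) (hi hQ.locallyProjective.isVB)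
    (fun g m => he g (1 ⊗ₜ m)) (fun g m => rfl) (mul_mem hs ht) (fun m => ?_) (fun m => ?_)
  · rw [mul_comm, mul_smul, ← map_smul]
    exact Submodule.smul_mem _ _ (hs' m)
  · rw [mul_smul, ← map_smul]
    exact Submodule.smul_mem _ _ (ht' m)

end Rank

end OXGMod

/-! ### Modifications -/

section Koszul

variable {A : Type*} [CommRing A] {M N M' N' : Type*} [AddCommGroup M] [AddCommGroup N]
  [AddCommGroup M'] [AddCommGroup N'] [Module A M] [Module A N] [Module A M'] [Module A N']

/-- `f` is an isomorphism up to multiplication by `s`. -/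
def InvertibleUpTo (s : A) (f : M →ₗ[A] N) : Prop :=
  ∃ h : N →ₗ[A] M, (∀ n, f (h n) = s • n) ∧ ∀ m, h (f m) = s • m

theorem invertibleUpTo_of_injective {s : A} {f : M →ₗ[A] N} (hf : Function.Injective f)
    (hs : ∀ n, s • n ∈ LinearMap.range f) : InvertibleUpTo s f := by
  let h : N →ₗ[A] M := (LinearEquiv.ofInjective f hf).symm.toLinearMap ∘ₗ
    (s • LinearMap.id).codRestrict (LinearMap.range f) hs
  have hh : ∀ n, f (h n) = s • n := fun n =>
    congrArg Subtype.val ((LinearEquiv.ofInjective f hf).apply_symm_apply ⟨s • n, hs n⟩)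
  exact ⟨h, hh, fun m => hf (by rw [hh, map_smul])⟩

/-- The first map of the tensor product of two two-term complexes. -/
def koszulLeft (f : M →ₗ[A] N) (g : M' →ₗ[A] N') : M ⊗[A] M' →ₗ[A] (N ⊗[A] M') × (M ⊗[A] N') :=
  (TensorProduct.map f LinearMap.id).prod (TensorProduct.map LinearMap.id g)

/-- The second map of the tensor product of two two-term complexes. -/
def koszulRight (f : M →ₗ[A] N) (g : M' →ₗ[A] N') : (N ⊗[A] M') × (M ⊗[A] N') →ₗ[A] N ⊗[A] N' :=
  (TensorProduct.map LinearMap.id g).coprod (-TensorProduct.map f LinearMap.id)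

theorem mem_of_span_eq_top {S : Set A} (h : Ideal.span S = ⊤) (K : Submodule A M) (y : M)
    (hy : ∀ s ∈ S, s • y ∈ K) : y ∈ K := by
  have : Ideal.span S ≤ K.comap (LinearMap.toSpanSingleton A M y) := Ideal.span_le.2 hy
  have h1 := this (h ▸ Submodule.mem_top : (1 : A) ∈ _)
  rwa [Submodule.mem_comap, LinearMap.toSpanSingleton_apply, one_smul] at h1

/-- An inverse up to `s` of either map provides a homotopy that makes multiplication by `s` zero on
the homology of the complex. Such `s` generate the unit ideal. -/
theorem koszul_exact {f : M →ₗ[A] N} {g : M' →ₗ[A] N'}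
    (h : Ideal.span {s | InvertibleUpTo s f ∨ InvertibleUpTo s g} = ⊤) :
    Function.Exact (koszulLeft f g) (koszulRight f g) ∧
      Function.Surjective (koszulRight f g) := by
  refine ⟨fun y => ⟨fun hy => ?_, ?_⟩, fun y => ?_⟩
  · refine mem_of_span_eq_top h (LinearMap.range (koszulLeft f g)) y fun s hs => ?_
    obtain ⟨y, z⟩ := y
    have hy : TensorProduct.map LinearMap.id g y = TensorProduct.map f LinearMap.id z := by
      have : TensorProduct.map LinearMap.id g y + -TensorProduct.map f LinearMap.id z = 0 := hy
      rwa [← sub_eq_add_neg, sub_eq_zero] at this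
    rcases hs with ⟨k, h1, h2⟩ | ⟨k, h1, h2⟩
    · refine ⟨TensorProduct.map k LinearMap.id y, Prod.ext ?_ ?_⟩
      · exact semilinear_eq (TensorProduct.map f LinearMap.id ∘ₗ TensorProduct.map k LinearMap.id)
          (s • LinearMap.id) (fun a b => by simp [h1, smul_tmul']) y
      · refine (semilinear_eq
          (TensorProduct.map LinearMap.id g ∘ₗ TensorProduct.map k LinearMap.id)
          (TensorProduct.map k LinearMap.id ∘ₗ TensorProduct.map LinearMap.id g)
          (fun a b => rfl) y).trans ((congrArg _ hy).trans ?_)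
        exact semilinear_eq (TensorProduct.map k LinearMap.id ∘ₗ TensorProduct.map f LinearMap.id)
          (s • LinearMap.id) (fun a b => by simp [h2, smul_tmul']) z
    · refine ⟨TensorProduct.map LinearMap.id k z, Prod.ext ?_ ?_⟩
      · refine (semilinear_eq
          (TensorProduct.map f LinearMap.id ∘ₗ TensorProduct.map LinearMap.id k)
          (TensorProduct.map LinearMap.id k ∘ₗ TensorProduct.map f LinearMap.id)
          (fun a b => rfl) z).trans ((congrArg _ hy.symm).trans ?_)
        exact semilinear_eq (TensorProduct.map LinearMap.id k ∘ₗ TensorProduct.map LinearMap.id g)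
          (s • LinearMap.id) (fun a b => by simp [h2]) y
      · exact semilinear_eq (TensorProduct.map LinearMap.id g ∘ₗ TensorProduct.map LinearMap.id k)
          (s • LinearMap.id) (fun a b => by simp [h1]) z
  · rintro ⟨x, rfl⟩
    have e : TensorProduct.map LinearMap.id g (TensorProduct.map f LinearMap.id x) =
        TensorProduct.map f LinearMap.id (TensorProduct.map LinearMap.id g x) :=
      semilinear_eq (TensorProduct.map LinearMap.id g ∘ₗ TensorProduct.map f LinearMap.id)
        (TensorProduct.map f LinearMap.id ∘ₗ TensorProduct.map LinearMap.id g) (fun a b => rfl) x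
    rw [koszulRight, koszulLeft, LinearMap.coprod_apply, LinearMap.prod_apply, LinearMap.neg_apply]
    exact add_neg_eq_zero.2 e
  · refine mem_of_span_eq_top h (LinearMap.range (koszulRight f g)) y fun s hs => ?_
    rcases hs with ⟨k, h1, h2⟩ | ⟨k, h1, h2⟩
    · refine ⟨(0, -TensorProduct.map k LinearMap.id y), ?_⟩
      have : koszulRight f g (0, -TensorProduct.map k LinearMap.id y) =
          TensorProduct.map f LinearMap.id (TensorProduct.map k LinearMap.id y) := by
        simp [koszulRight]
      rw [this]
      exact semilinear_eq (TensorProduct.map f LinearMap.id ∘ₗ TensorProduct.map k LinearMap.id)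
          (s • LinearMap.id) (fun a b => by simp [h1, smul_tmul']) y
    · refine ⟨(TensorProduct.map LinearMap.id k y, 0), ?_⟩
      have : koszulRight f g (TensorProduct.map LinearMap.id k y, 0) =
          TensorProduct.map LinearMap.id g (TensorProduct.map LinearMap.id k y) := by
        simp [koszulRight]
      rw [this]
      exact semilinear_eq (TensorProduct.map LinearMap.id g ∘ₗ TensorProduct.map LinearMap.id k)
          (s • LinearMap.id) (fun a b => by simp [h1]) y

end Koszul

/-! ### Modifications, their symmetric powers and their Koszul sequences -/

namespace OXGMod

variable {X : Scheme.{u}} {G : Type v} [Group G]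

/-- There is an injective homomorphism `B → A` that is an isomorphism at the points of `W`. -/
def IsModification (W : Set X) (B A : OXGMod X G) : Prop :=
  ∃ f : Hom B A, ∀ U : X.affineOpens, Function.Injective (f.app U) ∧
    ∀ w : U.1, w.1 ∈ W → ∃ s : Γ(X, U.1), s ∈ invertibleAt w ∧
      ∀ a : A.sec U, s • a ∈ LinearMap.range (f.app U)

theorem IsModification.mono {W W' : Set X} {B A : OXGMod X G} (h : IsModification W B A)
    (hW : W' ⊆ W) : IsModification W' B A := by
  obtain ⟨f, hf⟩ := h
  exact ⟨f, fun U => ⟨(hf U).1, fun w hw => (hf U).2 w (hW hw)⟩⟩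

theorem IsModification.locEquivAt {W : Set X} {B A : OXGMod X G} (h : IsModification W B A)
    {U : X.affineOpens} (w : U.1) (hw : w.1 ∈ W) : LocEquivAt B A U w := by
  obtain ⟨f, hf⟩ := h
  obtain ⟨s, hs, hs'⟩ := (hf U).2 w hw
  exact .of_range (fun x => A.rho U x) (g := LinearMap.id) (hf U).1 Function.injective_id
    (fun x a => f.app_rho U x a) (fun _ _ => rfl) hs (fun a => ⟨_, rfl⟩) hs'

theorem subsingleton_of_isEmpty (P : OXGMod X G) {U : X.affineOpens} (hU : IsEmpty U.1) :
    Subsingleton (P.sec U) := by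
  have : Subsingleton Γ(X, U.1) := by
    have h : U.1 = ⊥ := by
      ext x
      exact ⟨fun hx => hU.elim ⟨x, hx⟩, fun hx => hx.elim⟩
    rw [h]
    infer_instance
  exact Module.subsingleton Γ(X, U.1) _

theorem IsModification.sym [IsIntegral X] {W : Set X} (hW : genericPoint X ∈ W)
    {B A : OXGMod X G} (hB : B.IsVB) (h : IsModification W B A) (n : ℕ) :
    IsModification W (B.sym n) (A.sym n) := by
  obtain ⟨f, hf⟩ := h
  let f' : Hom (B.sym n) (A.sym n) :=
    { app := fun U => SymPow.map (RingHom.id _) (f.app U) n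
      app_res := fun {U V} h m => Subtype.ext
        ((SymPow.algMap_comp (resHom h) (RingHom.id _) (resHom h) (B.res h) (f.app V)
          ((A.res h).comp (f.app U)) (fun _ => rfl) (fun m => (f.app_res h m).symm) m.1).trans
        (SymPow.algMap_comp (RingHom.id _) (resHom h) (resHom h) (f.app U) (A.res h)
          ((A.res h).comp (f.app U)) (fun _ => rfl) (fun _ => rfl) m.1).symm)
      app_rho := fun U x m => Subtype.ext
        ((SymPow.algMap_comp _ _ (RingHom.id _) _ _ (f.app U ∘ₗ B.rho U x)
          (fun _ => rfl) (fun _ => rfl) m.1).trans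
        (SymPow.algMap_comp _ _ (RingHom.id _) _ _ (f.app U ∘ₗ B.rho U x)
          (fun _ => rfl) (fun m => f.app_rho U x m) m.1).symm) }
  have key : ∀ (U : X.affineOpens) (w : U.1), w.1 ∈ W → ∃ s ∈ invertibleAt w,
      InvertibleUpTo s (f'.app U) := fun U w hw => by
    obtain ⟨s, hs, hs'⟩ := (hf U).2 w hw
    obtain ⟨k, h1, h2⟩ := invertibleUpTo_of_injective (hf U).1 hs'
    exact ⟨s ^ n, pow_mem hs n, SymPow.map (RingHom.id _) k n,
      fun a => (SymPow.map_map _ _ _ _).trans (SymPow.map_smul_eq (f := f.app U ∘ₗ k) h1 n a),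
      fun a => (SymPow.map_map _ _ _ _).trans (SymPow.map_smul_eq (f := k ∘ₗ f.app U) h2 n a)⟩
  refine ⟨f', fun U => ⟨?_, fun w hw => ?_⟩⟩
  -- Symmetric powers do not preserve injectivity in general. Here the map is invertible up to a
  -- nonzero function, because the modification is an isomorphism at the generic point, and
  -- `Sym^n(B)` is torsion-free.
  · rcases isEmpty_or_nonempty U.1 with hU | ⟨x, hx⟩
    · have := (B.sym n).subsingleton_of_isEmpty hU
      exact Function.injective_of_subsingleton _
    · obtain ⟨s, hs, k, -, hk⟩ := key U ⟨_, genericPoint_mem hx⟩ hW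
      exact fun a b hab => (hB.sym n).smul_cancel (ne_zero_of_mem_basicOpen hs) (by
        rw [← hk, ← hk, hab])
  · obtain ⟨s, hs, k, hk, -⟩ := key U w hw
    exact ⟨s, hs, fun a => ⟨k a, hk a⟩⟩

/-- The Koszul complex of two modifications with disjoint centres. -/
theorem IsModification.ses_koszul {W W' : Set X} (hW : W ∪ W' = Set.univ) {B A B' A' : OXGMod X G}
    (h : IsModification W B A) (h' : IsModification W' B' A') (hB' : B'.IsVB) :
    Ses (B.tensor B') ((A.tensor B').prod (B.tensor A')) (A.tensor A') := by
  obtain ⟨f, hf⟩ := h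
  obtain ⟨g, hg⟩ := h'
  let f₁ := f.tensorMap (Hom.id B')
  let f₂ := f.tensorMap (Hom.id A')
  let g₁ := (Hom.id B).tensorMap g
  let g₂ := (Hom.id A).tensorMap g
  refine ⟨⟨fun U => koszulLeft (f.app U) (g.app U), fun h m => Prod.ext (f₁.app_res h m)
      (g₁.app_res h m), fun U x m => Prod.ext (f₁.app_rho U x m) (g₁.app_rho U x m)⟩,
    ⟨fun U => koszulRight (f.app U) (g.app U), fun {U V} h m => ?_, fun U x m => ?_⟩,
    fun U => ⟨?_, koszul_exact (ideal_eq_top fun w => ?_)⟩⟩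
  · have e : (A.tensor A').res h (g₂.app U m.1 + -f₂.app U m.2) =
        g₂.app V ((A.tensor B').res h m.1) + -f₂.app V ((B.tensor A').res h m.2) := by
      rw [map_add, map_neg, ← g₂.app_res, ← f₂.app_res]
    exact e.symm
  · have e : (A.tensor A').rho U x (g₂.app U m.1 + -f₂.app U m.2) =
        g₂.app U ((A.tensor B').rho U x m.1) + -f₂.app U ((B.tensor A').rho U x m.2) := by
      rw [map_add, map_neg, ← g₂.app_rho, ← f₂.app_rho]
    exact e.symm
  · have := hB'.2 U
    exact fun a b hab => Module.Flat.rTensor_preserves_injective_linearMap (M := B'.sec U) _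
      (hf U).1 (congrArg Prod.fst hab)
  · rcases (hW ▸ Set.mem_univ w.1 : w.1 ∈ W ∪ W') with hw | hw
    · obtain ⟨s, hs, hs'⟩ := (hf U).2 w hw
      exact ⟨s, Ideal.subset_span (.inl (invertibleUpTo_of_injective (hf U).1 hs')), hs⟩
    · obtain ⟨s, hs, hs'⟩ := (hg U).2 w hw
      exact ⟨s, Ideal.subset_span (.inr (invertibleUpTo_of_injective (hg U).1 hs')), hs⟩

end OXGMod

/-! ### Points of Dedekind schemes -/

section Points

variable {X : Scheme.{u}}

/-- The ideal of the functions on `U` that are not invertible at `z`. -/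
def vanishingAt (z : X) (U : X.affineOpens) : Ideal Γ(X, U.1) where
  carrier := {r | z ∉ X.basicOpen r}
  zero_mem' := fun h => ne_zero_of_mem_basicOpen h rfl
  add_mem' {a b} ha hb h := by
    let z' : U.1 := ⟨z, X.basicOpen_le _ h⟩
    have ha : z'.1 ∉ X.basicOpen a := ha
    have hb : z'.1 ∉ X.basicOpen b := hb
    have h : z'.1 ∈ X.basicOpen (a + b) := h
    rw [mem_basicOpen_iff_notMem, not_not] at ha hb
    rw [mem_basicOpen_iff_notMem] at h
    exact h (add_mem ha hb)
  smul_mem' a b hb h := hb (mem_basicOpen_mul.1 h).2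

/-- The point need not lie in `U`: otherwise the ideal is the unit ideal, so that one formula gives
the ideal sheaf of `z` on all affine opens. -/
theorem mem_vanishingAt {z : X} {U : X.affineOpens} {r : Γ(X, U.1)} :
    r ∈ vanishingAt z U ↔ z ∉ X.basicOpen r := Iff.rfl

theorem vanishingAt_eq {U : X.affineOpens} (z : U.1) :
    vanishingAt z.1 U = (U.2.primeIdealOf z).asIdeal :=
  Ideal.ext fun r => by rw [mem_vanishingAt, mem_basicOpen_iff_notMem, not_not]

variable [IsDedekindScheme X]

theorem primeIdealOf_ne_bot {U : X.affineOpens} {z : U.1} (hz : z.1 ≠ genericPoint X) :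
    (U.2.primeIdealOf z).asIdeal ≠ ⊥ := by
  intro h
  refine hz ((genericPoint_spec X).eq ?_).symm
  refine dense_iff_closure_eq.1 (dense_iff_inter_open.2 fun V hV ⟨y, hy⟩ => ⟨z.1, ?_, rfl⟩)
  obtain ⟨W, t, hW, hξ, -, hWV⟩ := exists_affine_basicOpen U ⟨V, hV⟩ (genericPoint_mem z.2)
    (genericPoint_mem (U := ⟨V, hV⟩) hy)
  apply hWV
  rw [hW] at hξ ⊢
  rw [mem_basicOpen_iff_notMem, h]
  exact fun h0 => ne_zero_of_mem_basicOpen hξ h0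

/-- A specialization of `z` corresponds to a prime containing the nonzero prime of `z`, which is
already maximal in a Dedekind domain. -/
theorem isClosed_singleton_of_ne {z : X} (hz : z ≠ genericPoint X) : IsClosed ({z} : Set X) := by
  refine isClosed_of_closure_subset fun w hw => ?_
  obtain ⟨_, ⟨U, hU, rfl⟩, hwU, -⟩ := X.isBasis_affineOpens.exists_subset_of_mem_open
    (Set.mem_univ w) isOpen_univ
  have hzU : z ∈ U := by
    obtain ⟨y, hy, rfl⟩ := mem_closure_iff.1 hw U U.2 hwU
    exact hy
  let V : X.affineOpens := ⟨U, hU⟩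
  let z' : V.1 := ⟨z, hzU⟩
  let w' : V.1 := ⟨w, hwU⟩
  have : Nonempty V.1 := ⟨z'⟩
  have := IsDedekindScheme.isDedekindDomain V
  have hmax := (V.2.primeIdealOf z').isPrime.isMaximal (primeIdealOf_ne_bot hz)
  have hle : (V.2.primeIdealOf z').asIdeal ≤ (V.2.primeIdealOf w').asIdeal := fun r hr => by
    by_contra h
    rw [← mem_basicOpen_iff_notMem] at h
    obtain ⟨y, hy, rfl⟩ := mem_closure_iff.1 hw _ (X.basicOpen r).2 h
    exact (mem_basicOpen_iff_notMem z' r).1 hy hr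
  have heq := hmax.eq_of_le (V.2.primeIdealOf w').isPrime.ne_top hle
  have h1 := V.2.fromSpec_primeIdealOf z'
  have h2 := V.2.fromSpec_primeIdealOf w'
  rw [PrimeSpectrum.ext heq, h2] at h1
  exact h1

/-- The complement has finitely many irreducible components, and the generic point of each is a
closed point. -/
theorem finite_compl_of_isOpen {W : Set X} (hW : IsOpen W) (hξ : genericPoint X ∈ W) :
    Wᶜ.Finite := by
  obtain ⟨S, hS, hc, hi, he⟩ :=
    TopologicalSpace.NoetherianSpace.exists_finite_set_isClosed_irreducible hW.isClosed_compl
  rw [he, Set.sUnion_eq_biUnion]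
  refine hS.biUnion fun t ht => ?_
  have hg := (hi t ht).isGenericPoint_genericPoint (hc t ht)
  have hmem : (hi t ht).genericPoint ∈ t := hg.mem
  have hne : (hi t ht).genericPoint ≠ genericPoint X := fun e => by
    have : genericPoint X ∈ Wᶜ := by
      rw [he]
      exact ⟨t, ht, e ▸ hmem⟩
    exact this hξ
  rw [← hg.def, (isClosed_singleton_of_ne hne).closure_eq]
  exact Set.finite_singleton _

theorem exists_mem_vanishingAt {z : X} (hz : z ≠ genericPoint X) {U : X.affineOpens} (w : U.1)
    (hw : w.1 ≠ z) : ∃ s ∈ invertibleAt w, s ∈ vanishingAt z U := by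
  obtain ⟨W, t, hW, hwW, -, hWz⟩ := exists_affine_basicOpen U
    ⟨{z}ᶜ, (isClosed_singleton_of_ne hz).isOpen_compl⟩ w.2 hw
  rw [hW] at hwW hWz
  exact ⟨t, hwW, fun h => hWz h rfl⟩

theorem vanishingAt_res {z : X} (hz : z ≠ genericPoint X) {U V : X.affineOpens} (h : V ≤ U) :
    vanishingAt z V = (vanishingAt z U).map (resHom h) := by
  refine le_antisymm (fun r hr => ?_) (Ideal.map_le_iff_le_comap.2 fun r hr hzr => ?_)
  · let I : Ideal Γ(X, V.1) := Submodule.comap (LinearMap.toSpanSingleton _ _ r)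
      ((vanishingAt z U).map (resHom h))
    have hI : I = ⊤ := ideal_eq_top fun w => by
      by_cases hw : w.1 = z
      -- Functions are extended as sections of the bundle `O_X`; the trivial group serves only to
      -- apply the statement on bundles.
      · obtain ⟨s, p, hs, e⟩ := (OXGMod.isVB_unit (X := X)
          (G := PUnit.{1})).exists_smul_eq_res h w.2 r
        change resHom h s * r = resHom h p at e
        refine ⟨resHom h s, ?_, (mem_basicOpen_resHom h s w.2).2 hs⟩
        rw [Submodule.mem_comap, LinearMap.toSpanSingleton_apply, smul_eq_mul, e]
        refine Ideal.mem_map_of_mem _ fun hp => hr ?_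
        have h2 := (mem_basicOpen_resHom h p (hw ▸ w.2)).2 hp
        rw [← e] at h2
        exact (mem_basicOpen_mul.1 h2).2
      · obtain ⟨s, hs, hsz⟩ := exists_mem_vanishingAt hz ⟨w.1, h w.2⟩ hw
        refine ⟨resHom h s, ?_, (mem_basicOpen_resHom h s w.2).2 hs⟩
        rw [Submodule.mem_comap, LinearMap.toSpanSingleton_apply, smul_eq_mul]
        exact Ideal.mul_mem_right _ _ (Ideal.mem_map_of_mem _ hsz)
    have h1 : (1 : Γ(X, V.1)) ∈ I := hI ▸ Submodule.mem_top
    rwa [Submodule.mem_comap, LinearMap.toSpanSingleton_apply, one_smul] at h1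
  · exact hr ((mem_basicOpen_resHom h r (X.basicOpen_le _ hzr)).1 hzr)

end Points

namespace OXGMod

/-! #### Splitting a modification into modifications at single points -/

section Saturation

variable {X : Scheme.{u}} {G : Type v} [Group G] {R P : OXGMod X G}

/-- The sections of `P` that lie in the image of `R` away from `z`. -/
def satSections (f : Hom R P) (z : X) (U : X.affineOpens) : Submodule Γ(X, U.1) (P.sec U) where
  carrier := {p | ∃ n : ℕ, ∀ r ∈ vanishingAt z U ^ n, r • p ∈ LinearMap.range (f.app U)}
  zero_mem' := ⟨0, fun r _ => by rw [smul_zero]; exact zero_mem _⟩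
  add_mem' := by
    rintro a b ⟨n, hn⟩ ⟨m, hm⟩
    refine ⟨n + m, fun r hr => ?_⟩
    rw [smul_add]
    exact add_mem (hn r (Ideal.pow_le_pow_right (Nat.le_add_right _ _) hr))
      (hm r (Ideal.pow_le_pow_right (Nat.le_add_left _ _) hr))
  smul_mem' := by
    rintro a b ⟨n, hn⟩
    refine ⟨n, fun r hr => ?_⟩
    rw [smul_comm]
    exact Submodule.smul_mem _ _ (hn r hr)

theorem range_le_satSections (f : Hom R P) (z : X) (U : X.affineOpens) :
    LinearMap.range (f.app U) ≤ satSections f z U :=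
  fun _ hp => ⟨0, fun _ _ => Submodule.smul_mem _ _ hp⟩

theorem satSections_rho (f : Hom R P) {z : X} (U : X.affineOpens) (g : G) (p : P.sec U)
    (hp : p ∈ satSections f z U) : P.rho U g p ∈ satSections f z U := by
  obtain ⟨n, hn⟩ := hp
  refine ⟨n, fun r hr => ?_⟩
  obtain ⟨b, hb⟩ := hn r hr
  exact ⟨R.rho U g b, by rw [f.app_rho, hb, map_smul]⟩

variable [IsDedekindScheme X] {z : X}

theorem satSections_res (hz : z ≠ genericPoint X) (f : Hom R P) {U V : X.affineOpens} (h : V ≤ U)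
    (p : P.sec U)
    (hp : p ∈ satSections f z U) : P.res h p ∈ satSections f z V := by
  obtain ⟨n, hn⟩ := hp
  refine ⟨n, fun r hr => ?_⟩
  rw [vanishingAt_res hz h, ← Ideal.map_pow] at hr
  have : (vanishingAt z U ^ n).map (resHom h) ≤
      (LinearMap.range (f.app V)).comap (LinearMap.toSpanSingleton _ _ (P.res h p)) := by
    refine Ideal.map_le_iff_le_comap.2 fun r hr => ?_
    obtain ⟨b, hb⟩ := hn r hr
    exact ⟨R.res h b, by
      rw [f.app_res, hb, LinearMap.toSpanSingleton_apply, map_smulₛₗ]⟩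
  exact this hr

/-- The largest submodule of `P` that agrees with the image of `R` away from `z`. -/
def saturation (hz : z ≠ genericPoint X) (f : Hom R P) : OXGMod X G :=
  P.sub (satSections f z) (satSections_res hz f) (satSections_rho f)

/-- A section over `V` is first extended as a section of `P`. For each of finitely many generators
of the power of the ideal of `z`, the preimage in `R` is then extended as well, at the cost of
further denominators invertible at `w`. -/
theorem isCoherent_saturation (hz : z ≠ genericPoint X) (hR : R.IsVB) (hP : P.IsVB) (f : Hom R P) :
    (saturation hz f).IsCoherent := by
  refine isCoherent_sub hP.1 (satSections_res hz f) (satSections_rho f)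
    fun {U V} h q ⟨n, hn⟩ w hw => ?_
  obtain ⟨s, p, hs, e⟩ := hP.exists_smul_eq_res h hw q
  let w' : U.1 := ⟨w, h hw⟩
  have : Nonempty V.1 := nonempty_of_mem hw
  obtain ⟨t, ht, ht'⟩ := exists_smul_mem_of_finite (M := (vanishingAt z U ^ n : Ideal _))
    (invertibleAt w') (Submodule.comap
      (LinearMap.toSpanSingleton Γ(X, U.1) (P.sec U) p ∘ₗ Submodule.subtype _)
      (LinearMap.range (f.app U))) (by
    rintro ⟨r, hr⟩
    obtain ⟨b, hb⟩ := hn (resHom h r) (by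
      rw [vanishingAt_res hz h, ← Ideal.map_pow]
      exact Ideal.mem_map_of_mem _ hr)
    obtain ⟨t, b₀, ht, e'⟩ := hR.exists_smul_eq_res h hw b
    refine ⟨t, ht, s • b₀, hP.res_injective h ?_⟩
    have hb₀ : P.res h (f.app U b₀) = resHom h t • resHom h r • q := by
      rw [← f.app_res, ← e', map_smul, hb]
    rw [map_smul, map_smulₛₗ, hb₀]
    change _ = P.res h ((t * r) • p)
    rw [map_smulₛₗ, ← e, map_mul]
    simp only [smul_smul]
    congr 1
    ring)
  refine ⟨t * s, t • p, mul_mem ht hs, ⟨n, fun r hr => ?_⟩, ?_⟩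
  · have := ht' ⟨r, hr⟩
    rw [smul_smul, mul_comm]
    exact this
  · rw [map_smulₛₗ, ← e, map_mul, mul_smul]

/-- At a point other than `z` there is an invertible function vanishing at `z`, and a power of it
moves a given section of the saturation into `R`. -/
theorem isModification_saturation_left (hz : z ≠ genericPoint X) (hR : R.IsVB) (hP : P.IsVB)
    {f : Hom R P}
    (hf : ∀ U, Function.Injective (f.app U)) : IsModification {z}ᶜ R (saturation hz f) := by
  refine ⟨⟨fun U => (f.app U).codRestrict _ fun b => range_le_satSections f z U ⟨b, rfl⟩,
    fun h m => Subtype.ext (f.app_res h m), fun U x m => Subtype.ext (f.app_rho U x m)⟩,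
    fun U => ⟨fun a b hab => hf U (congrArg Subtype.val hab), fun w hw => ?_⟩⟩
  have := (isCoherent_saturation hz hR hP f).2 U
  refine exists_smul_mem_of_finite (M := (saturation hz f).sec U) _ _ ?_
  rintro ⟨p, n, hn⟩
  obtain ⟨s, hs, hsz⟩ := exists_mem_vanishingAt hz w hw
  obtain ⟨b, hb⟩ := hn (s ^ n) (Ideal.pow_mem_pow hsz n)
  exact ⟨s ^ n, pow_mem hs n, b, Subtype.ext hb⟩

/-- Write `(c) = m ^ n J` with `J` not contained in `m`, and take `s` in `J` outside `m`. -/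
theorem _root_.Ideal.exists_notMem_mul_pow_le {A : Type*} [CommRing A] [IsDedekindDomain A]
    {m : Ideal A} [hm : m.IsPrime] {c : A} (hc : c ≠ 0) :
    ∃ s ∉ m, ∃ n : ℕ, ∀ r ∈ m ^ n, ∃ a, s * r = a * c := by
  have hfin : FiniteMultiplicity m (Ideal.span {c}) :=
    FiniteMultiplicity.of_not_isUnit (fun h => hm.ne_top (Ideal.isUnit_iff.1 h))
      (by rwa [Ne, Ideal.zero_eq_bot, Ideal.span_singleton_eq_bot])
  obtain ⟨J, hJ, hmJ⟩ := hfin.exists_eq_pow_mul_and_not_dvd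
  rw [Ideal.dvd_iff_le] at hmJ
  obtain ⟨s, hs, hsm⟩ := SetLike.not_le_iff_exists.1 hmJ
  refine ⟨s, hsm, multiplicity m (Ideal.span {c}), fun r hr => ?_⟩
  have : s * r ∈ Ideal.span {c} := by
    rw [hJ, mul_comm s]
    exact Ideal.mul_mem_mul hr hs
  obtain ⟨a, ha⟩ := Ideal.mem_span_singleton'.1 this
  exact ⟨a, ha.symm⟩

/-- Some nonzero `c` satisfies `c P ⊆ R`. Near `z` the ideal `(c)` contains a power of the ideal of
`z`, up to a function `s` invertible at `z`; hence `s P` lies in the saturation. -/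
theorem isModification_saturation_right (hz : z ≠ genericPoint X) {W : Set X}
    (hξ : genericPoint X ∈ W) {f : Hom R P}
    (hf : ∀ U : X.affineOpens, Function.Injective (f.app U) ∧ ∀ w : U.1, w.1 ∈ W →
      ∃ s : Γ(X, U.1), s ∈ invertibleAt w ∧ ∀ a : P.sec U, s • a ∈ LinearMap.range (f.app U)) :
    IsModification (insert z W) (saturation hz f) P := by
  refine ⟨subι, fun U => ⟨Subtype.val_injective (p := (· ∈ satSections f z U)), fun w hw => ?_⟩⟩
  suffices ∃ s : Γ(X, U.1), s ∈ invertibleAt w ∧ ∀ p : P.sec U, s • p ∈ satSections f z U by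
    obtain ⟨s, hs, hs'⟩ := this
    exact ⟨s, hs, fun p => ⟨⟨s • p, hs' p⟩, rfl⟩⟩
  rcases hw with hw | hw
  · have : Nonempty U.1 := ⟨w⟩
    have := IsDedekindScheme.isDedekindDomain U
    obtain ⟨c, hc, hc'⟩ := (hf U).2 ⟨_, genericPoint_mem w.2⟩ hξ
    have h1 : vanishingAt z U = (U.2.primeIdealOf w).asIdeal := by
      rw [← hw, vanishingAt_eq]
    obtain ⟨s, hs, n, hn⟩ := Ideal.exists_notMem_mul_pow_le (m := (U.2.primeIdealOf w).asIdeal)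
      (ne_zero_of_mem_basicOpen hc)
    refine ⟨s, (mem_basicOpen_iff_notMem w s).2 hs, fun p => ⟨n, fun r hr => ?_⟩⟩
    rw [h1] at hr
    obtain ⟨a, ha⟩ := hn r hr
    rw [smul_smul, mul_comm, ha, mul_smul]
    exact Submodule.smul_mem _ _ (hc' p)
  · obtain ⟨s, hs, hs'⟩ := (hf U).2 w hw
    exact ⟨s, hs, fun p => range_le_satSections f z U (hs' p)⟩

end Saturation

/-! ### Factoring modifications into modifications at single points -/

section Decomposition

variable {X : Scheme.{u}} {G : Type v} [Group G]

theorem IsModification.iso {R P : OXGMod X G} (h : IsModification Set.univ R P) : Iso R P := by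
  obtain ⟨f, hf⟩ := h
  refine ⟨f, fun U => ⟨(hf U).1, fun p => mem_of_span_eq_top (S := {s : Γ(X, U.1) |
    ∀ a : P.sec U, s • a ∈ LinearMap.range (f.app U)}) (ideal_eq_top fun w => ?_)
    (LinearMap.range (f.app U)) p fun s hs => hs p⟩⟩
  obtain ⟨s, hs, hs'⟩ := (hf U).2 w trivial
  exact ⟨s, Ideal.subset_span hs', hs⟩

variable (X G) in
/-- The differences `[A] - [B]` for modifications `B → A` along the sets in `𝒲`. -/
def modificationDiff (𝒲 : Set (Set X)) : Set (K0Proj X G) :=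
  {x | ∃ W ∈ 𝒲, ∃ (A B : OXGMod X G) (hA : A.LocallyProjective) (hB : B.LocallyProjective),
    IsModification W B A ∧ x = K0.cls A hA - K0.cls B hB}

variable [IsDedekindScheme X]

variable (X) in
/-- The complements of the closed points. -/
def punctured : Set (Set X) := {W | ∃ z, z ≠ genericPoint X ∧ W = {z}ᶜ}

theorem IsModification.sub_mem_closure [Fintype G] {S : Set X}
    (hS : S.Finite) : genericPoint X ∉ S →
    ∀ {P R : OXGMod X G} (hP : P.LocallyProjective) (hR : R.LocallyProjective),
    IsModification Sᶜ R P →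
    (K0.cls P hP - K0.cls R hR : K0Proj X G) ∈
      AddSubgroup.closure (modificationDiff X G (punctured X)) := by
  induction S, hS using Set.Finite.induction_on with
  | empty =>
    intro _ P R hP hR h
    rw [Set.compl_empty] at h
    rw [cls_iso locallyProjective_zero h.iso hR hP, sub_self]
    exact zero_mem _
  | @insert z S hzS _ ih =>
    intro hξ P R hP hR h
    rw [Set.mem_insert_iff, not_or] at hξ
    obtain ⟨f, hf⟩ := h
    have hz := Ne.symm hξ.1
    have h1 := isModification_saturation_left hz hR.isVB hP.isVB fun U => (hf U).1
    have h2 := isModification_saturation_right hz (fun h => h.elim (Ne.symm hz) hξ.2) hf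
    -- The saturation agrees locally with `P` at `z` and with `R` everywhere else.
    have hQ : (saturation hz f).LocallyProjective :=
      .of_locEquivAt (isCoherent_saturation hz hR.isVB hP.isVB f) fun U w => by
        by_cases hw : w.1 = z
        · exact ⟨P, hP, h2.locEquivAt w (.inl hw)⟩
        · exact ⟨R, hR, (h1.locEquivAt w hw).symm⟩
    rw [← sub_add_sub_cancel _ (K0.cls _ hQ)]
    refine add_mem (ih hξ.2 hP hQ (h2.mono fun w hw => ?_))
      (AddSubgroup.subset_closure ⟨_, ⟨z, hz, rfl⟩, _, _, hQ, hR, h1, rfl⟩)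
    by_cases hwz : w = z
    · exact .inl hwz
    · exact .inr fun h => h.elim hwz hw

end Decomposition

end OXGMod

/-- Choose `c` in `I` outside `m I`. Then `(c) = I J` with `J` not contained in `m`, and any `s` in
`J` outside `m` gives `s I ⊆ (c)`. -/
theorem Ideal.exists_locally_principal {A : Type*} [CommRing A] [IsDedekindDomain A] {I : Ideal A}
    (hI : I ≠ ⊥) (m : Ideal A) [hm : m.IsPrime] :
    ∃ c ∈ I, c ≠ 0 ∧ ∃ s ∉ m, ∀ r ∈ I, ∃ a, s * r = a * c := by
  have hne : ¬ I ≤ m * I := fun h => by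
    have h1 : m * I = 1 * I := by rw [one_mul]; exact le_antisymm Ideal.mul_le_right h
    have h2 : m = 1 := mul_right_cancel₀ hI h1
    exact hm.ne_top (h2.trans Ideal.one_eq_top)
  obtain ⟨c, hc, hcm⟩ := SetLike.not_le_iff_exists.1 hne
  obtain ⟨J, hJ⟩ := Ideal.dvd_iff_le.2 ((Ideal.span_singleton_le_iff_mem I).2 hc)
  have hJm : ¬ J ≤ m := fun h => by
    refine hcm ?_
    rw [mul_comm]
    exact Ideal.mul_mono_right h (hJ ▸ Ideal.mem_span_singleton_self c)
  obtain ⟨s, hs, hsm⟩ := SetLike.not_le_iff_exists.1 hJm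
  refine ⟨c, hc, fun h => hcm (h ▸ zero_mem _), s, hsm, fun r hr => ?_⟩
  have : s * r ∈ Ideal.span {c} := by
    rw [hJ, mul_comm s]
    exact Ideal.mul_mem_mul hr hs
  obtain ⟨a, ha⟩ := Ideal.mem_span_singleton'.1 this
  exact ⟨a, ha.symm⟩

theorem isUnit_resHom {X : Scheme.{u}} {U V : X.affineOpens} (h : V ≤ U) {s : Γ(X, U.1)}
    (hV : V.1 ≤ X.basicOpen s) : IsUnit (resHom h s) := by
  rw [← Ideal.span_singleton_eq_top]
  exact ideal_eq_top fun w => ⟨_, Ideal.mem_span_singleton_self _,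
    (mem_basicOpen_resHom h s w.2).2 (hV w.2)⟩

namespace OXGMod

/-! #### Moving a modification away from a point -/

section Extend

variable {X : Scheme.{u}} {G : Type v} [Group G] {P Q N : OXGMod X G} {U₀ : X.affineOpens}

/-- The extension of a linear map between sections over `U₀` to the affine open subsets of `U₀`. -/
def extend (hQ : Q.IsCoherent) (h : Q.sec U₀ →ₗ[Γ(X, U₀.1)] P.sec U₀) (V : X.affineOpens)
    (hV : V ≤ U₀) : Q.sec V →ₗ[Γ(X, V.1)] P.sec V :=
  (hQ.isBC hV).lift ((P.res hV).comp h)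

variable (hQ : Q.IsCoherent) (h : Q.sec U₀ →ₗ[Γ(X, U₀.1)] P.sec U₀)

theorem extend_res {V : X.affineOpens} (hV : V ≤ U₀) (m : Q.sec U₀) :
    extend hQ h V hV (Q.res hV m) = P.res hV (h m) :=
  (hQ.isBC hV).lift_apply _ m

/-- The local extensions are compatible, so they form a homomorphism on `U₀`. Over a general `V` it
is only a rational homomorphism, encoded by its graph on the affine opens inside `V` and `U₀`. -/
theorem extend_res_res {V W : X.affineOpens} (hV : V ≤ U₀) (hW : W ≤ V) (m : Q.sec V) :
    extend hQ h W (hW.trans hV) (Q.res hW m) = P.res hW (extend hQ h V hV m) := by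
  have e : (extend hQ h W (hW.trans hV)).comp (Q.res hW) =
      (P.res hW).comp (extend hQ h V hV) := by
    refine LinearMap.ext_on (hQ.isBC hV).span_range ?_
    rintro _ ⟨m, rfl⟩
    rw [LinearMap.comp_apply, LinearMap.comp_apply, ← Q.res_comp, extend_res, extend_res,
      P.res_comp]
  exact LinearMap.congr_fun e m

theorem extend_rho (hρ : ∀ g m, h (Q.rho U₀ g m) = P.rho U₀ g (h m)) {V : X.affineOpens}
    (hV : V ≤ U₀) (g : G) (m : Q.sec V) :
    extend hQ h V hV (Q.rho V g m) = P.rho V g (extend hQ h V hV m) := by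
  have e : extend hQ h V hV ∘ₗ Q.rho V g = P.rho V g ∘ₗ extend hQ h V hV :=
    (hQ.isBC hV).hom_ext fun m => by
      rw [LinearMap.comp_apply, LinearMap.comp_apply, ← Q.rho_res, extend_res, extend_res, hρ,
        P.rho_res]
  exact LinearMap.congr_fun e m

theorem extend_extend {h} {hP : P.IsCoherent} {k : P.sec U₀ →ₗ[Γ(X, U₀.1)] Q.sec U₀}
    {s : Γ(X, U₀.1)} (hk : ∀ m, k (h m) = s • m) {V : X.affineOpens} (hV : V ≤ U₀) (m : Q.sec V) :
    extend hP k V hV (extend hQ h V hV m) = resHom hV s • m := by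
  have e : extend hP k V hV ∘ₗ extend hQ h V hV = resHom hV s • LinearMap.id :=
    (hQ.isBC hV).hom_ext fun m => by
      rw [LinearMap.comp_apply, extend_res, extend_res, hk, map_smulₛₗ]
      rfl
  exact LinearMap.congr_fun e m

/-- The graph of the rational homomorphism defined by `h`. -/
def graph (V : X.affineOpens) : Submodule Γ(X, V.1) (Q.sec V × P.sec V) where
  carrier := {m | ∀ (W : X.affineOpens) (hW : W ≤ V) (hW₀ : W ≤ U₀),
    extend hQ h W hW₀ (Q.res hW m.1) = P.res hW m.2}
  zero_mem' W hW hW₀ := by simp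
  add_mem' {a b} ha hb W hW hW₀ := by
    rw [Prod.fst_add, Prod.snd_add, map_add, map_add, map_add, ha W hW hW₀, hb W hW hW₀]
  smul_mem' r a ha W hW hW₀ := by
    rw [Prod.smul_fst, Prod.smul_snd, map_smulₛₗ (Q.res hW), map_smulₛₗ (P.res hW), map_smul,
      ha W hW hW₀]

theorem mem_graph_res {U V : X.affineOpens} (hV : V ≤ U) {q : Q.sec U} {p : P.sec U}
    (hm : (q, p) ∈ graph hQ h U) : (Q.res hV q, P.res hV p) ∈ graph hQ h V := fun W hW hW₀ => by
  have := hm W (hW.trans hV) hW₀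
  rwa [Q.res_comp hV hW, P.res_comp hV hW] at this

theorem mem_graph_rho (hρ : ∀ g m, h (Q.rho U₀ g m) = P.rho U₀ g (h m)) {U : X.affineOpens} (g : G)
    {q : Q.sec U} {p : P.sec U} (hm : (q, p) ∈ graph hQ h U) :
    (Q.rho U g q, P.rho U g p) ∈ graph hQ h U := fun W hW hW₀ => by
  have := hm W hW hW₀
  rw [Q.rho_res, P.rho_res, extend_rho hQ h hρ, this]

theorem mem_graph_extend {V : X.affineOpens} (hV : V ≤ U₀) (q : Q.sec V) :
    (q, extend hQ h V hV q) ∈ graph hQ h V := fun _ hW _ => extend_res_res hQ h hV hW q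

/-- The functions `r` such that the rational homomorphism is defined on `r Q`. -/
def conductor (V : X.affineOpens) : Ideal Γ(X, V.1) where
  carrier := {r | ∀ q : Q.sec V, r • q ∈ (graph hQ h V).map (LinearMap.fst _ _ _)}
  zero_mem' q := by rw [zero_smul]; exact zero_mem _
  add_mem' ha hb q := by rw [add_smul]; exact add_mem (ha q) (hb q)
  smul_mem' r a ha q := by
    rw [smul_eq_mul, mul_smul]
    exact Submodule.smul_mem _ _ (ha q)

theorem mem_conductor {V : X.affineOpens} {r : Γ(X, V.1)} :
    r ∈ conductor hQ h V ↔ ∀ q : Q.sec V, ∃ p, (r • q, p) ∈ graph hQ h V := by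
  refine forall_congr' fun q => ⟨?_, fun ⟨p, hp⟩ => ⟨_, hp, rfl⟩⟩
  rintro ⟨⟨_, p⟩, hp, rfl⟩
  exact ⟨p, hp⟩

theorem conductor_res {U V : X.affineOpens} (hV : V ≤ U) {r : Γ(X, U.1)}
    (hr : r ∈ conductor hQ h U) : resHom hV r ∈ conductor hQ h V := fun q => by
  have : Submodule.span _ (Set.range (Q.res hV)) ≤
      ((graph hQ h V).map (LinearMap.fst _ _ _)).comap
        (LinearMap.lsmul _ (Q.sec V) (resHom hV r)) := by
    refine Submodule.span_le.2 ?_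
    rintro _ ⟨q, rfl⟩
    obtain ⟨p, hp⟩ := (mem_conductor hQ h).1 hr q
    refine ⟨_, mem_graph_res hQ h hV hp, ?_⟩
    exact map_smulₛₗ (Q.res hV) r q
  exact this ((hQ.isBC hV).span_range ▸ Submodule.mem_top)

/-- The graph of the restriction of the rational homomorphism to the product of `Q` and the
conductor. -/
def movedSections (V : X.affineOpens) : Submodule Γ(X, V.1) (Q.sec V × P.sec V) :=
  (conductor hQ h V • (⊤ : Submodule Γ(X, V.1) (Q.sec V))).comap
      (LinearMap.fst _ _ _) ⊓ graph hQ h V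

theorem conductor_smul_res {U V : X.affineOpens} (hV : V ≤ U) {q : Q.sec U}
    (hq : q ∈ conductor hQ h U • (⊤ : Submodule Γ(X, U.1) (Q.sec U))) :
    Q.res hV q ∈ conductor hQ h V • (⊤ : Submodule Γ(X, V.1) (Q.sec V)) := by
  induction hq using Submodule.smul_induction_on' with
  | smul r hr q hq =>
    rw [map_smulₛₗ]
    exact Submodule.smul_mem_smul (conductor_res hQ h hV hr) trivial
  | add a _ b _ ha hb =>
    rw [map_add]
    exact add_mem ha hb

theorem conductor_smul_rho {U : X.affineOpens} (g : G) {q : Q.sec U}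
    (hq : q ∈ conductor hQ h U • (⊤ : Submodule Γ(X, U.1) (Q.sec U))) :
    Q.rho U g q ∈ conductor hQ h U • (⊤ : Submodule Γ(X, U.1) (Q.sec U)) := by
  induction hq using Submodule.smul_induction_on' with
  | smul r hr q hq =>
    rw [map_smul]
    exact Submodule.smul_mem_smul hr trivial
  | add a _ b _ ha hb =>
    rw [map_add]
    exact add_mem ha hb

theorem movedSections_res {U V : X.affineOpens} (hV : V ≤ U) (m : (Q.prod P).sec U)
    (hm : m ∈ movedSections hQ h U) : (Q.prod P).res hV m ∈ movedSections hQ h V :=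
  ⟨conductor_smul_res hQ h hV hm.1, mem_graph_res hQ h hV hm.2⟩

variable (hρ : ∀ g m, h (Q.rho U₀ g m) = P.rho U₀ g (h m))

include hρ in
theorem movedSections_rho (U : X.affineOpens) (g : G) (m : (Q.prod P).sec U)
    (hm : m ∈ movedSections hQ h U) : (Q.prod P).rho U g m ∈ movedSections hQ h U :=
  ⟨conductor_smul_rho hQ h g hm.1, mem_graph_rho hQ h hρ g hm.2⟩

/-- The product of `Q` and the conductor of the rational homomorphism. -/
def moved : OXGMod X G :=
  (Q.prod P).sub (movedSections hQ h) (movedSections_res hQ h) (movedSections_rho hQ h hρ)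

end Extend

section Moving

variable {X : Scheme.{u}} [IsIntegral X] {G : Type v} [Group G] {P Q : OXGMod X G}
  {U₀ : X.affineOpens} (hQ : Q.IsVB) (hP : P.IsVB) (h : Q.sec U₀ →ₗ[Γ(X, U₀.1)] P.sec U₀)

include hP

/-- On an integral scheme any two nonempty opens meet and restriction is injective on bundles, so
one nonempty affine open decides membership in the graph. -/
theorem mem_graph_of_extend_eq {V W : X.affineOpens} [hne : Nonempty W.1] {q : Q.sec V}
    {p : P.sec V} (hW : W ≤ V) (hW₀ : W ≤ U₀)
    (e : extend hQ.1 h W hW₀ (Q.res hW q) = P.res hW p) : (q, p) ∈ graph hQ.1 h V := by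
  intro W' hW' hW₀'
  rcases isEmpty_or_nonempty W'.1 with hemp | ⟨y, hy⟩
  · have := P.subsingleton_of_isEmpty hemp
    exact Subsingleton.elim _ _
  · obtain ⟨x, hx⟩ := hne
    obtain ⟨T, -, -, hT, hTW, hTW'⟩ := exists_affine_basicOpen W W'.1 (genericPoint_mem hx)
      (genericPoint_mem hy)
    have := nonempty_of_mem hT
    have hTW' : T ≤ W' := hTW'
    apply hP.res_injective hTW'
    rw [← extend_res_res, ← P.res_comp, ← Q.res_comp]
    have := congrArg (P.res hTW) e
    rwa [← extend_res_res, ← P.res_comp, ← Q.res_comp] at this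

theorem mem_graph_of_res [Nonempty U₀.1] {U V : X.affineOpens} [hne : Nonempty V.1] (hV : V ≤ U)
    {q : Q.sec U} {p : P.sec U} (hm : (Q.res hV q, P.res hV p) ∈ graph hQ.1 h V) :
    (q, p) ∈ graph hQ.1 h U := by
  obtain ⟨x, hx⟩ := hne
  obtain ⟨y, hy⟩ := (inferInstance : Nonempty U₀.1)
  obtain ⟨T, -, -, hT, hTV, hTU⟩ := exists_affine_basicOpen V U₀.1 (genericPoint_mem hx)
    (genericPoint_mem hy)
  have := nonempty_of_mem hT
  have e := hm T hTV hTU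
  rw [← P.res_comp, ← Q.res_comp] at e
  exact mem_graph_of_extend_eq hQ hP h (hTV.trans hV) hTU e

theorem eq_zero_of_mem_graph_right [Nonempty U₀.1] {U : X.affineOpens} {p : P.sec U}
    (hm : (0, p) ∈ graph hQ.1 h U) : p = 0 := by
  obtain ⟨y, hy⟩ := (inferInstance : Nonempty U₀.1)
  rcases isEmpty_or_nonempty U.1 with hemp | ⟨x, hx⟩
  · have := P.subsingleton_of_isEmpty hemp
    exact Subsingleton.elim _ _
  obtain ⟨T, -, -, hT, hTV, hTU⟩ := exists_affine_basicOpen U U₀.1 (genericPoint_mem hx)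
    (genericPoint_mem hy)
  have := nonempty_of_mem hT
  have e := hm T hTV hTU
  rw [map_zero, map_zero] at e
  exact hP.res_injective hTV (e.symm.trans (map_zero _).symm)

theorem eq_zero_of_mem_graph_left [Nonempty U₀.1] {k : P.sec U₀ →ₗ[Γ(X, U₀.1)] Q.sec U₀}
    {s : Γ(X, U₀.1)} (hs : s ≠ 0) (hk : ∀ m, k (h m) = s • m) {U : X.affineOpens} {q : Q.sec U}
    (hm : (q, 0) ∈ graph hQ.1 h U) : q = 0 := by
  obtain ⟨y, hy⟩ := (inferInstance : Nonempty U₀.1)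
  rcases isEmpty_or_nonempty U.1 with hemp | ⟨x, hx⟩
  · have := Q.subsingleton_of_isEmpty hemp
    exact Subsingleton.elim _ _
  obtain ⟨T, -, -, hT, hTV, hTU⟩ := exists_affine_basicOpen U U₀.1 (genericPoint_mem hx)
    (genericPoint_mem hy)
  have := nonempty_of_mem hT
  have hTU : T ≤ U₀ := hTU
  have e := congrArg (extend hP.1 k T hTU) (hm T hTV hTU)
  rw [map_zero, map_zero, extend_extend (hP := hP.1) hQ.1 hk hTU] at e
  exact hQ.res_injective hTV ((hQ.smul_eq_zero (fun h0 => hs (resHom_injective hTU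
    (h0.trans (map_zero _).symm))) e).trans (map_zero _).symm)

/-- On `U₀` the homomorphism is defined everywhere, and its values on the finitely many generators
of `Q(U)` extend to `U` after multiplication by one function invertible at `w`. -/
theorem exists_mem_conductor {U : X.affineOpens} (w : U.1) (hw : w.1 ∈ U₀.1) :
    ∃ t ∈ invertibleAt w, t ∈ conductor hQ.1 h U := by
  obtain ⟨T, -, -, hT, hTU, hTU₀⟩ := exists_affine_basicOpen U U₀.1 w.2 hw
  have hTU₀ : T ≤ U₀ := hTU₀
  have := nonempty_of_mem hT
  have : Nonempty U₀.1 := ⟨⟨_, hw⟩⟩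
  have := hQ.1.2 U
  refine exists_smul_mem_of_finite (invertibleAt w) ((graph hQ.1 h U).map (LinearMap.fst _ _ _))
    fun q => ?_
  obtain ⟨t, p, ht, e⟩ := hP.exists_smul_eq_res hTU hT (extend hQ.1 h T hTU₀ (Q.res hTU q))
  refine ⟨t, ht, (t • q, p), mem_graph_of_res hQ hP h hTU ?_, rfl⟩
  rw [← e, map_smulₛₗ]
  exact Submodule.smul_mem _ (resHom hTU t) (mem_graph_extend hQ.1 h hTU₀ (Q.res hTU q))

/-- Denominators over `V` come from denominators over `U`, up to functions invertible at `w`. This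
gives the quasi-coherence of the product of the conductor with `Q`. -/
theorem exists_conductor_res [Nonempty U₀.1] {U V : X.affineOpens} (hV : V ≤ U) (w : V.1)
    {r : Γ(X, V.1)} (hr : r ∈ conductor hQ.1 h V) :
    ∃ (t r₀ : Γ(X, U.1)), w.1 ∈ X.basicOpen t ∧ r₀ ∈ conductor hQ.1 h U ∧
      resHom hV t * r = resHom hV r₀ := by
  obtain ⟨s, (r₁ : Γ(X, U.1)), hs, e⟩ := (isVB_unit (X := X)
      (G := PUnit.{1})).exists_smul_eq_res hV w.2 r
  change resHom hV s * r = resHom hV r₁ at e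
  let w' : U.1 := ⟨w.1, hV w.2⟩
  have : Nonempty V.1 := ⟨w⟩
  have := hQ.1.2 U
  obtain ⟨t, ht, ht'⟩ := exists_smul_mem_of_finite (invertibleAt w')
    (((graph hQ.1 h U).map (LinearMap.fst _ _ _)).comap (LinearMap.lsmul _ (Q.sec U) r₁))
    fun q => by
      obtain ⟨p, hp⟩ := (mem_conductor hQ.1 h).1 hr (Q.res hV q)
      obtain ⟨t, p₀, ht, e'⟩ := hP.exists_smul_eq_res hV w.2 p
      refine ⟨t, ht, (r₁ • t • q, s • p₀), mem_graph_of_res hQ hP h hV ?_, rfl⟩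
      have := Submodule.smul_mem _ (resHom hV t * resHom hV s) hp
      convert! this using 2
      · change _ = (resHom hV t * resHom hV s) • r • Q.res hV q
        rw [map_smulₛₗ, map_smulₛₗ, ← e, smul_smul, smul_smul]
        congr 1
        ring
      · change _ = (resHom hV t * resHom hV s) • p
        rw [map_smulₛₗ, ← e', smul_smul, mul_comm]
  refine ⟨t * s, t * r₁, mul_mem ht hs, fun q => ?_, ?_⟩
  · have := ht' q
    rw [Submodule.mem_comap, LinearMap.lsmul_apply, smul_smul] at this
    rwa [mul_comm]
  · rw [map_mul, map_mul, ← e, mul_assoc]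

theorem exists_conductor_smul_res [Nonempty U₀.1] {U V : X.affineOpens} (hV : V ≤ U) (w : V.1)
    {q : Q.sec V} (hq : q ∈ conductor hQ.1 h V • (⊤ : Submodule Γ(X, V.1) (Q.sec V))) :
    ∃ (t : Γ(X, U.1)) (q₀ : Q.sec U), w.1 ∈ X.basicOpen t ∧
      q₀ ∈ conductor hQ.1 h U • (⊤ : Submodule Γ(X, U.1) (Q.sec U)) ∧
      resHom hV t • q = Q.res hV q₀ := by
  induction hq using Submodule.smul_induction_on' with
  | smul r hr q _ =>
    obtain ⟨t, r₀, ht, hr₀, e⟩ := exists_conductor_res hQ hP h hV w hr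
    obtain ⟨s, q₀, hs, e'⟩ := hQ.exists_smul_eq_res hV w.2 q
    refine ⟨t * s, r₀ • q₀, mem_basicOpen_mul.2 ⟨ht, hs⟩, Submodule.smul_mem_smul hr₀ trivial, ?_⟩
    rw [map_smulₛₗ, ← e', ← e, map_mul, smul_smul, smul_smul]
    congr 1
    ring
  | add a _ b _ ha hb =>
    obtain ⟨s, a₀, hs, ha₀, ea⟩ := ha
    obtain ⟨t, b₀, ht, hb₀, eb⟩ := hb
    refine ⟨s * t, t • a₀ + s • b₀, mem_basicOpen_mul.2 ⟨hs, ht⟩,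
      add_mem (Submodule.smul_mem _ _ ha₀) (Submodule.smul_mem _ _ hb₀), ?_⟩
    rw [map_add, map_smulₛₗ, map_smulₛₗ, ← ea, ← eb, smul_add, map_mul, smul_smul, smul_smul,
      mul_comm (resHom hV t)]

variable (hρ : ∀ g m, h (Q.rho U₀ g m) = P.rho U₀ g (h m))

theorem isCoherent_moved [IsLocallyNoetherian X] [Nonempty U₀.1] :
    (moved hQ.1 h hρ).IsCoherent := by
  refine isCoherent_sub (hQ.prod hP).1 (movedSections_res hQ.1 h)
    (movedSections_rho hQ.1 h hρ) fun {U V} hV m hm w hw => ?_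
  have : Nonempty V.1 := nonempty_of_mem hw
  obtain ⟨s, m₀, hs, e⟩ := (hQ.prod hP).exists_smul_eq_res hV hw m
  obtain ⟨t, q₀, ht, hq₀, e'⟩ := exists_conductor_smul_res hQ hP h hV ⟨w, hw⟩ hm.1
  have e1 : resHom hV s • m.1 = Q.res hV m₀.1 := congrArg Prod.fst e
  have e2 : resHom hV s • m.2 = P.res hV m₀.2 := congrArg Prod.snd e
  have e3 : t • m₀.1 = s • q₀ := by
    apply hQ.res_injective hV
    rw [map_smulₛₗ, map_smulₛₗ, ← e1, ← e', smul_comm]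
    rfl
  refine ⟨t * s, t • m₀, mem_basicOpen_mul.2 ⟨ht, hs⟩, ⟨?_, ?_⟩, ?_⟩
  · change t • m₀.1 ∈ conductor hQ.1 h U • (⊤ : Submodule Γ(X, U.1) (Q.sec U))
    rw [e3]
    exact Submodule.smul_mem _ _ hq₀
  · refine Submodule.smul_mem _ t (mem_graph_of_res hQ hP h hV ?_)
    rw [← e1, ← e2]
    exact Submodule.smul_mem _ (resHom hV s) hm.2
  · rw [map_smulₛₗ, ← e, map_mul, mul_smul]

theorem isModification_moved_left {W : Set X} (hW : W ⊆ U₀.1) [Nonempty U₀.1] :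
    IsModification W (moved hQ.1 h hρ) Q := by
  refine ⟨⟨fun U => LinearMap.fst _ _ _ ∘ₗ (movedSections hQ.1 h U).subtype, fun _ _ => rfl,
    fun _ _ _ => rfl⟩, fun U => ⟨?_, fun w hw => ?_⟩⟩
  · rw [injective_iff_map_eq_zero]
    rintro ⟨⟨q, p⟩, hm⟩ (rfl : q = 0)
    obtain rfl := eq_zero_of_mem_graph_right hQ hP h hm.2
    rfl
  · obtain ⟨t, ht, ht'⟩ := exists_mem_conductor hQ hP h w (hW hw)
    refine ⟨t, ht, fun q => ?_⟩
    obtain ⟨p, hp⟩ := (mem_conductor hQ.1 h).1 ht' q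
    exact ⟨⟨(t • q, p), Submodule.smul_mem_smul ht' trivial, hp⟩, rfl⟩

theorem isModification_moved_right {k : P.sec U₀ →ₗ[Γ(X, U₀.1)] Q.sec U₀} {s : Γ(X, U₀.1)}
    (hs : s ≠ 0) (hk : ∀ m, k (h m) = s • m) (hk' : ∀ m, h (k m) = s • m) [Nonempty U₀.1] :
    IsModification (X.basicOpen s) (moved hQ.1 h hρ) P := by
  refine ⟨⟨fun U => LinearMap.snd _ _ _ ∘ₗ (movedSections hQ.1 h U).subtype, fun _ _ => rfl,
    fun _ _ _ => rfl⟩, fun U => ⟨?_, fun w hw => ?_⟩⟩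
  · rw [injective_iff_map_eq_zero]
    rintro ⟨⟨q, p⟩, hm⟩ (rfl : p = 0)
    obtain rfl := eq_zero_of_mem_graph_left hQ hP h hs hk hm.2
    rfl
  · have := hP.1.2 U
    refine exists_smul_mem_of_finite (invertibleAt w) _ fun p => ?_
    obtain ⟨T, -, -, hT, hTU, hTs⟩ := exists_affine_basicOpen U (X.basicOpen s) w.2 hw
    have := nonempty_of_mem hT
    have hTU₀ : T ≤ U₀ := hTs.trans (X.basicOpen_le s)
    obtain ⟨a, ha⟩ := isUnit_resHom hTU₀ hTs
    -- On `D(s)` the inverse of the homomorphism is `s⁻¹ k`; the preimage of `p` is extended to `U`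
    -- after multiplication by `t`, and `c` then moves it into the conductor times `Q`.
    obtain ⟨t, q, ht, e⟩ := hQ.exists_smul_eq_res hTU hT
      ((a⁻¹ : Γ(X, T.1)ˣ) • extend hP.1 k T hTU₀ (P.res hTU p))
    obtain ⟨c, hc, hc'⟩ := exists_mem_conductor hQ hP h w (X.basicOpen_le s hw)
    have hm : (q, t • p) ∈ graph hQ.1 h U := by
      refine mem_graph_of_extend_eq hQ hP h hTU hTU₀ ?_
      rw [← e, map_smul, Units.smul_def, map_smul, extend_extend (hP := hQ.1) hP.1 hk' hTU₀, ← ha,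
        ← Units.smul_def, ← Units.smul_def, inv_smul_smul, map_smulₛₗ]
    refine ⟨c * t, mul_mem hc ht, ⟨c • (q, t • p), Submodule.smul_mem_smul hc' trivial,
      Submodule.smul_mem _ _ hm⟩, ?_⟩
    exact (mul_smul c t p).symm

end Moving

/-! ### Common modifications on Dedekind schemes -/

section MovingDedekind

variable {X : Scheme.{u}} [IsDedekindScheme X] {G : Type v} [Group G] {P Q : OXGMod X G}
  {U₀ : X.affineOpens}

/-- The moved module is the conductor times `Q`. Over a Dedekind domain the nonzero conductor is
locally generated by one function `c`, and multiplication by `c` identifies `Q` with it locally. In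
particular it inherits local projectivity. -/
theorem locEquiv_moved (hQ : Q.IsVB) (hP : P.IsVB) (h : Q.sec U₀ →ₗ[Γ(X, U₀.1)] P.sec U₀)
    (hρ : ∀ g m, h (Q.rho U₀ g m) = P.rho U₀ g (h m)) [Nonempty U₀.1] :
    LocEquiv (moved hQ.1 h hρ) Q := by
  intro U w
  have : Nonempty U.1 := ⟨w⟩
  have := IsDedekindScheme.isDedekindDomain U
  obtain ⟨y, hy⟩ := (inferInstance : Nonempty U₀.1)
  obtain ⟨t, ht, ht'⟩ := exists_mem_conductor hQ hP h ⟨_, genericPoint_mem w.2⟩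
      (genericPoint_mem hy)
  have hne : conductor hQ.1 h U ≠ ⊥ := fun e => by
    rw [e, Submodule.mem_bot] at ht'
    exact ne_zero_of_mem_basicOpen ht ht'
  obtain ⟨c, hc, hc0, s, hs, hs'⟩ :=
    Ideal.exists_locally_principal hne (U.2.primeIdealOf w).asIdeal
  refine LocEquivAt.of_range (fun g => Q.rho U g)
    (f := LinearMap.fst _ _ _ ∘ₗ (movedSections hQ.1 h U).subtype) (g := c • LinearMap.id)
    ?_ (fun a b hab => hQ.smul_cancel hc0 hab) (fun _ _ => rfl)
    (fun g q => ((Q.rho U g).map_smul c q).symm) ((mem_basicOpen_iff_notMem w s).2 hs) ?_ ?_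
  · rw [injective_iff_map_eq_zero]
    rintro ⟨⟨q, p⟩, hm⟩ (rfl : q = 0)
    obtain rfl := eq_zero_of_mem_graph_right hQ hP h hm.2
    rfl
  · rintro ⟨⟨q, p⟩, hq, hp⟩
    change q ∈ conductor hQ.1 h U • (⊤ : Submodule Γ(X, U.1) (Q.sec U)) at hq
    change s • q ∈ LinearMap.range (c • LinearMap.id : Q.sec U →ₗ[Γ(X, U.1)] Q.sec U)
    clear hp
    induction hq using Submodule.smul_induction_on' with
    | smul r hr q _ =>
      obtain ⟨a, ha⟩ := hs' r hr
      exact ⟨a • q, by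
        rw [smul_smul, ha, mul_comm, mul_smul]
        rfl⟩
    | add a _ b _ ha hb =>
      rw [smul_add]
      exact add_mem ha hb
  · intro q
    obtain ⟨p, hp⟩ := (mem_conductor hQ.1 h).1 hc q
    exact Submodule.smul_mem _ s ⟨⟨(c • q, p), Submodule.smul_mem_smul hc trivial, hp⟩, rfl⟩

/-- Locally isomorphic modules have a common modification that is trivial at a given point. -/
theorem LocEquiv.exists_modification [Fintype G] (hQ : Q.LocallyProjective)
    (hP : P.LocallyProjective) (h : LocEquiv Q P) (z : X) :
    ∃ (W : Set X) (R : OXGMod X G), IsOpen W ∧ z ∈ W ∧ R.LocallyProjective ∧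
      IsModification W R Q ∧ IsModification W R P := by
  obtain ⟨_, ⟨U, hU, rfl⟩, hz, -⟩ := X.isBasis_affineOpens.exists_subset_of_mem_open
    (Set.mem_univ z) isOpen_univ
  let U₀ : X.affineOpens := ⟨U, hU⟩
  have : Nonempty U₀.1 := ⟨⟨z, hz⟩⟩
  obtain ⟨f, k, s, hs, h1, h2, h3, -⟩ := h U₀ ⟨z, hz⟩
  have hQ' := hQ.isVB
  have hP' := hP.isVB
  exact ⟨X.basicOpen s, moved hQ'.1 f h3, (X.basicOpen s).2, hs,
    .of_locEquivAt (isCoherent_moved hQ' hP' f h3) fun V w =>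
        ⟨Q, hQ, locEquiv_moved hQ' hP' f h3 V w⟩,
    isModification_moved_left hQ' hP' f h3 (X.basicOpen_le s),
    isModification_moved_right hQ' hP' f h3 (ne_zero_of_mem_basicOpen hs) h1 h2⟩

end MovingDedekind

end OXGMod

namespace OXGMod

open PowerSeries

/-! #### Symmetric power operations modulo an ideal -/

section Congruence

variable {X : Scheme.{u}} {G : Type v} [Group G] [Fintype G] [IsLocallyNoetherian X]

/-- The elements of `K_0(O_XG)` whose symmetric powers of positive degree lie in `K`. -/
def sigmaKer (K : Ideal (SymRing X G)) : AddSubgroup (K0Proj X G) where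
  carrier := {x | PowerSeries.map (Ideal.Quotient.mk K) (sigma x) = 1}
  zero_mem' := by rw [Set.mem_ofPred_eq, sigma_zero, map_one]
  add_mem' {x y} hx hy := by
    rw [Set.mem_ofPred_eq] at hx hy ⊢
    rw [sigma_add, map_mul, hx, hy, mul_one]
  neg_mem' {x} hx := by
    rw [Set.mem_ofPred_eq] at hx ⊢
    have := congrArg (PowerSeries.map (Ideal.Quotient.mk K)) (sigma_neg_mul x)
    rwa [map_mul, hx, mul_one, map_one] at this

theorem mem_sigmaKer {K : Ideal (SymRing X G)} {x : K0Proj X G} :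
    x ∈ sigmaKer K ↔ PowerSeries.map (Ideal.Quotient.mk K) (sigma x) = 1 := Iff.rfl

theorem coeff_sigma_sub_one_mem {K : Ideal (SymRing X G)} {x : K0Proj X G} (hx : x ∈ sigmaKer K)
    (n : ℕ) : coeff n (sigma x - 1) ∈ K := by
  have : PowerSeries.map (Ideal.Quotient.mk K) (sigma x - 1) = 0 := by
    rw [map_sub, mem_sigmaKer.1 hx, map_one, sub_self]
  rw [← Ideal.Quotient.eq_zero_iff_mem, ← PowerSeries.coeff_map, this, map_zero]

/-- The two power series agree modulo `K` and are units, so their quotient, the series of the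
difference, is `1` modulo `K`. -/
theorem sub_mem_sigmaKer {K : Ideal (SymRing X G)} {P Q : OXGMod X G} (hP : P.LocallyProjective)
    (hQ : Q.LocallyProjective) (h : ∀ n, SymRing.cls n (P.sym n) (hP.memSym_sym n) -
      SymRing.cls n (Q.sym n) (hQ.memSym_sym n) ∈ K) :
    (K0.cls P hP - K0.cls Q hQ : K0Proj X G) ∈ sigmaKer K := by
  have h1 : PowerSeries.map (Ideal.Quotient.mk K) (sigma (K0.cls P hP)) =
      PowerSeries.map (Ideal.Quotient.mk K) (sigma (K0.cls Q hQ)) := by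
    ext n
    rw [PowerSeries.coeff_map, PowerSeries.coeff_map, sigma_cls, sigma_cls, coeff_symSeries,
      coeff_symSeries]
    exact Ideal.Quotient.eq.2 (h n)
  have h2 : IsUnit (PowerSeries.map (Ideal.Quotient.mk K) (sigma (K0.cls Q hQ))) :=
    (IsUnit.of_mul_eq_one_right _ (sigma_neg_mul _)).map _
  rw [mem_sigmaKer]
  refine h2.mul_right_cancel ?_
  rw [one_mul, ← map_mul, ← sigma_add, sub_add_cancel, h1]

end Congruence

/-! ### Symmetric powers and local isomorphism -/

section LocEquiv

variable {X : Scheme.{u}} {G : Type v} [Group G] [Fintype G] [IsLocallyNoetherian X]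

variable (X G) in
/-- The ideal generated by the differences of locally isomorphic modules. -/
def locEquivIdeal : Ideal (SymRing X G) :=
  Ideal.span {x | ∃ (n : ℕ) (A B : OXGMod X G) (hA : MemSym n A) (hB : MemSym n B),
    LocEquiv A B ∧ x = SymRing.cls n A hA - SymRing.cls n B hB}

theorem LocEquiv.sub_mem_sigmaKer {P Q : OXGMod X G} (hP : P.LocallyProjective)
    (hQ : Q.LocallyProjective) (h : LocEquiv P Q) :
    (K0.cls P hP - K0.cls Q hQ : K0Proj X G) ∈ sigmaKer (locEquivIdeal X G) :=
  OXGMod.sub_mem_sigmaKer hP hQ fun n => Ideal.subset_span ⟨n, _, _, _, _, h.sym n, rfl⟩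

theorem SymRing.component_cls_of_ne {m n : ℕ} (h : m ≠ n) (P : OXGMod X G) (hP : MemSym m P) :
    SymRing.component n (SymRing.cls m P hP) = 0 :=
  (K0.lift_cls _ _ (m, P) hP).trans (dif_neg h)

/-- A generator of the ideal times a class `[P]` is again a difference of locally isomorphic
modules, since tensoring preserves local isomorphism; in degree `n` such differences come from the
class group. -/
theorem component_mem_range [IrreducibleSpace X] {n : ℕ}
    (hn : ∀ P : OXGMod X G, MemSym n P → P.LocallyProjective) {x : SymRing X G}
    (hx : x ∈ locEquivIdeal X G) :
    K0.map hn (SymRing.component n x) ∈ (Cl.toK0 X G).range := by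
  -- The additional factor `r` makes the claim stable under the ring action in the induction over
  -- the ideal.
  suffices h : ∀ r : SymRing X G,
      K0.map hn (SymRing.component n (x * r)) ∈ (Cl.toK0 X G).range by
    simpa using h 1
  induction hx using Submodule.span_induction with
  | zero => intro r; rw [zero_mul, map_zero, map_zero]; exact zero_mem _
  | add a b _ _ ha hb =>
    intro r
    rw [add_mul, map_add, map_add]
    exact add_mem (ha r) (hb r)
  | smul s a _ ha =>
    intro r
    rw [smul_eq_mul, mul_comm s, mul_assoc]
    exact ha _
  | mem a ha =>
    obtain ⟨m, A, B, hA, hB, h, rfl⟩ := ha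
    intro r
    induction r using SymRing.induction with
    | zero => rw [mul_zero, map_zero, map_zero]; exact zero_mem _
    | neg r hr => rw [mul_neg, map_neg, map_neg]; exact neg_mem hr
    | add r r' hr hr' => rw [mul_add, map_add, map_add]; exact add_mem hr hr'
    | cls k P hP =>
      rw [sub_mul, SymRing.cls_mul_cls, SymRing.cls_mul_cls, map_sub]
      by_cases hk : m + k = n
      · subst hk
        rw [SymRing.component_cls, SymRing.component_cls, map_sub, K0.map_cls, K0.map_cls]
        exact (h.tensor_right P).sub_mem_range _ _
      · rw [SymRing.component_cls_of_ne hk, SymRing.component_cls_of_ne hk, sub_zero, map_zero]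
        exact zero_mem _

end LocEquiv

/-! ### Vanishing of products on the class group -/

section Modification

variable {X : Scheme.{u}} [IsDedekindScheme X] {G : Type v} [Group G] [Fintype G]

variable (X G) in
/-- The ideal generated by the differences of modifications along the complements of sets
in `𝒲`. -/
def modificationIdeal (𝒲 : Set (Set X)) : Ideal (SymRing X G) :=
  Ideal.span {x | ∃ W ∈ 𝒲, ∃ (n : ℕ) (A B : OXGMod X G) (hA : MemSym n A) (hB : MemSym n B),
    IsModification W B A ∧ x = SymRing.cls n A hA - SymRing.cls n B hB}

theorem closure_modificationDiff_le {𝒲 : Set (Set X)} (h𝒲 : ∀ W ∈ 𝒲, genericPoint X ∈ W) :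
    AddSubgroup.closure (modificationDiff X G 𝒲) ≤ sigmaKer (modificationIdeal X G 𝒲) := by
  rw [AddSubgroup.closure_le]
  rintro _ ⟨W, hW, A, B, hA, hB, h, rfl⟩
  exact sub_mem_sigmaKer hA hB fun n =>
    Ideal.subset_span ⟨W, hW, n, _, _, _, _, h.sym (h𝒲 W hW) hB.isVB n, rfl⟩

variable (X) in
/-- The open neighbourhoods of a point. -/
def openNhds (z : X) : Set (Set X) := {W | IsOpen W ∧ z ∈ W}

theorem genericPoint_mem_of_openNhds {z : X} {W : Set X} (hW : W ∈ openNhds X z) :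
    genericPoint X ∈ W :=
  genericPoint_mem (U := ⟨W, hW.1⟩) hW.2

theorem genericPoint_mem_of_punctured {W : Set X} (hW : W ∈ punctured X) : genericPoint X ∈ W := by
  obtain ⟨z, hz, rfl⟩ := hW
  exact hz.symm

omit [IsDedekindScheme X] in
theorem compl_union_eq_univ {z : X} {W : Set X} (hW : W ∈ openNhds X z) :
    {z}ᶜ ∪ W = Set.univ := by
  ext w
  by_cases h : w = z
  · simp [h, hW.2]
  · simp [h]

/-- Equal classes at the generic point force equal ranks, and locally free modules of equal rank are
locally isomorphic. -/
theorem Cl.exists_locEquiv (x : Cl X G) :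
    ∃ (P Q : OXGMod X G) (hP : P.LocallyFree) (hQ : Q.LocallyFree), LocEquiv P Q ∧
      Cl.toK0 X G x = K0.cls P hP.locallyProjective - K0.cls Q hQ.locallyProjective := by
  obtain ⟨x, hx⟩ := x
  obtain ⟨P, Q, hP, hQ, rfl⟩ := K0Free.exists_sub x
  rw [AddMonoidHom.mem_ker, map_sub, sub_eq_zero] at hx
  refine ⟨P, Q, hP, hQ, LocallyFree.locEquiv hP hQ hx, ?_⟩
  change K0Free.toProj X G (K0.cls P hP - K0.cls Q hQ) = _
  rw [K0Free.toProj, map_sub, K0.map_cls, K0.map_cls]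

/-- With a common modification `R` trivial near `z`, write `[P] - [Q] = ([P] - [R]) - ([Q] - [R])`.
-/
theorem Cl.toK0_mem_closure_openNhds (x : Cl X G) (z : X) :
    Cl.toK0 X G x ∈ AddSubgroup.closure (modificationDiff X G (openNhds X z)) := by
  obtain ⟨P, Q, hP, hQ, h, e⟩ := Cl.exists_locEquiv x
  obtain ⟨W, R, hW, hz, hR, h1, h2⟩ :=
    h.exists_modification hP.locallyProjective hQ.locallyProjective z
  rw [e, ← sub_sub_sub_cancel_right _ _ (K0.cls R hR)]
  exact sub_mem (AddSubgroup.subset_closure ⟨W, ⟨hW, hz⟩, _, _, _, _, h1, rfl⟩)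
    (AddSubgroup.subset_closure ⟨W, ⟨hW, hz⟩, _, _, _, _, h2, rfl⟩)

/-- A common modification trivial at the generic point is trivial outside finitely many closed
points, which can then be treated one by one. -/
theorem Cl.toK0_mem_closure_punctured (x : Cl X G) :
    Cl.toK0 X G x ∈ AddSubgroup.closure (modificationDiff X G (punctured X)) := by
  obtain ⟨P, Q, hP, hQ, h, e⟩ := Cl.exists_locEquiv x
  obtain ⟨W, R, hW, hz, hR, h1, h2⟩ :=
    h.exists_modification hP.locallyProjective hQ.locallyProjective (genericPoint X)
  have hS := finite_compl_of_isOpen hW hz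
  have hξ : genericPoint X ∉ Wᶜ := fun h => h hz
  rw [← compl_compl W] at h1 h2
  rw [e, ← sub_sub_sub_cancel_right _ _ (K0.cls R hR)]
  exact sub_mem (IsModification.sub_mem_closure hS hξ _ _ h1)
    (IsModification.sub_mem_closure hS hξ _ _ h2)

/-- The product on the locally free class group is trivial. -/
theorem projMul_toK0 (x y : Cl X G) : projMul X G (Cl.toK0 X G x) (Cl.toK0 X G y) = 0 := by
  -- First `x` is reduced to a modification at one closed point `z`; only then is `y` represented by
  -- modifications trivial near that `z`, so that the centres are disjoint.
  suffices h : AddSubgroup.closure (modificationDiff X G (punctured X)) ≤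
      ((projMul X G).flip (Cl.toK0 X G y)).ker from h (Cl.toK0_mem_closure_punctured x)
  rw [AddSubgroup.closure_le]
  rintro _ ⟨_, ⟨z, hz, rfl⟩, A, B, hA, hB, h, rfl⟩
  suffices h : AddSubgroup.closure (modificationDiff X G (openNhds X z)) ≤
      (projMul X G (K0.cls A hA - K0.cls B hB)).ker from h (Cl.toK0_mem_closure_openNhds y z)
  rw [AddSubgroup.closure_le]
  rintro _ ⟨W, hW, A', B', hA', hB', h', rfl⟩
  have hs := h.ses_koszul (compl_union_eq_univ hW) h' hB'.isVB
  have key := K0.cls_ses (hB.tensor hB') ((hA.tensor hB').prod (hB.tensor hA')) (hA.tensor hA') hs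
  rw [cls_prod (hA.tensor hB') (hB.tensor hA')] at key
  simp only [SetLike.mem_coe, AddMonoidHom.mem_ker, map_sub, AddMonoidHom.sub_apply, projMul_cls]
  rw [sub_sub_sub_eq, add_comm, ← key, add_comm, sub_self]

/-- The Koszul relation, now between classes in the graded ring. The element `b` must lie in the
ideal for every `z`, because the point is dictated by the generator occurring in `a`. -/
theorem mul_eq_zero_of_mem_modificationIdeal {a b : SymRing X G}
    (ha : a ∈ modificationIdeal X G (punctured X))
    (hb : ∀ z, b ∈ modificationIdeal X G (openNhds X z)) : a * b = 0 := by
  induction ha using Submodule.span_induction with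
  | zero => exact zero_mul b
  | add x y _ _ hx hy => rw [add_mul, hx, hy, add_zero]
  | smul r x _ hx => rw [smul_eq_mul, mul_assoc, hx, mul_zero]
  | mem x hx =>
    obtain ⟨_, ⟨z, hz, rfl⟩, n, A, B, hA, hB, h, rfl⟩ := hx
    replace hb := hb z
    induction hb using Submodule.span_induction with
    | zero => exact mul_zero _
    | add x y _ _ hx hy => rw [mul_add, hx, hy, add_zero]
    | smul r x _ hx => rw [smul_eq_mul, mul_left_comm, hx, mul_zero]
    | mem x hx =>
      obtain ⟨W, hW, m, A', B', hA', hB', h', rfl⟩ := hx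
      have hs := h.ses_koszul (compl_union_eq_univ hW) h' hB'.isVB
      have h1 := ses_prod (A.tensor B') (B.tensor A')
      have h2 : MemSym (n + m) ((A.tensor B').prod (B.tensor A')) := .ext h1
        ((hA.tensor hB').isVB.prod (hB.tensor hA').isVB).1 (hA.tensor hB') (hB.tensor hA')
      have key := SymRing.cls_ses (hB.tensor hB') h2 (hA.tensor hA') hs
      rw [SymRing.cls_ses (hA.tensor hB') h2 (hB.tensor hA') h1] at key
      rw [sub_mul, mul_sub, mul_sub, SymRing.cls_mul_cls, SymRing.cls_mul_cls,
        SymRing.cls_mul_cls, SymRing.cls_mul_cls, sub_sub_sub_eq, key, add_comm, sub_self]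

/-- The coefficients of the first factor come from modifications at single points, those of the
second from modifications trivial near any prescribed point. -/
theorem sigma_sub_one_mul_sigma_sub_one (x y : Cl X G) :
    (sigma (Cl.toK0 X G x) - 1) * (sigma (Cl.toK0 X G y) - 1) = 0 := by
  ext n
  rw [PowerSeries.coeff_mul, map_zero]
  refine Finset.sum_eq_zero fun p _ => mul_eq_zero_of_mem_modificationIdeal
    (coeff_sigma_sub_one_mem (closure_modificationDiff_le
      (fun _ => genericPoint_mem_of_punctured) (Cl.toK0_mem_closure_punctured x)) _)
    fun z => coeff_sigma_sub_one_mem (closure_modificationDiff_le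
      (fun _ => genericPoint_mem_of_openNhds) (Cl.toK0_mem_closure_openNhds y z)) _

/-- The symmetric power operations are additive on the locally free class group. -/
theorem sigmaM_toK0_add (n : ℕ+) (x y : Cl X G) :
    sigmaM n (Cl.toK0 X G (x + y)) = sigmaM n (Cl.toK0 X G x) + sigmaM n (Cl.toK0 X G y) := by
  apply inclM_injective n
  rw [map_add (inclM n), inclM_sigmaM, inclM_sigmaM, inclM_sigmaM, map_add, sigma_add]
  have h : sigma (Cl.toK0 X G x) * sigma (Cl.toK0 X G y) =
      sigma (Cl.toK0 X G x) + sigma (Cl.toK0 X G y) - 1 := by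
    -- Expanding the vanishing product shows that `σ(x) σ(y) - 1` is the sum of `σ(x) - 1` and `σ(y)
    -- - 1`; the constant `1` does not affect positive degrees.
    linear_combination sigma_sub_one_mul_sigma_sub_one x y
  rw [h, map_sub, map_add, PowerSeries.coeff_one, if_neg n.ne_zero, sub_zero]

/-- The symmetric power operations preserve the locally free class group. -/
theorem map_sigmaM_toK0_mem_range {n : ℕ+}
    (hn : ∀ P : OXGMod X G, InM n P → P.LocallyProjective) (x : Cl X G) :
    K0.map hn (sigmaM n (Cl.toK0 X G x)) ∈ (Cl.toK0 X G).range := by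
  obtain ⟨P, Q, hP, hQ, h, e⟩ := Cl.exists_locEquiv x
  have h1 := coeff_sigma_sub_one_mem
    (h.sub_mem_sigmaKer hP.locallyProjective hQ.locallyProjective) (n : ℕ)
  rw [map_sub, PowerSeries.coeff_one, if_neg n.ne_zero, sub_zero, ← e] at h1
  have h2 := component_mem_range (fun P hP => hn P (inM_iff.2 hP)) h1
  have h3 : (K0.map hn).comp (K0.map fun _ => inM_iff.2) =
      K0.map (ses := Ses) (fun P (hP : MemSym (n : ℕ) P) => hn P (inM_iff.2 hP)) :=
    K0.hom_ext fun P hP => by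
      rw [AddMonoidHom.comp_apply, K0.map_cls, K0.map_cls, K0.map_cls]
  rwa [← h3] at h2

end Modification

end OXGMod

end

theorem proposition2p6 (X : Scheme.{u}) [IsDedekindScheme X] (G : Type v) [Group G] [Finite G]
    (i : ℕ+) (hi : IsUnit ((Nat.gcd (i : ℕ) (Nat.card G) : ℕ) : Γ(X, ⊤))) :
    ∃ mul : K0Proj X G →+ K0Proj X G →+ K0Proj X G, IsTensorProductMap mul ∧
    ∃ μ : ∀ a b : ℕ+, K0M X G a →+ K0M X G b →+ K0M X G (a + b),
      (∀ a b : ℕ+, IsTensorProductMap (μ a b)) ∧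
    ∃ σ : ∀ n : ℕ+, K0Proj X G → K0M X G n, IsSymPowerHom μ σ ∧
    ∃ hM : ∀ P : OXGMod X G, OXGMod.InM i P → P.LocallyProjective,
      Function.Injective (Cl.toK0 X G) ∧
      (∀ x y : Cl X G, mul (Cl.toK0 X G x) (Cl.toK0 X G y) = 0) ∧
      ∃ s : Cl X G →+ Cl X G, ∀ x : Cl X G,
        Cl.toK0 X G (s x) = K0.map hM (σ i (Cl.toK0 X G x)) := by
  have := Fintype.ofFinite G
  have hM : ∀ P : OXGMod X G, OXGMod.InM i P → P.LocallyProjective := fun P hP =>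
    (OXGMod.inM_iff.1 hP).locallyProjective hi
  refine ⟨OXGMod.projMul X G, OXGMod.isTensorProductMap_projMul, OXGMod.gradedMul,
    OXGMod.isTensorProductMap_gradedMul, OXGMod.sigmaM, OXGMod.isSymPowerHom_sigmaM, hM,
    OXGMod.toK0_injective, OXGMod.projMul_toK0, ?_⟩
  choose s hs using OXGMod.map_sigmaM_toK0_mem_range hM
  -- The chosen preimages are unique because `κ` is injective, so additivity may be checked in
  -- `K_0(O_XG)`.
  refine ⟨AddMonoidHom.mk' s fun x y => OXGMod.toK0_injective ?_, hs⟩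
  rw [map_add (Cl.toK0 X G), hs, hs, hs, OXGMod.sigmaM_toK0_add, map_add]
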